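/- **Setting.** Let $A=\mathbb Z/d\mathbb Z$ with $2\le d<\infty$, or $A=\mathbb Z$ (degree $d=\infty$). Sequences are infinite sequences over $A\cup\{\star\}$, and $\sigma$ is the left shift. For sequences $a,b$ let $\operatorname{diff}(a,b)\in\{1,2,\dots\}\cup\{\infty\}$ be the first position where $a$ and $b$ differ, where $\star$ does not differ from any symbol. A *$\star$-periodic kneading sequence of period $p\ge2$* is a $p$-periodic sequence $\nu=\overline{\nu_1\cdots\nu_{p-1}\star}$ with $\nu_1=1$ and $\nu_2,\dots,\nu_{p-1}\in A$. The sequence $\star\nu$ is the critical point, $\nu$ is the critical value, and sequences $w\star\nu$ with $w$ a finite word over $A$ are precritical points of depth $|w|+1$. **Critical path.** Let $P_1=\{\star\nu\prec\nu\}$. Given the finite ordered set $P_n$, consider each pair $a\prec b$ of adjacent points, and let $k=\operatorname{diff}(a,b)$. If $k<\infty$, insert between $a$ and $b$ the point $w\star\nu$ with $|w|=k-1$, where $w$ does not differ from the first $k-1$ entries of $a$ and $b$. If $k=\infty$, nothing is ever inserted, and $(a,b)$ is a *gap*. This gives $P_{n+1}$; put $P_\infty=\bigcup_n P_n$. A sequence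 $c\in A^{\mathbb N}$ with $\operatorname{diff}(a,c)=\operatorname{diff}(c,b)=\infty$ for a gap $(a,b)$ is called the *central itinerary* of the gap; it is placed between $a$ and $b$, and is joined to $a$ and to $b$ by abstract intervals $[c,a]$, $[c,b]$. Nested adjacent pairs $(a_n,b_n)$ of $P_n$ without gaps define limit sequences $s\in A^{\mathbb N}$ (the points inserted into the successive pairs converge to $s$). If one end of these pairs is eventually a constant point $x\in P_\infty$, then $s$ is placed next to $x$ on the corresponding side, and is joined to $x$ by an abstract interval $[s,x]$. All these abstract intervals are called *Fatou intervals*. The *critical path* $C_\nu$ is the union of $P_\infty$, all limit sequences, all central itineraries and all Fatou intervals, with its order topology. **Hubbard tree.** The shift is extended to Fatou intervals by arbitrary homeomorphisms $[u,c]\to[\sigma u,\sigma c]$ respecting endpoints. The Hubbard tree is $\mathcal H(\nu)=\bigcup_{n\ge0}\sigma^n(C_\nu)$ (points with equal itineraries are identified), with the quotient topology coming from the maps $\sigma^k\colon C_\nu\to\mathcal H(\nu)$, $0\le k\le p-1$. The *branches* at $\tau\in\mathcal H(\nu)$ are the components of $\mathcal H(\nu)\setminus\{\tau\}$; their germs at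 $\tau$ are the local arms, on which iterates of $\sigma$ act as long as the critical point is not met. A point $\tau$ is *characteristic* if a single component of $\mathcal H(\nu)\setminus\{\tau\}$ contains $\star\nu$ and all points of the orbit of $\tau$ other than $\tau$, but not $\nu$. A periodic orbit avoiding $\star\nu$ is of *primitive type* if each of its points has exactly two branches, fixed (locally) by the first return map; of *satellite type* if each of its points has at least two branches, permuted transitively and cyclically by the first return map; of *evil type* if each of its points has at least three branches, permuted non-transitively, and at the characteristic point of the orbit the first return map fixes the arm towards $\star\nu$ and permutes all other arms transitively and cyclically. **Bifurcations.** $\nu$ is a *bifurcation from period $q$* if $q\mid p$, $q<p$ and $\overline{\nu_1\cdots\nu_{p-1}e}$ has exact period $q$ for some $e\in A$. The *internal address* of $\nu$ is $S_0=1\to S_1\to\cdots$, where $S_{n+1}$ is the first position at which $\nu$ differs from $\overline{\nu_1\cdots\nu_{S_n}}$ (here $\star$ counts as different from all symbols of $A$; the address ends with $p$). A bifurcation from period $q$ is *standard* if $q$ occurs in the internal address of $\nu$, and *non-standard* otherwise. **Proposition (Classification of $\star$-periodic kneading sequences).** Let $\nu$ be a $\star$-periodic kneading sequence of period $p\ge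 2$. There is a unique sequence $\omega\in A^{\mathbb N}$ such that $[\omega,\nu]$ is a Fatou interval on the critical path (the *lower sequence* of $\nu$). The point $\omega$ of $\mathcal H(\nu)$ is characteristic, and: 1. if $\nu$ is not a bifurcation, then $\omega$ has exact period $p$, its orbit is of primitive type, and every point of $\mathcal H(\nu)$ that some iterate $\sigma^n$, $n\ge0$, maps to $\omega$ has exactly two branches; 2. if $\nu$ is a standard bifurcation from period $q$, then $\omega$ has exact period $q$, it is a central itinerary, it has exactly $p/q$ branches, and its orbit is of satellite type; 3. if $\nu$ is a non-standard bifurcation from period $q$, then $\omega$ has exact period $q$, it has exactly $p/q+1$ branches, and its orbit is of evil type. Gaps, and hence central itineraries, occur only if $\nu$ is a standard bifurcation. -/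

import Mathlib

namespace Kneading

open Filter Topology

/-- Infinite sequences over the alphabet `A` together with the extra symbol `⋆`, which is `none`.
The entry number `i + 1` of a sequence `s` is `s i`. -/
abbrev Itin (A : Type*) := ℕ → Option A

variable {A : Type*}

/-- The left shift on sequences. -/
def shift (s : Itin A) : Itin A := fun n => s (n + 1)

/-- `s` has no entry `⋆`, i.e. it is a sequence over `A`. -/
def StarFree (s : Itin A) : Prop := ∀ n, s n ≠ none

/-- `ν` is a `⋆`-periodic kneading sequence of (exact) period `p`: it is periodic, `⋆` occurs
exactly once in the period, at the last position, and the first symbol is `1`.  The trivial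
sequence (`p = 1`) is excluded. -/
structure IsStarPeriodic [One A] (ν : Itin A) (p : ℕ) : Prop where
  two_le : 2 ≤ p
  first : ν 0 = some 1
  periodic : ∀ n, ν (n + p) = ν n
  star_iff : ∀ n, ν n = none ↔ p ∣ n + 1

/-- The sequence `⋆ν`: the critical point. -/
def crit (ν : Itin A) : Itin A
  | 0 => none
  | n + 1 => ν n

/-- Position of the first difference of two sequences, where `⋆` does not differ from any symbol;
it is `⊤` if there is no difference. -/
noncomputable def diff (a b : Itin A) : ℕ∞ :=
  sInf {k : ℕ∞ | ∃ i : ℕ, k = (i : ℕ∞) + 1 ∧ a i ≠ none ∧ b i ≠ none ∧ a i ≠ b i}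

open Classical in
/-- For `k = diff a b < ⊤`, the sequence `w⋆ν` with `|w| = k - 1`, where each entry of `w` is the
entry of `a` or, if that is `⋆`, the entry of `b`. -/
noncomputable def mid (ν a b : Itin A) : Itin A := fun i =>
  if (i : ℕ∞) + 1 < diff a b then (if a i = none then b i else a i)
  else if (i : ℕ∞) + 1 = diff a b then none
  else ν (i - (diff a b).toNat)

/-! ### Precritical points on the critical path -/

/-- A pair `l ≺ r` of adjacent points together with their values `x = φ(l)` and `y = φ(r)`. -/
structure Arc (A : Type*) where
  l : Itin A
  r : Itin A
  x : ℝ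
  y : ℝ

open Classical in
/-- One step of the construction: if `diff l r = ⊤`, nothing is ever inserted between `l` and `r`;
otherwise a precritical point is inserted, with the mean value of `φ`, and we pass to the right
half (if `c = true`) or to the left half (if `c = false`). -/
noncomputable def refine (ν : Itin A) (I : Arc A) (c : Bool) : Arc A :=
  if diff I.l I.r = ⊤ then I
  else if c then ⟨mid ν I.l I.r, I.r, (I.x + I.y) / 2, I.y⟩
  else ⟨I.l, mid ν I.l I.r, I.x, (I.x + I.y) / 2⟩

/-- The adjacent pairs of `P_{n+1}` are exactly the pairs `arc ν b n`, where `b` runs through all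
sequences of left/right choices. The set `P_1` is `{⋆ν ≺ ν}` with `φ(⋆ν) = 0` and `φ(ν) = 1`. -/
noncomputable def arc (ν : Itin A) (b : ℕ → Bool) : ℕ → Arc A
  | 0 => ⟨crit ν, ν, 0, 1⟩
  | n + 1 => refine ν (arc ν b n) (b n)

/-- The case `diff = ⊤` occurs for the adjacent pair `I`: there is a gap in `P_∞`. -/
def IsGap (I : Arc A) : Prop := diff I.l I.r = ⊤

/-- `c` is the central itinerary in the gap `I`. -/
def IsCentralIn (c : Itin A) (I : Arc A) : Prop :=
  IsGap I ∧ StarFree c ∧ diff I.l c = ⊤ ∧ diff c I.r = ⊤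

/-- `c` is a central itinerary, i.e. the one in some gap of the critical path. -/
def IsCentral (ν c : Itin A) : Prop := ∃ b n, IsCentralIn c (arc ν b n)

/-- `s` is the limit point in `L_ν` of the nested adjacent pairs given by the choices `b`: a
point is inserted in every step, and these points converge to `s`. -/
structure IsLimit (ν : Itin A) (b : ℕ → Bool) (s : Itin A) : Prop where
  starFree : StarFree s
  no_gap : ∀ n, ¬ IsGap (arc ν b n)
  lim : Tendsto (fun n => diff (mid ν (arc ν b n).l (arc ν b n).r) s) atTop (𝓝 ⊤)

/-! ### The critical path -/

/-- Points of the critical path and of the Hubbard tree: itineraries, and the interior points of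
the abstract Fatou intervals `[u, c]`, with `u` a sequence without `⋆`, `c = w⋆ν` and a coordinate
`t` in `(0,1)` which increases from `u` to `c`. -/
inductive Pt (A : Type*) where
  | itin (s : Itin A) : Pt A
  | fatou (u c : Itin A) (t : Set.Ioo (0 : ℝ) 1) : Pt A

/-- `OnPath ν z k`: the point `z` lies on the critical path of `ν`, at the position `k`. Positions
are ordered lexicographically: the first component is the value of `φ`; the second one separates
a precritical point (second component `0`) from the limit points in `M_ν` with the same value of
`φ` which are approximated from its left (`-1`) or from its right (`1`), with a Fatou interval
inserted in between. A gap is filled by two Fatou intervals which meet at the central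
itinerary. -/
inductive OnPath (ν : Itin A) : Pt A → ℝ ×ₗ ℝ → Prop
  /- the precritical points, `P_∞` -/
  | left (b n) : OnPath ν (.itin (arc ν b n).l) (toLex ((arc ν b n).x, 0))
  | right (b n) : OnPath ν (.itin (arc ν b n).r) (toLex ((arc ν b n).y, 0))
  /- limit points where no endpoint of the nested pairs is eventually constant, `L_ν ∖ M_ν` -/
  | limit (b s v) : IsLimit ν b s → (∀ n, ∃ k ≥ n, b k = true) → (∀ n, ∃ k ≥ n, b k = false) →
      Tendsto (fun n => (arc ν b n).x) atTop (𝓝 v) → OnPath ν (.itin s) (toLex (v, 0))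
  /- limit points in `M_ν`, on the left of the precritical point `r` -/
  | limitL (b s n) : IsLimit ν b s → (∀ k ≥ n, b k = true) →
      OnPath ν (.itin s) (toLex ((arc ν b n).y, -1))
  | fatouL (b s n) (t : Set.Ioo (0 : ℝ) 1) : IsLimit ν b s → (∀ k ≥ n, b k = true) →
      OnPath ν (.fatou s (arc ν b n).r t) (toLex ((arc ν b n).y, -1 + (t : ℝ)))
  /- limit points in `M_ν`, on the right of the precritical point `l` -/
  | limitR (b s n) : IsLimit ν b s → (∀ k ≥ n, b k = false) →
      OnPath ν (.itin s) (toLex ((arc ν b n).x, 1))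
  | fatouR (b s n) (t : Set.Ioo (0 : ℝ) 1) : IsLimit ν b s → (∀ k ≥ n, b k = false) →
      OnPath ν (.fatou s (arc ν b n).l t) (toLex ((arc ν b n).x, 1 - (t : ℝ)))
  /- gaps -/
  | central (b c n) : IsCentralIn c (arc ν b n) →
      OnPath ν (.itin c) (toLex (((arc ν b n).x + (arc ν b n).y) / 2, 0))
  | gapL (b c n) (t : Set.Ioo (0 : ℝ) 1) : IsCentralIn c (arc ν b n) →
      OnPath ν (.fatou c (arc ν b n).l t) (toLex
        (((arc ν b n).x + (arc ν b n).y) / 2 - t * (((arc ν b n).y - (arc ν b n).x) / 2), 0))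
  | gapR (b c n) (t : Set.Ioo (0 : ℝ) 1) : IsCentralIn c (arc ν b n) →
      OnPath ν (.fatou c (arc ν b n).r t) (toLex
        (((arc ν b n).x + (arc ν b n).y) / 2 + t * (((arc ν b n).y - (arc ν b n).x) / 2), 0))

/-- The critical path `C_ν`, a set of points. -/
def critPath (ν : Itin A) : Set (Pt A) := {z | ∃ k, OnPath ν z k}

/-- The order `≺` on the critical path. -/
def Prec (ν : Itin A) (z w : Pt A) : Prop := ∃ k l, OnPath ν z k ∧ OnPath ν w l ∧ k < l

/-- The order topology on the critical path. -/
instance critPathTopology (ν : Itin A) : TopologicalSpace (critPath ν) :=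
  TopologicalSpace.generateFrom
    {U | ∃ c : critPath ν, U = {z | Prec ν z c} ∨ U = {z | Prec ν c z}}

/-! ### The Hubbard tree -/

/-- A choice of homeomorphisms, for each Fatou interval `[u, c]`, onto `[shift u, shift c]`
that respect the endpoints, written in the coordinates `t`. -/
abbrev FatouMaps (A : Type*) := Itin A → Itin A → (Set.Ioo (0 : ℝ) 1 ≃o Set.Ioo (0 : ℝ) 1)

/-- The dynamics: the shift on itineraries, extended to the Fatou intervals. -/
def step (h : FatouMaps A) : Pt A → Pt A
  | .itin s => .itin (shift s)
  | .fatou u c t => .fatou (shift u) (shift c) (h u c t)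

/-- The Hubbard tree of a `⋆`-periodic kneading sequence `ν` of period `p`: the union of all
iterated images of the critical path. -/
def HubbardTree (h : FatouMaps A) (ν : Itin A) (_p : ℕ) :=
  {z : Pt A // ∃ n : ℕ, ∃ c : critPath ν, (step h)^[n] c = z}

variable {h : FatouMaps A} {ν : Itin A} {p : ℕ}

/-- The `n`-th iterate as a map from the critical path to the Hubbard tree. -/
def pathToTree (h : FatouMaps A) (ν : Itin A) (p n : ℕ) (c : critPath ν) : HubbardTree h ν p :=
  ⟨(step h)^[n] c, n, c, rfl⟩

/-- The topology of the finite tree `H_{p-1}`, the union of the images of `C_ν` under the iterates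
`0, …, p - 1`: a set is open iff its preimages in `C_ν` under these iterates are open. (Since
`C_ν` is cut by the precritical points of depth at most `k` into finitely many closed intervals on
which the `k`-th iterate is injective, this says that the set has open intersection with the image
of each of them.) -/
instance treeTopology : TopologicalSpace (HubbardTree h ν p) :=
  ⨆ k : Fin p, TopologicalSpace.coinduced (pathToTree h ν p k) inferInstance

/-- The dynamics on the Hubbard tree. -/
def treeMap (z : HubbardTree h ν p) : HubbardTree h ν p :=
  ⟨step h z.1, by
    obtain ⟨n, c, hc⟩ := z.2
    exact ⟨n + 1, c, by rw [Function.iterate_succ_apply', hc]⟩⟩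

theorem crit_mem (ν : Itin A) : Pt.itin (crit ν) ∈ critPath ν :=
  ⟨_, OnPath.left (fun _ => true) 0⟩

theorem value_mem (ν : Itin A) : Pt.itin ν ∈ critPath ν :=
  ⟨_, OnPath.right (fun _ => true) 0⟩

/-- The critical point `⋆ν` of the tree. -/
def critPoint : HubbardTree h ν p := pathToTree h ν p 0 ⟨_, crit_mem ν⟩

/-- The critical value `ν` of the tree. -/
def critValue : HubbardTree h ν p := pathToTree h ν p 0 ⟨_, value_mem ν⟩

/-- The global arms (branches) at `τ`: the connected components of the complement of `τ`. -/
def arms (τ : HubbardTree h ν p) : Set (Set (HubbardTree h ν p)) :=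
  {G | ∃ x, x ≠ τ ∧ G = connectedComponentIn {τ}ᶜ x}

/-- `τ` is a characteristic point. -/
def IsCharacteristic (τ : HubbardTree h ν p) : Prop :=
  ∃ G ∈ arms τ, critPoint ∈ G ∧ (∀ n : ℕ, treeMap^[n] τ ≠ τ → treeMap^[n] τ ∈ G) ∧ critValue ∉ G

/-- The `n`-th iterate maps the local arm at `τ` in `G` to the local arm in `G'` at the image
of `τ`: small neighbourhoods of `τ`, restricted to `G`, are mapped into `G'`. -/
def LocalArmMap (n : ℕ) (τ : HubbardTree h ν p) (G G' : Set (HubbardTree h ν p)) : Prop :=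
  ∀ᶠ z in 𝓝[G] τ, treeMap^[n] z ∈ G'

/-- The first return map of the periodic point `τ` permutes the local arms at `τ` by `f`. -/
def ReturnPermutes (τ : HubbardTree h ν p) (f : Equiv.Perm (arms τ)) : Prop :=
  ∀ G : arms τ, LocalArmMap (Function.minimalPeriod treeMap τ) τ G (f G)

/-- `τ` is periodic and its orbit does not contain the critical point. -/
def NoncriticalPeriodic (τ : HubbardTree h ν p) : Prop :=
  τ ∈ Function.periodicPts treeMap ∧ ∀ k : ℕ, treeMap^[k] τ ≠ critPoint

/-- The periodic orbit of `τ` is of primitive type: each of its points has exactly two branches,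
and these are fixed locally by the first return map. -/
def PrimitiveType (τ : HubbardTree h ν p) : Prop :=
  NoncriticalPeriodic τ ∧ ∀ k : ℕ, (arms (treeMap^[k] τ)).encard = 2 ∧
    ReturnPermutes (treeMap^[k] τ) (Equiv.refl _)

/-- The periodic orbit of `τ` is of satellite type: each of its points has at least two branches,
and these are permuted transitively and cyclically by the first return map. -/
def SatelliteType (τ : HubbardTree h ν p) : Prop :=
  NoncriticalPeriodic τ ∧ ∀ k : ℕ, 2 ≤ (arms (treeMap^[k] τ)).encard ∧
    ∃ f, ReturnPermutes (treeMap^[k] τ) f ∧ f.IsCycleOn Set.univ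

/-- The periodic orbit of `τ` is of evil type: each of its points has at least three branches,
which are permuted non-transitively by the first return map, and at the characteristic point of
the orbit the first return map fixes the arm towards the critical point and permutes all other
arms transitively and cyclically. -/
def EvilType (τ : HubbardTree h ν p) : Prop :=
  NoncriticalPeriodic τ ∧
  (∀ k : ℕ, 3 ≤ (arms (treeMap^[k] τ)).encard ∧
    ∃ f, ReturnPermutes (treeMap^[k] τ) f ∧ ¬ ∀ G G', f.SameCycle G G') ∧
  ∃ k : ℕ, IsCharacteristic (treeMap^[k] τ) ∧
    ∃ f, ReturnPermutes (treeMap^[k] τ) f ∧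
      ∃ G₀ : arms (treeMap^[k] τ), critPoint ∈ (G₀ : Set (HubbardTree h ν p)) ∧ f G₀ = G₀ ∧
        f.IsCycleOn {G | G ≠ G₀}

/-- `ω` is a lower sequence of `ν`: a sequence without `⋆` such that `[ω, ν]` is a Fatou interval
on the critical path. -/
def IsLowerSequence (ν ω : Itin A) : Prop :=
  StarFree ω ∧ ∀ t, Pt.fatou ω ν t ∈ critPath ν

/-! ### Bifurcations -/

/-- All entries `⋆` of `s` are replaced by the symbol `e`. -/
def fill (e : A) (s : Itin A) : Itin A := fun n => some ((s n).getD e)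

/-- The `⋆`-periodic sequence `ν` of period `p` is a bifurcation from period `q`, i.e. its base
sequence has period `q`. -/
def IsBifurcation (ν : Itin A) (p q : ℕ) : Prop :=
  q ∣ p ∧ q < p ∧ ∃ e : A, Function.minimalPeriod shift (fill e ν) = q

/-- The entries of the internal address of `ν`. For an entry `S`, the next entry is the first
position at which `ν` differs from the `S`-periodic sequence that has the same first `S` entries as
`ν`, if there is such a position. (Here `⋆` counts as different from the symbols in `A`, so that
the internal address of a `⋆`-periodic sequence ends with its period.) -/
inductive InternalAddress (ν : Itin A) : ℕ → Prop
  | one : InternalAddress ν 1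
  | next (S T : ℕ) : InternalAddress ν S →
      IsLeast {k | 1 ≤ k ∧ ν (k - 1) ≠ ν ((k - 1) % S)} T → InternalAddress ν T

/-- `ν` is a standard bifurcation from period `q`. -/
def IsStandardBifurcation (ν : Itin A) (p q : ℕ) : Prop :=
  IsBifurcation ν p q ∧ InternalAddress ν q

/-- `ν` is a non-standard bifurcation from period `q`. -/
def IsNonstandardBifurcation (ν : Itin A) (p q : ℕ) : Prop :=
  IsBifurcation ν p q ∧ ¬ InternalAddress ν q

end Kneading

open Kneading

namespace Kneading

open Filter Topology

set_option linter.unusedSectionVars false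

variable {A : Type*}

/-! ### Following a sequence relative to a base sequence -/

/-! Everything rests on one symbolic device. If the first entries of `τ` and `x` differ, the
critical point lies between them, so from `τ` the point `x` is seen in the same direction as `⋆ν`
and may be replaced by it. Hence `x` is followed from `τ` by shifting as long as the entries agree
and by resetting to `ν` otherwise (`track`); two points are in the same direction from `τ` exactly
when their tracks merge (`SameSide`). The proof has a symbolic half about tracks and a topological
half showing that these directions are the branches.

Symbolic half. Some point of the orbit of `ν` has all others on one side (`exists_endpoint`). Pulled
back to `ν`, this gives a symbol `e` in whose direction all other postcritical points are seen
(`exists_lastSymbol`). The lower sequence is `ω = fill e ν`, of exact period `q`. It separates `ν`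
from the rest of the postcritical orbit (`not_sameSide_fill`), and the other points of its own orbit
lie on the critical side (`sameSide_crit_of_ne`), so it is characteristic. The first return map at
`ω` takes the critical side either to the side of `ν` or to itself (`track_crit_orbit`), and every
other side is that of some `shift^[s * q] ν`. Those `p / q` sides are permuted cyclically. In the
first case there are no further sides, which is the satellite picture. In the second the critical
side is one additional fixed side: for `q < p` this is the evil picture, for `q = p` the primitive
one. For `q < p` the internal address decides, because the critical point followed along `ω` is at
`ν` exactly at the times in the address (`internalAddress_iff`). Any symbol that shortens the period
must be `e` (`eq_of_minimalPeriod_lt`), so the `q` of a bifurcation is the period of `ω`.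

Topological half. A sequence without `⋆` is on the critical path if and only if it separates `⋆ν`
from `ν`, and the nested pairs around it are the closest precritical points `cur`
(`Lies.exists_surrounds`, `exists_lies_of_sep`). Positions make the path a dense complete order, so
its intervals are connected. Sides are open in the tree (`isOpen_arm`). Conversely each component of
the complement of `τ` contains all sufficiently close precritical points in some direction
(`exists_germ_in_component`), and these depend only on the side (`cur_eventually_eq`). So components
are sides (`connectedComponentIn_eq_arm`), and the return map acts on them as tracks do
(`localArmMap`).

Gaps are treated by `track_crit_of_gap`, where a descent excludes that the critical side is fixed;
uniqueness of `ω` is `eq_fill_of_compat`. -/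

/-- `Post ν x`: the sequence `x` lies on the orbit of `ν`. -/
def Post (ν x : Itin A) : Prop := ∃ i, x = shift^[i] ν

open Classical in
/-- The sequence `x` seen from `τ`: both are shifted as long as the first entries agree, and
otherwise `x` is replaced by the critical point before the shift is applied. -/
noncomputable def track (ν τ x : Itin A) : ℕ → Itin A
  | 0 => x
  | n + 1 => if track ν τ x n 0 = τ n then shift (track ν τ x n) else ν

/-- The sequences `x` and `y` lie on the same side of `τ`. -/
def SameSide (ν τ x y : Itin A) : Prop := ∃ n, track ν τ x n = track ν τ y n

theorem shift_iterate_apply (s : Itin A) (i n : ℕ) : shift^[i] s n = s (n + i) := by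
  induction i generalizing n with
  | zero => rfl
  | succ i ih => rw [Function.iterate_succ_apply', shift, ih]; congr 1; omega

theorem shift_iterate_add (s : Itin A) (i j : ℕ) :
    shift^[i] (shift^[j] s) = shift^[i + j] s := (Function.iterate_add_apply _ _ _ _).symm

theorem shift_iterate_comm (s : Itin A) (i j : ℕ) :
    shift^[i] (shift^[j] s) = shift^[j] (shift^[i] s) := by
  rw [shift_iterate_add, shift_iterate_add, Nat.add_comm]

section track

variable {ν τ τ' x y z : Itin A}

theorem track_succ_of_eq {n : ℕ} (h : track ν τ x n 0 = τ n) :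
    track ν τ x (n + 1) = shift (track ν τ x n) := by
  rw [track, if_pos h]

theorem track_succ_of_ne {n : ℕ} (h : track ν τ x n 0 ≠ τ n) : track ν τ x (n + 1) = ν := by
  rw [track, if_neg h]

theorem track_add (m n : ℕ) :
    track ν τ x (m + n) = track ν (shift^[m] τ) (track ν τ x m) n := by
  induction n with
  | zero => rfl
  | succ n ih =>
    have : (shift^[m] τ) n = τ (m + n) := by rw [shift_iterate_apply, Nat.add_comm]
    rw [← Nat.add_assoc, track, track, ih, this]

theorem track_congr {n : ℕ} (h : ∀ i < n, τ i = τ' i) : track ν τ x n = track ν τ' x n := by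
  induction n with
  | zero => rfl
  | succ n ih =>
    rw [track, track, ih fun i hi => h i (by omega), h n (by omega)]

theorem track_eq_of_le {m n : ℕ} (h : track ν τ x m = track ν τ y m) (hmn : m ≤ n) :
    track ν τ x n = track ν τ y n := by
  obtain ⟨k, rfl⟩ := Nat.exists_eq_add_of_le hmn
  rw [track_add, track_add, h]

theorem track_eq_of_ne_of_ne {n : ℕ} (hx : track ν τ x n 0 ≠ τ n) (hy : track ν τ y n 0 ≠ τ n) :
    track ν τ x (n + 1) = track ν τ y (n + 1) := by
  rw [track_succ_of_ne hx, track_succ_of_ne hy]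

/-- As long as there are no differences, following a sequence means to shift it. -/
theorem track_eq_shift {n : ℕ} (hx : ∀ i < n, x i = none → shift^[i + 1] x = ν)
    (h : ∀ i < n, x i = none ∨ x i = τ i) : track ν τ x n = shift^[n] x := by
  induction n with
  | zero => rfl
  | succ n ih =>
    have ih := ih (fun i hi => hx i (by omega)) fun i hi => h i (by omega)
    have h0 : track ν τ x n 0 = x n := by rw [ih, shift_iterate_apply, Nat.zero_add]
    by_cases hn : x n = τ n
    · rw [track_succ_of_eq (h0.trans hn), ih, Function.iterate_succ_apply']
    · rw [track_succ_of_ne (by rwa [h0])]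
      exact (hx n (by omega) ((h n (by omega)).resolve_right hn)).symm

theorem SameSide.refl : SameSide ν τ x x := ⟨0, rfl⟩

theorem SameSide.symm (h : SameSide ν τ x y) : SameSide ν τ y x := h.imp fun _ h => h.symm

theorem SameSide.trans (h : SameSide ν τ x y) (h' : SameSide ν τ y z) : SameSide ν τ x z := by
  obtain ⟨m, hm⟩ := h
  obtain ⟨n, hn⟩ := h'
  exact ⟨max m n, (track_eq_of_le hm (le_max_left _ _)).trans
    (track_eq_of_le hn (le_max_right _ _))⟩

/-- Merged tracks stay merged, so the comparison may be started at any later time. In this form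
sides are transported by the dynamics, and injectively. -/
theorem sameSide_track (n : ℕ) :
    SameSide ν (shift^[n] τ) (track ν τ x n) (track ν τ y n) ↔ SameSide ν τ x y := by
  constructor
  · rintro ⟨m, hm⟩
    exact ⟨n + m, by rw [track_add, track_add, hm]⟩
  · rintro ⟨m, hm⟩
    exact ⟨m, by rw [← track_add, ← track_add]; exact track_eq_of_le hm (by omega)⟩

theorem SameSide.eventually (h : SameSide ν τ x y) :
    ∀ᶠ n in atTop, track ν τ x n = track ν τ y n := by
  obtain ⟨m, hm⟩ := h
  exact eventually_atTop.2 ⟨m, fun n hn => track_eq_of_le hm hn⟩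

theorem exists_first_ne (h : τ ≠ τ') : ∃ n, τ n ≠ τ' n ∧ ∀ i < n, τ i = τ' i := by
  classical
  have h : ∃ n, τ n ≠ τ' n := Function.ne_iff.1 h
  exact ⟨Nat.find h, Nat.find_spec h, fun i hi => not_not.1 (Nat.find_min h hi)⟩

theorem track_eq_shift_of_eq {n : ℕ} (h : ∀ i < n, x i = τ i) :
    track ν τ x n = shift^[n] x := by
  induction n with
  | zero => rfl
  | succ n ih =>
    have ih := ih fun i hi => h i (by omega)
    rw [track_succ_of_eq (by rw [ih, shift_iterate_apply, Nat.zero_add, h n (by omega)]), ih,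
      Function.iterate_succ_apply']

/-- If `x` and `b` lie on different sides of `a`, then `x` and `a` lie on the same side of `b`. -/
theorem sameSide_of_not_sameSide {a b : Itin A} (hab : a ≠ b) (h : ¬ SameSide ν a x b) :
    SameSide ν b x a := by
  obtain ⟨n, hn, hlt⟩ := exists_first_ne hab
  -- At the first difference of `a` and `b`, each is reset as seen from the other. A point `x` that
  -- is not reset at `a` there has the entry `a n ≠ b n`, so it is reset at `b`, together with `a`.
  have hb : track ν a b n 0 ≠ a n := by
    rw [track_eq_shift_of_eq fun i hi => (hlt i hi).symm, shift_iterate_apply, Nat.zero_add]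
    exact hn.symm
  have ha : track ν b a n 0 ≠ b n := by
    rw [track_eq_shift_of_eq fun i hi => hlt i hi, shift_iterate_apply, Nat.zero_add]
    exact hn
  have hx : track ν a x n 0 = a n := by
    by_contra hx
    exact h ⟨n + 1, track_eq_of_ne_of_ne hx hb⟩
  refine ⟨n + 1, track_eq_of_ne_of_ne ?_ ha⟩
  rwa [← track_congr hlt, hx]

end track

/-! ### Tracks of postcritical points, and the direction of the orbit as seen from the critical
value. -/

section starPeriodic

variable [One A] {ν τ x y z : Itin A} {p : ℕ}

theorem IsStarPeriodic.pos (hν : IsStarPeriodic ν p) : 0 < p := by have := hν.two_le; omega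

theorem IsStarPeriodic.add_mul (hν : IsStarPeriodic ν p) (n k : ℕ) : ν (n + p * k) = ν n := by
  induction k with
  | zero => rfl
  | succ k ih => rw [Nat.mul_succ, ← Nat.add_assoc, hν.periodic, ih]

theorem IsStarPeriodic.shift_period (hν : IsStarPeriodic ν p) : shift^[p] ν = ν :=
  funext fun n => by rw [shift_iterate_apply, hν.periodic]

theorem IsStarPeriodic.shift_of_dvd (hν : IsStarPeriodic ν p) {n : ℕ} (h : p ∣ n) :
    shift^[n] ν = ν := by
  obtain ⟨k, rfl⟩ := h
  exact funext fun n => by rw [shift_iterate_apply, hν.add_mul]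

theorem IsStarPeriodic.shift_eq_iff (hν : IsStarPeriodic ν p) {i j : ℕ} :
    shift^[i] ν = shift^[j] ν ↔ i ≡ j [MOD p] := by
  have key : ∀ i j, i ≤ j → (shift^[i] ν = shift^[j] ν ↔ i ≡ j [MOD p]) := by
    intro i j hij
    rw [Nat.modEq_iff_dvd' hij]
    constructor
    · intro h
      -- A `⋆` whose index is at least `i`, so that it is still visible after `i` shifts.
      have hi : ν (p * (i + 1) - 1) = none := by
        rw [hν.star_iff]
        have : 1 ≤ p * (i + 1) := Nat.mul_pos hν.pos (by omega)
        rw [Nat.sub_add_cancel this]; exact ⟨_, rfl⟩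
      have hle : i + 1 ≤ p * (i + 1) := Nat.le_mul_of_pos_left _ hν.pos
      have := congrFun h (p * (i + 1) - 1 - i)
      rw [shift_iterate_apply, shift_iterate_apply, Nat.sub_add_cancel (by omega), hi, eq_comm,
        hν.star_iff] at this
      have h2 : p * (i + 1) - 1 - i + j + 1 = p * (i + 1) + (j - i) := by omega
      rw [h2] at this
      exact (Nat.dvd_add_right ⟨_, rfl⟩).1 this
    · rintro ⟨k, hk⟩
      funext n
      rw [shift_iterate_apply, shift_iterate_apply, show n + j = n + i + p * k by omega,
        hν.add_mul]
  rcases le_total i j with h | h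
  · exact key i j h
  · rw [eq_comm, key j i h]; exact ⟨Nat.ModEq.symm, Nat.ModEq.symm⟩

theorem IsStarPeriodic.shift_eq_self_iff (hν : IsStarPeriodic ν p) {i : ℕ} :
    shift^[i] ν = ν ↔ p ∣ i := by
  have := hν.shift_eq_iff (i := i) (j := 0)
  rw [Function.iterate_zero_apply] at this
  rw [this, Nat.modEq_zero_iff_dvd]

theorem IsStarPeriodic.shift_of_star (hν : IsStarPeriodic ν p) {i n : ℕ}
    (h : shift^[i] ν n = none) : shift^[n + 1] (shift^[i] ν) = ν := by
  rw [shift_iterate_apply, hν.star_iff] at h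
  rw [shift_iterate_add, hν.shift_eq_self_iff]
  convert h using 1; omega

theorem IsStarPeriodic.crit_eq (hν : IsStarPeriodic ν p) : crit ν = shift^[p - 1] ν := by
  funext n
  rw [shift_iterate_apply]
  cases n with
  | zero =>
    rw [crit, eq_comm, hν.star_iff, show 0 + (p - 1) + 1 = p by have := hν.pos; omega]
  | succ n =>
    rw [crit, show n + 1 + (p - 1) = n + p by have := hν.pos; omega, hν.periodic]

theorem post_crit (hν : IsStarPeriodic ν p) : Post ν (crit ν) := ⟨_, hν.crit_eq⟩

theorem post_self : Post ν ν := ⟨0, rfl⟩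

theorem Post.shift_mem (h : Post ν x) : Post ν (shift x) := by
  obtain ⟨i, rfl⟩ := h
  exact ⟨i + 1, (Function.iterate_succ_apply' _ _ _).symm⟩

theorem Post.track_mem (h : Post ν x) (n : ℕ) : Post ν (track ν τ x n) := by
  induction n with
  | zero => exact h
  | succ n ih =>
    rw [track]
    split_ifs
    · exact ih.shift_mem
    · exact post_self

theorem Post.exists_lt (hν : IsStarPeriodic ν p) (h : Post ν x) : ∃ i < p, x = shift^[i] ν := by
  obtain ⟨i, rfl⟩ := h
  exact ⟨i % p, Nat.mod_lt _ hν.pos, hν.shift_eq_iff.2 (Nat.mod_modEq _ _).symm⟩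

theorem Post.shift_succ_of_star (hν : IsStarPeriodic ν p) (h : Post ν x) {n : ℕ} (hn : x n = none) :
    shift^[n + 1] x = ν := by
  obtain ⟨i, rfl⟩ := h
  exact hν.shift_of_star hn

theorem Post.eq_crit (hν : IsStarPeriodic ν p) (h : Post ν x) (h0 : x 0 = none) :
    x = crit ν := by
  have := h.shift_succ_of_star hν h0
  funext n
  cases n with
  | zero => exact h0
  | succ n => exact congrFun this n

theorem track_post {i n : ℕ} (hν : IsStarPeriodic ν p)
    (h : ∀ k < n, ν (k + i) = none ∨ ν (k + i) = τ k) :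
    track ν τ (shift^[i] ν) n = shift^[n + i] ν := by
  rw [track_eq_shift (fun k _ hk => hν.shift_of_star hk), shift_iterate_add]
  intro k hk
  rw [shift_iterate_apply]
  exact h k hk

theorem track_crit_one (h : τ 0 ≠ none) : track ν τ (crit ν) 1 = ν :=
  track_succ_of_ne fun h' => h h'.symm

/-- The class of `x` at the point `shift^[i] ν`, where `i < p`. -/
theorem track_class_symm (hν : IsStarPeriodic ν p) {i j : ℕ} (hi : i < p) (hj : j < p)
    (hij : i ≠ j) (h : track ν (shift^[i] ν) x (p - 1 - i) 0 ≠
      track ν (shift^[i] ν) (shift^[j] ν) (p - 1 - i) 0) :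
    track ν (shift^[j] ν) x (p - 1 - j) 0 =
      track ν (shift^[j] ν) (shift^[i] ν) (p - 1 - j) 0 := by
  have hne : shift^[i] ν ≠ shift^[j] ν := fun h' =>
    hij (by simpa [Nat.ModEq, Nat.mod_eq_of_lt hi, Nat.mod_eq_of_lt hj] using hν.shift_eq_iff.1 h')
  obtain ⟨n, hn, hlt⟩ := exists_first_ne hne
  set a := shift^[i] ν with ha
  set b := shift^[j] ν with hb
  have hba : track ν a b n = shift^[n] b := track_eq_shift_of_eq fun i hi => (hlt i hi).symm
  have hab : track ν b a n = shift^[n] a := track_eq_shift_of_eq fun i hi => hlt i hi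
  have hba0 : track ν a b n 0 = b n := by rw [hba, shift_iterate_apply, Nat.zero_add]
  have hab0 : track ν b a n 0 = a n := by rw [hab, shift_iterate_apply, Nat.zero_add]
  have hx : track ν a x n = track ν b x n := track_congr hlt
  have hstara : ∀ n, a n = none ↔ p ∣ n + i + 1 := fun n => by
    rw [ha, shift_iterate_apply, hν.star_iff]
  have hstarb : ∀ n, b n = none ↔ p ∣ n + j + 1 := fun n => by
    rw [hb, shift_iterate_apply, hν.star_iff]
  have h1 : a (p - 1 - i) = none := by rw [hstara]; exact ⟨1, by omega⟩
  have h2 : b (p - 1 - j) = none := by rw [hstarb]; exact ⟨1, by omega⟩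
  -- Since `i ≠ j`, the two sequences have their first `⋆` at different indices, so they differ no
  -- later than at the first `⋆` of either.
  have hna : n ≤ p - 1 - i := by
    by_contra hlt'
    have := hlt (p - 1 - i) (by omega)
    rw [h1, eq_comm, hstarb] at this
    rcases lt_or_gt_of_ne hij with hij | hij
    · have := Nat.eq_of_dvd_of_lt_two_mul (by omega) this (by omega)
      omega
    · have := Nat.le_of_dvd (by omega) this
      omega
  have hnb : n ≤ p - 1 - j := by
    by_contra hlt'
    have := hlt (p - 1 - j) (by omega)
    rw [h2, hstara] at this
    rcases lt_or_gt_of_ne hij with hij | hij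
    · have := Nat.le_of_dvd (by omega) this
      omega
    · have := Nat.eq_of_dvd_of_lt_two_mul (by omega) this (by omega)
      omega
  -- A class is read off at the first `⋆` of the reference point. If the difference at `n` comes
  -- strictly earlier, a common reset makes all later entries agree; a difference at the `⋆` itself
  -- is read off directly.
  rcases eq_or_lt_of_le hnb with hnb' | hnb'
  · rw [← hnb'] at h2 ⊢
    rw [hab0]
    by_contra hx'
    rw [← hx] at hx'
    rcases eq_or_lt_of_le hna with hna' | hna'
    · rw [← hna'] at h1
      exact hn (h1.trans h2.symm)
    · refine h (congrFun (track_eq_of_le ?_ (show n + 1 ≤ p - 1 - i from hna')) 0)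
      exact track_eq_of_ne_of_ne hx' (by rw [hba0]; exact hn.symm)
  · have hxa : track ν a x n 0 ≠ b n := by
      rcases eq_or_lt_of_le hna with hna' | hna'
      · rw [← hna', hba0] at h
        exact h
      · intro hxa
        refine h (congrFun (track_eq_of_le ?_ (show n + 1 ≤ p - 1 - i from hna')) 0)
        exact track_eq_of_ne_of_ne (by rw [hxa]; exact hn.symm) (by rw [hba0]; exact hn.symm)
    refine congrFun (track_eq_of_le ?_ (show n + 1 ≤ p - 1 - j from hnb')) 0
    exact track_eq_of_ne_of_ne (by rw [← hx]; exact hxa) (by rw [hab0]; exact hn)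

/-- Some point of the orbit of `ν` has all other points on one side. -/
theorem exists_endpoint (hν : IsStarPeriodic ν p) : ∃ i < p, ∀ j < p, ∀ k < p, j ≠ i → k ≠ i →
    track ν (shift^[i] ν) (shift^[j] ν) (p - 1 - i) 0 =
      track ν (shift^[i] ν) (shift^[k] ν) (p - 1 - i) 0 := by
  classical
  let s : ℕ → ℕ → Option A := fun i j =>
    track ν (shift^[i] ν) (shift^[j] ν) (p - 1 - i) 0
  let N : ℕ × ℕ → Finset ℕ := fun x =>
    (Finset.range p).filter fun y => y ≠ x.1 ∧ s x.1 y = s x.1 x.2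
  let S : Finset (ℕ × ℕ) := (Finset.range p ×ˢ Finset.range p).filter fun x => x.1 ≠ x.2
  have hS : S.Nonempty := ⟨(0, 1), by
    have := hν.two_le
    simp only [S, Finset.mem_filter, Finset.mem_product, Finset.mem_range]
    omega⟩
  -- Choose a point and a class at it with as many members as possible. For `k` in another class,
  -- the class of `i` at `k` would contain all these members by `track_class_symm`, and also `i`.
  obtain ⟨⟨i, j⟩, hij, hmax⟩ := S.exists_max_image (fun x => (N x).card) hS
  simp only [S, Finset.mem_filter, Finset.mem_product, Finset.mem_range] at hij hmax
  obtain ⟨⟨hi, hj⟩, hij⟩ := hij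
  suffices H : ∀ k < p, k ≠ i → s i k = s i j from
    ⟨i, hi, fun k hk l hl hki hli => (H k hk hki).trans (H l hl hli).symm⟩
  intro k hk hki
  by_contra hne
  have h1 : insert i (N (i, j)) ⊆ N (k, i) := by
    intro y hy
    simp only [N, Finset.mem_insert, Finset.mem_filter, Finset.mem_range] at hy ⊢
    rcases hy with rfl | ⟨hy, hyi, hyj⟩
    · exact ⟨hi, hki.symm, rfl⟩
    · refine ⟨hy, fun h => hne (by rw [← h]; exact hyj), ?_⟩
      exact track_class_symm hν hi hk hki.symm fun h => hne (h.symm.trans hyj)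
  have h2 : i ∉ N (i, j) := by simp [N]
  have h3 := Finset.card_le_card h1
  rw [Finset.card_insert_of_notMem h2] at h3
  have h4 := hmax (k, i) ⟨⟨hk, hi⟩, hki⟩
  omega

/-- From `ν`, all other points of its orbit are seen in the direction of the symbol `e`. -/
def LastSymbol (ν : Itin A) (p : ℕ) (e : A) : Prop :=
  ∀ τ : Itin A, (∀ n < p - 1, τ n = ν n) → ∀ x, Post ν x → x ≠ ν →
    track ν τ x (p - 1) 0 = some e

/-- The shift is injective on the cycle of `ν`, and a reset produces `ν`, to which the cycle itself
does not return before time `p`. -/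
theorem track_ne_of_ne (hν : IsStarPeriodic ν p) (hx : Post ν x) (hne : x ≠ ν) {n : ℕ}
    (hn : n < p) : track ν τ x n ≠ shift^[n] ν := by
  induction n with
  | zero => exact hne
  | succ n ih =>
    intro h
    by_cases h0 : track ν τ x n 0 = τ n
    · rw [track_succ_of_eq h0] at h
      obtain ⟨i, hi⟩ := hx.track_mem (τ := τ) n
      apply ih (by omega)
      rw [hi] at h ⊢
      rw [← Function.iterate_succ_apply' (f := shift), hν.shift_eq_iff] at h
      exact hν.shift_eq_iff.2 (Nat.ModEq.add_right_cancel' 1 h)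
    · rw [track_succ_of_ne h0, eq_comm, hν.shift_eq_self_iff] at h
      have := Nat.le_of_dvd (by omega) h
      omega

theorem exists_lastSymbol (hν : IsStarPeriodic ν p) : ∃ e, LastSymbol ν p e := by
  have hp := hν.two_le
  obtain ⟨k, hk, hend⟩ := exists_endpoint hν
  have hconst : ∀ x y, Post ν x → Post ν y → x ≠ ν → y ≠ ν →
      track ν ν x (p - 1) 0 = track ν ν y (p - 1) 0 := by
    intro x y hx hy hxν hyν
    -- After `k` steps the reference point is the endpoint of the orbit, and the tracked points
    -- still differ from it by `track_ne_of_ne`; so they are in its only class.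
    rw [show p - 1 = k + (p - 1 - k) by omega, track_add, track_add]
    obtain ⟨i, hi, hi'⟩ := (hx.track_mem (τ := ν) k).exists_lt hν
    obtain ⟨j, hj, hj'⟩ := (hy.track_mem (τ := ν) k).exists_lt hν
    rw [hi', hj']
    refine hend i hi j hj ?_ ?_
    · rintro rfl
      exact track_ne_of_ne hν hx hxν hk hi'
    · rintro rfl
      exact track_ne_of_ne hν hy hyν hk hj'
  have hcν : crit ν ≠ ν := fun h => by
    have := congrFun h 0
    rw [hν.first, crit] at this
    exact absurd this (by simp)
  have hnone : track ν ν (crit ν) (p - 1) 0 ≠ none := fun h => by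
    have := ((post_crit hν).track_mem (τ := ν) (p - 1)).eq_crit hν h
    exact track_ne_of_ne hν (post_crit hν) hcν (by omega) (this.trans hν.crit_eq)
  obtain ⟨e, he⟩ := Option.ne_none_iff_exists'.1 hnone
  refine ⟨e, fun τ hτ x hx hxν => ?_⟩
  rw [track_congr hτ, hconst x _ hx (post_crit hν) hxν hcν, he]

end starPeriodic

/-! ### The combinatorics of the lower sequence -/

section fill

variable [One A] {ν τ x y z : Itin A} {p : ℕ} {e : A}

theorem starFree_fill : StarFree (fill e ν) := fun n => by simp [fill]

theorem starFree_shift (h : StarFree z) (n : ℕ) : StarFree (shift^[n] z) := fun i => by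
  rw [shift_iterate_apply]; exact h _

theorem fill_of_star {n : ℕ} (h : ν n = none) : fill e ν n = some e := by simp [fill, h]

theorem fill_of_ne {n : ℕ} (h : ν n ≠ none) : fill e ν n = ν n := by
  obtain ⟨a, ha⟩ := Option.ne_none_iff_exists'.1 h
  simp [fill, ha]

theorem fill_compat (n : ℕ) : ν n = none ∨ ν n = fill e ν n := by
  by_cases h : ν n = none
  · exact Or.inl h
  · exact Or.inr (fill_of_ne h).symm

theorem IsStarPeriodic.ne_none (hν : IsStarPeriodic ν p) {n : ℕ} (hn : n < p - 1) :
    ν n ≠ none := fun h => by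
  rw [hν.star_iff] at h
  have := Nat.le_of_dvd (by omega) h
  omega

theorem fill_of_lt (hν : IsStarPeriodic ν p) {n : ℕ} (hn : n < p - 1) : fill e ν n = ν n :=
  fill_of_ne (hν.ne_none hn)

theorem shift_period_fill (hν : IsStarPeriodic ν p) : shift^[p] (fill e ν) = fill e ν := by
  funext n
  rw [shift_iterate_apply, fill, fill, hν.periodic]

theorem fill_last (hν : IsStarPeriodic ν p) : fill e ν (p - 1) = some e :=
  fill_of_star ((hν.star_iff _).2 ⟨1, by have := hν.pos; omega⟩)

theorem track_fill_self (hν : IsStarPeriodic ν p) (n : ℕ) :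
    track ν (fill e ν) ν n = shift^[n] ν :=
  track_post (i := 0) hν fun k _ => fill_compat k

/-- At the end of each period a tracked point other than `ν` shows `e` by the choice of `e`. It is
therefore shifted and not reset, and again differs from `ν`. The track of `ν` returns to `ν` at
these times, so the two never merge. -/
theorem not_sameSide_fill (hν : IsStarPeriodic ν p) (he : LastSymbol ν p e) (hx : Post ν x)
    (hne : x ≠ ν) : ¬ SameSide ν (fill e ν) x ν := by
  have hp := hν.two_le
  have hper : ∀ t, shift^[p * t] (fill e ν) = fill e ν := fun t => by
    induction t with
    | zero => rfl
    | succ t ih => rw [Nat.mul_succ, ← shift_iterate_add, shift_period_fill hν, ih]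
  have key : ∀ t, track ν (fill e ν) x (p * t) ≠ ν := by
    intro t
    induction t with
    | zero => exact hne
    | succ t ih =>
      set X := track ν (fill e ν) x (p * t) with hX
      have hpX : Post ν X := hx.track_mem _
      rw [Nat.mul_succ, track_add, hper, ← hX, show p = p - 1 + 1 by omega]
      rw [track_succ_of_eq]
      · obtain ⟨i, hi⟩ := hpX.track_mem (τ := fill e ν) (p - 1)
        have := track_ne_of_ne (τ := fill e ν) hν hpX ih (n := p - 1) (by omega)
        rw [hi, Ne, hν.shift_eq_iff] at this
        rw [hi, ← Function.iterate_succ_apply' (f := shift), Ne, hν.shift_eq_self_iff]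
        intro h
        apply this
        apply Nat.ModEq.add_right_cancel' 1
        rw [Nat.sub_add_cancel (by omega)]
        exact ((Nat.modEq_zero_iff_dvd.2 h).trans
          (Nat.modEq_zero_iff_dvd.2 (dvd_refl p)).symm)
      · rw [he _ (fun n hn => fill_of_lt hν hn) X hpX ih, fill_last hν]
  rintro ⟨n, hn⟩
  rw [track_fill_self hν, ← Nat.div_add_mod n p, track_add, hper,
    Nat.add_comm, ← shift_iterate_add, hν.shift_of_dvd ⟨_, rfl⟩] at hn
  exact track_ne_of_ne hν (hx.track_mem _) (key _) (Nat.mod_lt _ hν.pos) hn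

theorem crit_ne_self (hν : IsStarPeriodic ν p) : crit ν ≠ ν := fun h => by
  have := congrFun h 0
  rw [hν.first, crit] at this
  exact absurd this (by simp)

/-- At the first difference between `z` and the iterate of `fill e ν`, the iterate of `ν` has `⋆` or
the same symbol as that of `fill e ν`; so both are reset simultaneously. -/
theorem sameSide_fill (hν : IsStarPeriodic ν p) {i : ℕ} (hz : StarFree z)
    (h : z ≠ shift^[i] (fill e ν)) :
    SameSide ν z (shift^[i] ν) (shift^[i] (fill e ν)) := by
  obtain ⟨n, hn, hlt⟩ := exists_first_ne h
  refine ⟨n + 1, track_eq_of_ne_of_ne ?_ ?_⟩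
  · rw [track_post hν, shift_iterate_apply]
    · rcases fill_compat (e := e) (ν := ν) (n + i) with h | h
      · rw [Nat.zero_add, h]; exact (hz n).symm
      · rw [Nat.zero_add, h, ← shift_iterate_apply (fill e ν)]; exact hn.symm
    · intro k hk
      rcases fill_compat (e := e) (ν := ν) (k + i) with h | h
      · exact Or.inl h
      · exact Or.inr (by rw [h, hlt k hk, shift_iterate_apply])
  · rw [track_eq_shift_of_eq fun i hi => (hlt i hi).symm, shift_iterate_apply, Nat.zero_add]
    exact hn.symm

theorem finite_orbit_fill (hν : IsStarPeriodic ν p) :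
    {x : Itin A | ∃ a, x = shift^[a] (fill e ν)}.Finite := by
  refine ((Set.finite_Iio p).image fun a => shift^[a] (fill e ν)).subset ?_
  rintro x ⟨a, rfl⟩
  have hper : Function.IsPeriodicPt shift p (fill e ν) := shift_period_fill hν
  exact ⟨a % p, Nat.mod_lt _ hν.pos, hper.iterate_mod_apply a⟩

/-- The other points of the orbit of the lower sequence lie on the side of the critical point. -/
theorem sameSide_crit_of_ne (hν : IsStarPeriodic ν p) {j : ℕ}
    (h : shift^[j] (fill e ν) ≠ fill e ν) :
    SameSide ν (fill e ν) (shift^[j] (fill e ν)) (crit ν) := by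
  set ω := fill e ν with hω
  by_contra hj
  have hsf : ∀ a, StarFree (shift^[a] ω) := fun a => starFree_shift starFree_fill a
  -- If the claim fails at `ω`, then every point of the orbit sees some other point of the orbit
  -- away from the critical point. This passes from a point to its image. If the image separates the
  -- critical point from `ν`, the witness is `ω`, which is on the side of `ν` by `sameSide_fill`.
  have hsucc : ∀ a, ∃ b, shift^[b] ω ≠ shift^[a] ω ∧
      ¬ SameSide ν (shift^[a] ω) (shift^[b] ω) (crit ν) := by
    intro a
    induction a with
    | zero => exact ⟨j, h, hj⟩
    | succ a ih =>
      by_cases hω' : shift^[a + 1] ω = ω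
      · rw [hω']; exact ⟨j, h, hj⟩
      obtain ⟨b, hb, hab⟩ := ih
      have h0 : shift^[b] ω 0 = shift^[a] ω 0 := by
        by_contra h0
        refine hab ⟨1, track_eq_of_ne_of_ne h0 ?_⟩
        exact fun h' => hsf a 0 h'.symm
      have hab' : ¬ SameSide ν (shift^[a + 1] ω) (shift^[b + 1] ω) ν := by
        rw [← sameSide_track 1, track_succ_of_eq (τ := shift^[a] ω) (n := 0) h0,
          track_crit_one (hsf a 0)] at hab
        rw [Function.iterate_succ_apply', Function.iterate_succ_apply']
        exact hab
      by_cases hc : SameSide ν (shift^[a + 1] ω) (crit ν) ν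
      · refine ⟨b + 1, ?_, fun h' => hab' (h'.trans hc)⟩
        intro h'
        apply hb
        funext n
        cases n with
        | zero => exact h0
        | succ n =>
          have := congrFun h' n
          simpa only [Function.iterate_succ_apply', shift] using this
      · refine ⟨0, fun h' => hω' h'.symm, fun h' => hc (h'.symm.trans ?_)⟩
        exact (sameSide_fill (i := 0) hν (hsf _) hω').symm
  let S := {x : Itin A // ∃ a, x = shift^[a] ω}
  have : Finite S := (finite_orbit_fill hν).to_subtype
  -- `R b a` means that `a` separates `b` from the critical point. This is a strict order on a
  -- finite orbit, and a minimal element has nothing behind it, against `hsucc`.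
  let R : S → S → Prop := fun b a => b ≠ a ∧ ¬ SameSide ν a.1 b.1 (crit ν)
  have : IsTrans S R := ⟨fun c b a hcb hba => by
    have h1 : SameSide ν b.1 (crit ν) a.1 :=
      sameSide_of_not_sameSide (fun h' => hba.1 (Subtype.ext h').symm) fun h' => hba.2 h'.symm
    have h2 : ¬ SameSide ν b.1 c.1 a.1 := fun h' => hcb.2 (h'.trans h1.symm)
    have h3 : SameSide ν a.1 c.1 b.1 :=
      sameSide_of_not_sameSide (fun h' => hba.1 (Subtype.ext h')) h2
    exact ⟨fun h' => h2 (by rw [h']; exact SameSide.refl), fun h' => hba.2 (h3.symm.trans h')⟩⟩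
  have : Std.Irrefl R := ⟨fun a ha => ha.1 rfl⟩
  have hwf : WellFounded R := Finite.wellFounded_of_trans_of_irrefl R
  obtain ⟨⟨m, a, rfl⟩, -, hm⟩ := hwf.has_min Set.univ ⟨⟨ω, 0, rfl⟩, trivial⟩
  obtain ⟨b, hb, hab⟩ := hsucc a
  exact hm ⟨_, b, rfl⟩ trivial ⟨fun h' => hb (congrArg Subtype.val h'), hab⟩

end fill

/-! ### The first return map on the sides of the lower sequence. -/

section return_map

variable [One A] {ν τ x y z : Itin A} {p q : ℕ} {e : A}

theorem shift_fill_eq_iff (hq : Function.minimalPeriod shift (fill e ν) = q) {n : ℕ} :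
    shift^[n] (fill e ν) = fill e ν ↔ q ∣ n := by
  rw [← hq, ← Function.isPeriodicPt_iff_minimalPeriod_dvd]; rfl

theorem period_dvd (hν : IsStarPeriodic ν p)
    (hq : Function.minimalPeriod shift (fill e ν) = q) : q ∣ p :=
  (shift_fill_eq_iff hq).1 (shift_period_fill hν)

theorem period_pos (hν : IsStarPeriodic ν p)
    (hq : Function.minimalPeriod shift (fill e ν) = q) : 0 < q :=
  Nat.pos_of_dvd_of_pos (period_dvd hν hq) hν.pos

theorem fill_add_of_dvd (hq : Function.minimalPeriod shift (fill e ν) = q) {n i : ℕ}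
    (h : q ∣ i) : fill e ν (n + i) = fill e ν n := by
  have := congrFun ((shift_fill_eq_iff hq).2 h) n
  rwa [shift_iterate_apply] at this

theorem track_fill_post (hν : IsStarPeriodic ν p)
    (hq : Function.minimalPeriod shift (fill e ν) = q) {i : ℕ} (h : q ∣ i) (n : ℕ) :
    track ν (fill e ν) (shift^[i] ν) n = shift^[n + i] ν := by
  refine track_post hν fun k _ => ?_
  rw [← fill_add_of_dvd hq h]
  exact fill_compat _

theorem track_fill_add (hq : Function.minimalPeriod shift (fill e ν) = q) {i : ℕ}
    (h : q ∣ i) (n : ℕ) :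
    track ν (fill e ν) x (i + n) = track ν (fill e ν) (track ν (fill e ν) x i) n := by
  rw [track_add, (shift_fill_eq_iff hq).2 h]

theorem sameSide_track_fill (hq : Function.minimalPeriod shift (fill e ν) = q) {i : ℕ}
    (h : q ∣ i) : SameSide ν (fill e ν) (track ν (fill e ν) x i) (track ν (fill e ν) y i) ↔
      SameSide ν (fill e ν) x y := by
  rw [← sameSide_track (x := x) i, (shift_fill_eq_iff hq).2 h]

/-- Induction on the number of remaining steps. A difference resets the tracked point to `ν` at a
later point of the orbit of `fill e ν`. Without a difference, `ν` stays on the side of `fill e ν`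
and ends on that of an iterate of it, which is the critical side by `sameSide_crit_of_ne`. -/
theorem track_value_orbit (hν : IsStarPeriodic ν p)
    (hq : Function.minimalPeriod shift (fill e ν) = q) {r : ℕ} (hr : r ≤ q) (h0 : 0 < r) :
    track ν (shift^[r] (fill e ν)) ν (q - r) = ν ∨
      SameSide ν (fill e ν) (track ν (shift^[r] (fill e ν)) ν (q - r)) (crit ν) := by
  have hqp := Nat.le_of_dvd hν.pos (period_dvd hν hq)
  induction hk : q - r using Nat.strong_induction_on generalizing r with
  | _ k ih =>
  rcases eq_or_lt_of_le hr with rfl | hr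
  · left
    rw [← hk, Nat.sub_self]; rfl
  by_cases hall : ∀ n < k, ν n = shift^[r] (fill e ν) n
  · right
    have hne : ∀ i, 0 < i → i < q → shift^[i] (fill e ν) ≠ fill e ν := fun i h1 h2 h => by
      have := Nat.le_of_dvd h1 ((shift_fill_eq_iff hq).1 h)
      omega
    have h1 : SameSide ν (shift^[r] (fill e ν)) ν (fill e ν) :=
      sameSide_fill (i := 0) hν (starFree_shift starFree_fill r) (hne r h0 hr)
    rw [← sameSide_track k, shift_iterate_add, show k + r = q by omega,
      (shift_fill_eq_iff hq).2 dvd_rfl] at h1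
    refine h1.trans ?_
    rw [track_eq_shift_of_eq fun n hn => ?_]
    · exact sameSide_crit_of_ne hν (hne k (by omega) (by omega))
    · rw [fill_of_lt hν (by omega), hall n hn]
  · push Not at hall
    have hex := hall
    classical
    set n := Nat.find hex with hn
    obtain ⟨hnk, hne⟩ := Nat.find_spec hex
    have hlt : ∀ i < n, ν i = shift^[r] (fill e ν) i := fun i hi => by
      by_contra h
      exact Nat.find_min hex hi ⟨by omega, h⟩
    have h1 : track ν (shift^[r] (fill e ν)) ν (n + 1) = ν := by
      apply track_succ_of_ne
      rw [track_eq_shift_of_eq hlt, shift_iterate_apply, Nat.zero_add]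
      exact hne
    have h2 : track ν (shift^[r] (fill e ν)) ν k =
        track ν (shift^[r + n + 1] (fill e ν)) ν (q - (r + n + 1)) := by
      rw [show k = (n + 1) + (q - (r + n + 1)) by omega, track_add, h1, shift_iterate_add]
      congr 2; omega
    rw [h2]
    exact ih _ (by omega) (r := r + n + 1) (by omega) (by omega) rfl

/-- The dichotomy behind the classification. One step takes the critical point to `ν`, so this is
the case `r = 1` of `track_value_orbit`. -/
theorem track_crit_orbit (hν : IsStarPeriodic ν p)
    (hq : Function.minimalPeriod shift (fill e ν) = q) :
    track ν (fill e ν) (crit ν) q = ν ∨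
      SameSide ν (fill e ν) (track ν (fill e ν) (crit ν) q) (crit ν) := by
  have hq0 := period_pos hν hq
  have := track_value_orbit hν hq (r := 1) hq0 one_pos
  have h1 : track ν (fill e ν) (crit ν) q = track ν (shift^[1] (fill e ν)) ν (q - 1) := by
    rw [show q = 1 + (q - 1) by omega, track_add, track_crit_one (starFree_fill 0)]
    simp
  rwa [h1]

/-- A postcritical point contains `⋆`, hence differs somewhere from `fill e ν`. There it is reset to
`ν`, and `track_value_orbit` covers the rest of that period. -/
theorem exists_track_value_or_crit (hν : IsStarPeriodic ν p)
    (hq : Function.minimalPeriod shift (fill e ν) = q) (hx : Post ν x) :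
    ∃ n, track ν (fill e ν) x (n * q) = ν ∨
      SameSide ν (fill e ν) (track ν (fill e ν) x (n * q)) (crit ν) := by
  have hq0 := period_pos hν hq
  have hne : x ≠ fill e ν := by
    rintro rfl
    obtain ⟨i, hi, hi'⟩ := hx.exists_lt hν
    have := congrFun hi' (p - 1 - i)
    rw [shift_iterate_apply, show p - 1 - i + i = p - 1 by omega,
      (hν.star_iff _).2 ⟨1, by omega⟩] at this
    exact starFree_fill _ this
  obtain ⟨J, hJ, hlt⟩ := exists_first_ne hne
  have hJ1 : track ν (fill e ν) x (J + 1) = ν := by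
    apply track_succ_of_ne
    rw [track_eq_shift_of_eq hlt, shift_iterate_apply, Nat.zero_add]
    exact hJ
  have hJq := Nat.div_add_mod J q
  have hJm := Nat.mod_lt J hq0
  set a := J / q
  set r := J % q
  have h := track_value_orbit hν hq (r := r + 1) hJm (by omega)
  refine ⟨a + 1, ?_⟩
  have : track ν (fill e ν) x ((a + 1) * q) =
      track ν (shift^[r + 1] (fill e ν)) ν (q - (r + 1)) := by
    rw [show (a + 1) * q = (J + 1) + (q - (r + 1)) by
      rw [Nat.add_mul, Nat.mul_comm a q]; omega, track_add, hJ1]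
    congr 1
    rw [show J + 1 = (r + 1) + q * a by omega, ← shift_iterate_add,
      (shift_fill_eq_iff hq).2 ⟨_, rfl⟩]
  rwa [this]

/-- The return map is injective on sides and moves the sides of the points `shift^[t * q] ν` around
a cycle of length `m = p / q`. So `n` returns are undone within the cycle by `n * (m - 1)` further
ones. -/
theorem exists_sameSide_cycle (hν : IsStarPeriodic ν p)
    (hq : Function.minimalPeriod shift (fill e ν) = q) {n t : ℕ}
    (h : SameSide ν (fill e ν) (track ν (fill e ν) x (n * q)) (shift^[t * q] ν)) :
    ∃ s, SameSide ν (fill e ν) x (shift^[s * q] ν) := by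
  obtain ⟨m, hm⟩ := period_dvd hν hq
  have hm0 : 0 < m := Nat.pos_of_mul_pos_left (hm ▸ hν.pos)
  refine ⟨t + n * (m - 1), ?_⟩
  rw [← sameSide_track_fill hq (i := n * q) ⟨n, Nat.mul_comm _ _⟩]
  refine h.trans ?_
  rw [track_fill_post hν hq ⟨t + n * (m - 1), Nat.mul_comm _ _⟩]
  have : n * q + (t + n * (m - 1)) * q = p * n + t * q := by
    obtain ⟨m, rfl⟩ := Nat.exists_eq_add_of_le' hm0
    rw [hm, Nat.add_sub_cancel]; ring
  rw [this, Nat.add_comm, ← shift_iterate_add, hν.shift_of_dvd ⟨_, rfl⟩]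
  exact SameSide.refl

/-- Under `hB` the critical side reaches that of `ν` with one more return, so it belongs to the
cycle as well. -/
theorem exists_sameSide_of_value (hν : IsStarPeriodic ν p)
    (hq : Function.minimalPeriod shift (fill e ν) = q)
    (hB : track ν (fill e ν) (crit ν) q = ν) (hx : Post ν x) :
    ∃ s, SameSide ν (fill e ν) x (shift^[s * q] ν) := by
  obtain ⟨n, h | h⟩ := exists_track_value_or_crit hν hq hx
  · exact exists_sameSide_cycle hν hq (n := n) (t := 0) (by rw [h, Nat.zero_mul]; exact .refl)
  · refine exists_sameSide_cycle hν hq (n := n + 1) (t := 0) ?_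
    rw [Nat.zero_mul, Nat.add_mul, Nat.one_mul,
      track_fill_add hq (i := n * q) ⟨n, Nat.mul_comm _ _⟩]
    rw [← sameSide_track_fill hq (i := q) dvd_rfl, hB] at h
    exact h

theorem sameSide_cycle_or_crit (hν : IsStarPeriodic ν p)
    (hq : Function.minimalPeriod shift (fill e ν) = q)
    (hA : SameSide ν (fill e ν) (track ν (fill e ν) (crit ν) q) (crit ν)) (hx : Post ν x) :
    (∃ s, SameSide ν (fill e ν) x (shift^[s * q] ν)) ∨ SameSide ν (fill e ν) x (crit ν) := by
  have hA' : ∀ n, SameSide ν (fill e ν) (track ν (fill e ν) (crit ν) (n * q)) (crit ν) := by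
    intro n
    induction n with
    | zero => rw [Nat.zero_mul]; exact .refl
    | succ n ih =>
      rw [Nat.add_mul, Nat.one_mul, track_fill_add hq (i := n * q) ⟨n, Nat.mul_comm _ _⟩]
      exact ((sameSide_track_fill hq dvd_rfl).2 ih).trans hA
  obtain ⟨n, h | h⟩ := exists_track_value_or_crit hν hq hx
  · exact Or.inl
      (exists_sameSide_cycle hν hq (n := n) (t := 0) (by rw [h, Nat.zero_mul]; exact .refl))
  · right
    rw [← sameSide_track_fill hq (i := n * q) ⟨n, Nat.mul_comm _ _⟩]
    exact h.trans (hA' n).symm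

/-- If the fixed critical side were in the cycle, then `t * (m - 1)` further returns would show that
it is the side of `ν`, against `not_sameSide_fill`. -/
theorem not_sameSide_crit_cycle (hν : IsStarPeriodic ν p) (he : LastSymbol ν p e)
    (hq : Function.minimalPeriod shift (fill e ν) = q)
    (hA : SameSide ν (fill e ν) (track ν (fill e ν) (crit ν) q) (crit ν)) (t : ℕ) :
    ¬ SameSide ν (fill e ν) (crit ν) (shift^[t * q] ν) := by
  obtain ⟨m, hm⟩ := period_dvd hν hq
  have hm0 : 0 < m := Nat.pos_of_mul_pos_left (hm ▸ hν.pos)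
  have key : ∀ n, SameSide ν (fill e ν) (crit ν) (shift^[t * q] ν) →
      SameSide ν (fill e ν) (crit ν) (shift^[(t + n) * q] ν) := by
    intro n h
    induction n with
    | zero => exact h
    | succ n ih =>
      refine (hA.symm.trans ((sameSide_track_fill hq dvd_rfl).2 ih)).trans ?_
      rw [track_fill_post hν hq ⟨t + n, Nat.mul_comm _ _⟩,
        show q + (t + n) * q = (t + (n + 1)) * q by ring]
      exact .refl
  intro h
  have := key (t * (m - 1)) h
  obtain ⟨m, rfl⟩ := Nat.exists_eq_add_of_le' hm0
  rw [hν.shift_of_dvd ⟨t, by rw [hm, Nat.add_sub_cancel]; ring⟩] at this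
  exact not_sameSide_fill hν he (post_crit hν) (crit_ne_self hν) this

/-- Seen from `fill e ν` these points are only shifted, and the shift is injective on the cycle of
`ν`. -/
theorem sameSide_cycle_iff (hν : IsStarPeriodic ν p)
    (hq : Function.minimalPeriod shift (fill e ν) = q) {s t : ℕ} :
    SameSide ν (fill e ν) (shift^[s * q] ν) (shift^[t * q] ν) ↔ s ≡ t [MOD p / q] := by
  have hp := Nat.mul_div_cancel' (period_dvd hν hq)
  have hq0 := period_pos hν hq
  have : s ≡ t [MOD p / q] ↔ s * q ≡ t * q [MOD p] := by
    rw [← Nat.ModEq.mul_right_cancel_iff' (m := p / q) hq0.ne', Nat.mul_comm (p / q), hp]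
  rw [this]
  constructor
  · rintro ⟨n, hn⟩
    rw [track_fill_post hν hq ⟨s, Nat.mul_comm _ _⟩, track_fill_post hν hq ⟨t, Nat.mul_comm _ _⟩,
      hν.shift_eq_iff] at hn
    exact Nat.ModEq.add_left_cancel' _ hn
  · intro h
    rw [hν.shift_eq_iff.2 h]
    exact .refl

end return_map

/-! ### Internal address, the bifurcating symbol, gaps, and uniqueness of the lower sequence. -/

section address

variable [One A] {ν τ x y z : Itin A} {p q : ℕ} {e : A}

theorem InternalAddress.pos {n : ℕ} (h : InternalAddress ν n) : 0 < n := by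
  cases h with
  | one => exact one_pos
  | next S T _ hT => exact hT.1.1

/-- After following the critical point for `n` steps, we are at the critical value if and only
if `n` is an entry of the internal address. -/
theorem internalAddress_iff (hν : IsStarPeriodic ν p) {n : ℕ} (h0 : 0 < n) (hn : n < p) :
    InternalAddress ν n ↔ track ν (fill e ν) (crit ν) n = ν := by
  have h1 : track ν (fill e ν) (crit ν) 1 = ν := track_crit_one (starFree_fill 0)
  -- If the tracked point is `ν` at time `S`, the next reset is at the first index where `ν` differs
  -- from its shift by `S`, i.e. from its `S`-periodic continuation. This is the recursion of the
  -- internal address. Only entries of `ν` before the `⋆` are involved, so `e` plays no role.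
  have hfollow : ∀ S k, S + k < p → track ν (fill e ν) (crit ν) S = ν →
      (∀ i < k, ν i = ν (S + i)) → track ν (fill e ν) (crit ν) (S + k) = shift^[k] ν := by
    intro S k hk hS h
    rw [track_add, hS]
    refine track_eq_shift_of_eq fun i hi => ?_
    rw [shift_iterate_apply, Nat.add_comm i, fill_of_lt hν (by omega), h i hi]
  have hdiff : ∀ S k, 0 < S → S + k < p → (∀ i < k, ν (S + i) = ν ((S + i) % S)) →
      ∀ i, i < S ∨ i < k + S → ν i = ν (i % S) := by
    intro S k hS hk h i hi
    rcases lt_or_ge i S with h' | h'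
    · rw [Nat.mod_eq_of_lt h']
    · obtain ⟨i, rfl⟩ := Nat.exists_eq_add_of_le h'
      exact h i (by omega)
  constructor
  · intro h
    induction h with
    | one => exact h1
    | next S T hS hT ih =>
      obtain ⟨⟨hT0, hT1⟩, hmin⟩ := hT
      have hS0 := hS.pos
      have hST : S < T := by
        by_contra h
        exact hT1 (by rw [Nat.mod_eq_of_lt (by omega)])
      have ih := ih hS0 (by omega)
      have hmin' : ∀ i < T - 1, ν i = ν (i % S) := fun i hi => by
        by_contra h
        have := hmin ⟨Nat.le_add_left 1 i, by simpa using h⟩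
        omega
      have hν' : ∀ i < T - 1 - S, ν i = ν (S + i) := fun i hi => by
        rw [hmin' i (by omega), hmin' (S + i) (by omega), Nat.add_mod_left]
      have h3 := hfollow S (T - 1 - S) (by omega) ih hν'
      rw [show S + (T - 1 - S) = T - 1 by omega] at h3
      rw [show T = T - 1 + 1 by omega]
      apply track_succ_of_ne
      rw [h3, shift_iterate_apply, Nat.zero_add, fill_of_lt hν (by omega)]
      intro h
      apply hT1
      rw [← h, hmin' _ (by omega)]
      conv_rhs => rw [show T - 1 = S + (T - 1 - S) by omega]
      rw [Nat.add_mod_left]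
  · intro h
    induction n using Nat.strong_induction_on with
    | _ n ih =>
    rcases Nat.lt_or_ge 1 n with hn1 | hn1
    swap
    · obtain rfl : n = 1 := by omega
      exact .one
    classical
    let P : ℕ → Prop := fun S => 0 < S ∧ track ν (fill e ν) (crit ν) S = ν
    -- The last time before `n` at which the tracked point is `ν`; time `1` is always such a time.
    set S := Nat.findGreatest P (n - 1) with hSdef
    have hS : P S := Nat.findGreatest_spec (m := 1) (by omega) ⟨one_pos, h1⟩
    have hSn : S ≤ n - 1 := Nat.findGreatest_le _
    have hgr : ∀ k, S < k → k < n → track ν (fill e ν) (crit ν) k ≠ ν := fun k h1 h2 h3 =>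
      Nat.findGreatest_is_greatest h1 (by omega) ⟨by omega, h3⟩
    have hk : ∀ k, S + k < n → track ν (fill e ν) (crit ν) (S + k) = shift^[k] ν ∧
        ∀ i < k, ν i = ν (S + i) := by
      intro k
      induction k with
      | zero => exact fun _ => ⟨hS.2, by simp⟩
      | succ k ihk =>
        intro hk
        obtain ⟨h2, h3⟩ := ihk (by omega)
        have h4 : track ν (fill e ν) (crit ν) (S + k) 0 = fill e ν (S + k) := by
          by_contra h4
          exact hgr (S + k + 1) (by omega) (by omega) (track_succ_of_ne h4)
        refine ⟨?_, ?_⟩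
        · rw [← Nat.add_assoc, track_succ_of_eq h4, h2, Function.iterate_succ_apply']
        · intro i hi
          rcases Nat.lt_succ_iff_lt_or_eq.1 hi with hi | rfl
          · exact h3 i hi
          · rw [h2, shift_iterate_apply, Nat.zero_add, fill_of_lt hν (by omega)] at h4
            exact h4
    obtain ⟨h2, h3⟩ := hk (n - 1 - S) (by omega)
    rw [show S + (n - 1 - S) = n - 1 by omega] at h2
    have hmod : ∀ i < n - 1, ν i = ν (i % S) := by
      intro i
      induction i using Nat.strong_induction_on with
      | _ i ihi =>
      intro hi
      rcases lt_or_ge i S with h' | h'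
      · rw [Nat.mod_eq_of_lt h']
      · rw [show i = S + (i - S) by omega, ← h3 (i - S) (by omega), Nat.add_mod_left]
        exact ihi _ (by have := hS.1; omega) (by omega)
    -- The arrival at `ν` at time `n` is due to a reset: otherwise the tracked point would be
    -- `shift^[n - S] ν` with `0 < n - S < p`.
    have h5 : ν (n - 1 - S) ≠ ν (n - 1) := by
      intro h5
      have h6 : track ν (fill e ν) (crit ν) (n - 1) 0 = fill e ν (n - 1) := by
        rw [h2, shift_iterate_apply, Nat.zero_add, h5, fill_of_lt hν (by omega)]
      have h7 := track_succ_of_eq h6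
      rw [show n - 1 + 1 = n by omega, h, h2, ← Function.iterate_succ_apply' (f := shift), eq_comm,
        hν.shift_eq_self_iff] at h7
      have := Nat.le_of_dvd (by omega) h7
      have := hS.1
      omega
    refine .next S n (ih S (by omega) hS.1 (by omega) hS.2) ⟨⟨by omega, ?_⟩, ?_⟩
    · intro h6
      apply h5
      rw [h6]
      conv_rhs => rw [show n - 1 = S + (n - 1 - S) by omega]
      rw [Nat.add_mod_left]
      exact hmod _ (by have := hS.1; omega)
    · rintro k ⟨hk1, hk2⟩
      by_contra hlt
      exact hk2 (hmod _ (by omega))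

/-- The symbol of a bifurcation is the one in the direction of the other points of the orbit. -/
theorem eq_of_minimalPeriod_lt (hν : IsStarPeriodic ν p) (he : LastSymbol ν p e) {e' : A}
    (hq : Function.minimalPeriod shift (fill e' ν) = q) (hqp : q < p) : e' = e := by
  have hq0 := period_pos hν hq
  have hlt : ∀ n < p - 1, fill e' ν n = ν n := fun n hn => fill_of_lt hν hn
  have hne : shift^[q] ν ≠ ν := fun h => by
    have := Nat.le_of_dvd hq0 (hν.shift_eq_self_iff.1 h)
    omega
  -- Seen from `fill e' ν`, the point `shift^[q] ν` is only shifted. Its entry at the end of the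
  -- period is `e` by the choice of `e`, and `e'` by `q`-periodicity.
  have h := he _ hlt (shift^[q] ν) ⟨q, rfl⟩ hne
  rw [track_fill_post hν hq dvd_rfl, shift_iterate_apply] at h
  have h2 : fill e' ν (0 + (p - 1) + q) = fill e' ν (0 + (p - 1)) := fill_add_of_dvd hq dvd_rfl
  rw [Nat.zero_add, fill_last hν, fill_of_ne, ← Nat.zero_add (p - 1), Nat.add_assoc, h] at h2
  · exact (Option.some.inj h2).symm
  · rw [Nat.zero_add] at h
    rw [h]; simp

/-- If the critical point and the critical value are followed without differences from some time
on, then the first return map at the lower sequence maps the arm of the critical point to the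
arm of the critical value. -/
theorem track_crit_of_gap (hν : IsStarPeriodic ν p) (he : LastSymbol ν p e)
    (hq : Function.minimalPeriod shift (fill e ν) = q) (hτ : StarFree τ)
    (hsep : ¬ SameSide ν τ (crit ν) ν) {M : ℕ}
    (h0 : ∀ n ≥ M, track ν τ (crit ν) n 0 = none ∨ track ν τ (crit ν) n 0 = τ n)
    (h1 : ∀ n ≥ M, track ν τ ν n 0 = none ∨ track ν τ ν n 0 = τ n) :
    q < p ∧ track ν (fill e ν) (crit ν) q = ν := by
  have hp := hν.two_le
  have hfollow : ∀ x, Post ν x → ∀ M, (∀ n ≥ M, track ν τ x n 0 = none ∨ track ν τ x n 0 = τ n) →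
      ∀ n, track ν τ x (M + n) = shift^[n] (track ν τ x M) := by
    intro x hx M h n
    induction n with
    | zero => rfl
    | succ n ih =>
      rcases h (M + n) (by omega) with h | h
      · rw [← Nat.add_assoc, track_succ_of_ne (by rw [h]; exact (hτ _).symm),
          Function.iterate_succ_apply', ← ih, (hx.track_mem _).eq_crit hν h]
        rfl
      · rw [← Nat.add_assoc, track_succ_of_eq h, ih, Function.iterate_succ_apply']
  obtain ⟨i₀, hi₀, hi₀'⟩ := ((post_crit hν).track_mem (τ := τ) M).exists_lt hν
  -- From time `M` on both points are only shifted, and at time `N` the critical point has become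
  -- `ν`.
  set N := M + (p - i₀) with hN
  have hcN : track ν τ (crit ν) N = ν := by
    rw [hN, hfollow _ (post_crit hν) M h0, hi₀', shift_iterate_add,
      show p - i₀ + i₀ = p by omega, hν.shift_period]
  obtain ⟨i, hi, hi'⟩ := ((post_self (ν := ν)).track_mem (τ := τ) N).exists_lt hν
  have hne : ∀ n, track ν τ (crit ν) n ≠ track ν τ ν n := fun n h => hsep ⟨n, h⟩
  have hi0 : i ≠ 0 := by
    rintro rfl
    exact hne N (hcN.trans hi'.symm)
  -- The tail of `τ` is compatible both with `ν` and with `shift^[i] ν`. At the `⋆` of `ν` the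
  -- second condition determines the entry, and it is `e` by the choice of `e`.
  have hτN : shift^[N] τ = fill e ν ∧ ∀ n, ν (n + i) = none ∨ ν (n + i) = τ (N + n) := by
    have hc1 : ∀ n, ν n = none ∨ ν n = τ (N + n) := fun n => by
      have := hfollow _ (post_crit hν) N (fun n hn => h0 n (by omega)) n
      have h2 := h0 (N + n) (by omega)
      rwa [this, hcN, shift_iterate_apply, Nat.zero_add] at h2
    have hc2 : ∀ n, ν (n + i) = none ∨ ν (n + i) = τ (N + n) := fun n => by
      have := hfollow _ post_self N (fun n hn => h1 n (by omega)) n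
      have h2 := h1 (N + n) (by omega)
      rwa [this, hi', shift_iterate_add, shift_iterate_apply, Nat.zero_add] at h2
    refine ⟨?_, hc2⟩
    have hlast : ν (p - 1 + i) = some e := by
      have h2 := he (shift^[N] τ) (fun n hn => by
        rw [shift_iterate_apply, Nat.add_comm]
        exact ((hc1 n).resolve_left (hν.ne_none hn)).symm) (shift^[i] ν) ⟨i, rfl⟩
        (fun h => hne N (hcN.trans (h.symm.trans hi'.symm)))
      rw [track_post hν fun k _ => ?_] at h2
      · rwa [shift_iterate_apply, Nat.zero_add] at h2
      · rw [shift_iterate_apply, Nat.add_comm k N]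
        exact hc2 k
    funext n
    rw [shift_iterate_apply, Nat.add_comm]
    rcases hc1 n with h | h
    · rw [fill_of_star h]
      rw [hν.star_iff] at h
      obtain ⟨k, hk⟩ := h
      have hk0 : k ≠ 0 := by rintro rfl; omega
      obtain ⟨k, rfl⟩ := Nat.exists_eq_succ_of_ne_zero hk0
      have hn : n = p - 1 + p * k := by rw [Nat.mul_succ] at hk; omega
      have h2 : ν (n + i) = some e := by
        rw [hn, Nat.add_right_comm, hν.add_mul, hlast]
      have h3 := (hc2 n).resolve_left (by rw [h2]; simp)
      rw [← h3, h2]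
    · by_cases h4 : ν n = none
      · exact absurd (h.symm.trans h4) (hτ _)
      · rw [fill_of_ne h4, h]
  obtain ⟨hτω, hc2⟩ := hτN
  have hτω' : ∀ n, τ (N + n) = fill e ν n := fun n => by
    rw [← hτω, shift_iterate_apply, Nat.add_comm]
  have hqi : q ∣ i := by
    rw [← shift_fill_eq_iff hq]
    by_contra hcon
    have hcon : ∃ n, fill e ν (n + i) ≠ fill e ν n := by
      by_contra h
      push Not at h
      exact hcon (funext fun n => by rw [shift_iterate_apply, h])
    obtain ⟨n₀, hn₀⟩ := hcon
    have hstep : ∀ n, ¬ p ∣ n + i + 1 → fill e ν (n + i) = fill e ν n := fun n hn => by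
      rw [← hν.star_iff] at hn
      rw [fill_of_ne hn, (hc2 n).resolve_left hn, hτω']
    have hd : p ∣ n₀ + i + 1 := by
      by_contra h
      exact hn₀ (hstep _ h)
    have hper : ∀ n k, fill e ν (n + p * k) = fill e ν n := fun n k => by
      simp only [fill, hν.add_mul]
    -- Periodicity under `i` can fail only at an index `n₀` such that `shift^[i] ν` has `⋆` there.
    -- Going on from `n₀ + i` in steps of `i`, the entries stay equal until the index is `n₀` modulo
    -- `p` again, so it does not fail there either.
    have hchain : ∀ s, fill e ν (n₀ + (s + 1) * i) = fill e ν (n₀ + i) := by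
      intro s
      induction s with
      | zero => rw [Nat.zero_add, Nat.one_mul]
      | succ s ih =>
        rw [show n₀ + (s + 1 + 1) * i = n₀ + (s + 1) * i + i by ring]
        rw [hstep, ih]
        intro h
        have h2 : p ∣ (s + 1) * i := by
          have := (Nat.dvd_add_right (b := n₀ + i + 1) (c := (s + 1) * i) hd).1 (by
            convert h using 1; ring)
          exact this
        obtain ⟨k, hk⟩ := h2
        rw [hk, hper] at ih
        exact hn₀ ih.symm
    have := hchain (p - 1)
    rw [Nat.sub_add_cancel (by omega), hper] at this
    exact hn₀ this.symm
  have hq0 := period_pos hν hq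
  refine ⟨lt_of_le_of_lt (Nat.le_of_dvd (by omega) hqi) hi, ?_⟩
  rcases track_crit_orbit hν hq with hB | hA
  · exact hB
  exfalso
  have hsepne := hne
  -- It remains to exclude that the critical side is fixed. Go back from `D` to the last time `D'`
  -- at which `x'` was at `ν`. If `q` divides `D - D'`, the same situation occurs at `D'` with `x`
  -- and `x'` exchanged. If not, `x'` has arrived on the critical side, which is not in the cycle.
  -- At `D = 0` the point `x'` is the critical point itself.
  have descent : ∀ D, shift^[D] τ = fill e ν → ∀ x x', ((x = crit ν ∧ x' = ν) ∨
      (x = ν ∧ x' = crit ν)) → track ν τ x D = ν → ∀ t,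
      ¬ SameSide ν (fill e ν) (track ν τ x' D) (shift^[t * q] ν) := by
    intro D
    induction D using Nat.strong_induction_on with
    | _ D ih =>
    intro hD x x' hxx' hx t ht
    have hy : track ν τ x' D ≠ ν := by
      rcases hxx' with ⟨rfl, rfl⟩ | ⟨rfl, rfl⟩
      · exact fun h => hne D (hx.trans h.symm)
      · exact fun h => hne D (h.trans hx.symm)
    rcases Nat.eq_zero_or_pos D with rfl | hD0
    · rcases hxx' with ⟨rfl, rfl⟩ | ⟨rfl, rfl⟩
      · exact hy rfl
      · exact not_sameSide_crit_cycle hν he hq hA t ht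
    classical
    let P : ℕ → Prop := fun k => track ν τ x' k = ν
    obtain ⟨k₀, hk₀, hk₀D⟩ : ∃ k₀, P k₀ ∧ k₀ ≤ D := by
      rcases hxx' with ⟨rfl, rfl⟩ | ⟨rfl, rfl⟩
      · exact ⟨0, rfl, Nat.zero_le _⟩
      · exact ⟨1, track_crit_one (hτ 0), hD0⟩
    set D' := Nat.findGreatest P D with hD'
    have hPD' : P D' := Nat.findGreatest_spec hk₀D hk₀
    have hD'le : D' ≤ D := Nat.findGreatest_le _
    have hD'lt : D' < D := lt_of_le_of_ne hD'le fun h => hy (by rw [← h]; exact hPD')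
    have hgr : ∀ k, D' < k → k ≤ D → track ν τ x' k ≠ ν := fun k h1 h2 =>
      Nat.findGreatest_is_greatest h1 h2
    have hk : ∀ k, D' + k ≤ D → track ν τ x' (D' + k) = shift^[k] ν ∧
        ∀ i < k, ν i = τ (D' + i) := by
      intro k
      induction k with
      | zero => exact fun _ => ⟨hPD', by simp⟩
      | succ k ihk =>
        intro hk
        obtain ⟨h2, h3⟩ := ihk (by omega)
        have h4 : track ν τ x' (D' + k) 0 = τ (D' + k) := by
          by_contra h4
          exact hgr (D' + k + 1) (by omega) (by omega) (track_succ_of_ne h4)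
        refine ⟨?_, ?_⟩
        · rw [← Nat.add_assoc, track_succ_of_eq h4, h2, Function.iterate_succ_apply']
        · intro i hi
          rcases Nat.lt_succ_iff_lt_or_eq.1 hi with hi | rfl
          · exact h3 i hi
          · rw [h2, shift_iterate_apply, Nat.zero_add] at h4
            exact h4
    obtain ⟨j, hj⟩ : ∃ j, D = D' + j := Nat.exists_eq_add_of_le hD'le
    obtain ⟨h2, h3⟩ := hk j (by omega)
    rw [hj, h2] at ht
    by_cases hqj : q ∣ j
    · have hshift : shift^[D'] τ = fill e ν := by
        funext n
        rw [shift_iterate_apply]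
        rcases lt_or_ge n j with hn | hn
        · have h5 := h3 n hn
          rw [Nat.add_comm n, ← h5, fill_of_ne]
          rw [h5]; exact hτ _
        · obtain ⟨n, rfl⟩ := Nat.exists_eq_add_of_le' hn
          rw [fill_add_of_dvd hq hqj, ← hD, shift_iterate_apply, hj]
          congr 1; omega
      obtain ⟨a, ha⟩ := hqj
      have hx3 : track ν (fill e ν) (track ν τ x D') (a * q) = ν := by
        rw [← hshift, ← track_add, Nat.mul_comm, ← ha, ← hj, hx]
      obtain ⟨s, hs⟩ := exists_sameSide_cycle hν hq (n := a) (t := 0)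
        (x := track ν τ x D') (by rw [hx3, Nat.zero_mul]; exact .refl)
      exact ih D' hD'lt hshift x' x (by tauto) hPD' s hs
    · have hωj : shift^[j] (fill e ν) ≠ fill e ν := fun h => hqj ((shift_fill_eq_iff hq).1 h)
      have h5 : SameSide ν (fill e ν) (shift^[j] ν) (shift^[j] (fill e ν)) :=
        sameSide_fill hν starFree_fill hωj.symm
      have h6 := sameSide_crit_of_ne hν hωj
      exact not_sameSide_crit_cycle hν he hq hA t ((h5.trans h6).symm.trans ht)
  obtain ⟨s, rfl⟩ := hqi
  refine descent N hτω (crit ν) ν (Or.inl ⟨rfl, rfl⟩) hcN s ?_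
  rw [hi', Nat.mul_comm]
  exact .refl

/-- Uniqueness of the sequences without differences from `ν` that separate the critical point
from the critical value. -/
theorem eq_fill_of_compat (hν : IsStarPeriodic ν p) (he : LastSymbol ν p e) (hτ : StarFree τ)
    (hsep : ¬ SameSide ν τ (crit ν) ν) (hc : ∀ n, ν n = none ∨ ν n = τ n) : τ = fill e ν := by
  have hp := hν.two_le
  have htr : ∀ n, track ν τ ν n = shift^[n] ν := fun n => track_post (i := 0) hν fun k _ => hc k
  funext n
  rcases hc n with h | h
  swap
  · have h4 : ν n ≠ none := by rw [h]; exact hτ n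
    rw [fill_of_ne h4, h]
  rw [fill_of_star h]
  have h' := h
  rw [hν.star_iff] at h
  obtain ⟨k, hk⟩ := h
  have hk0 : k ≠ 0 := by rintro rfl; omega
  obtain ⟨k, rfl⟩ := Nat.exists_eq_succ_of_ne_zero hk0
  have hn : n = p * k + (p - 1) := by rw [Nat.mul_succ] at hk; omega
  by_contra hne
  -- At the start of the period the critical point is tracked to something other than `ν`, so at its
  -- end it shows `e` while `ν` shows `⋆`. If `τ` had another symbol there, both would be reset and
  -- `τ` would not separate them.
  have h1 := he (shift^[p * k] τ) (fun i hi => by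
    rw [shift_iterate_apply, ← (hc _).resolve_left, hν.add_mul]
    rw [hν.add_mul]; exact hν.ne_none hi) (track ν τ (crit ν) (p * k))
    ((post_crit hν).track_mem _) (fun h => hsep ⟨p * k, by
      rw [h, htr, hν.shift_of_dvd ⟨_, rfl⟩]⟩)
  rw [← track_add, ← hn] at h1
  refine hsep ⟨n + 1, track_eq_of_ne_of_ne (by rw [h1]; exact fun h => hne h.symm) ?_⟩
  rw [htr, shift_iterate_apply, Nat.zero_add, h']
  exact (hτ n).symm

end address

/-! ### Precritical points seen from a point without `⋆` -/

/-- The precritical point `w⋆ν`, where `w` consists of the first `m` entries of `τ`. -/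
def precrit (ν τ : Itin A) (m : ℕ) : Itin A := fun i => if i < m then τ i else crit ν (i - m)

open Classical in
/-- The precritical point closest to `τ` in the direction of `x`, up to depth `m`. -/
noncomputable def cur (ν τ x : Itin A) : ℕ → Itin A
  | 0 => x
  | m + 1 => if cur ν τ x m m = none ∨ cur ν τ x m m = τ m then cur ν τ x m else precrit ν τ m

/-- Each `⋆` in `x` is followed by `ν`. -/
def Precritical (ν x : Itin A) : Prop := ∀ n, x n = none → shift^[n + 1] x = ν

section precrit

variable {ν τ : Itin A} {m : ℕ}

theorem precrit_of_lt {i : ℕ} (h : i < m) : precrit ν τ m i = τ i := if_pos h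

theorem precrit_add (i : ℕ) : precrit ν τ m (m + i) = crit ν i := by
  rw [precrit, if_neg (by omega), Nat.add_sub_cancel_left]

theorem precrit_self : precrit ν τ m m = none := precrit_add 0

theorem shift_precrit : shift^[m + 1] (precrit ν τ m) = ν := by
  funext i
  rw [shift_iterate_apply, show i + (m + 1) = m + (i + 1) by omega, precrit_add]; rfl

theorem shift_precrit_add (k : ℕ) :
    shift^[k] (precrit ν τ (k + m)) = precrit ν (shift^[k] τ) m := by
  funext i
  rw [shift_iterate_apply]
  rcases lt_or_ge i m with h | h
  · rw [precrit_of_lt h, precrit_of_lt (by omega), shift_iterate_apply]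
  · obtain ⟨i, rfl⟩ := Nat.exists_eq_add_of_le h
    rw [precrit_add, show m + i + k = k + m + i by omega, precrit_add]

end precrit

/-! ### Closest precritical points and their relation to tracks. -/

section cur

variable [One A] {ν τ x y z : Itin A} {p m n : ℕ} {e : A}

theorem crit_eq_none_iff (hν : IsStarPeriodic ν p) : crit ν n = none ↔ p ∣ n := by
  cases n with
  | zero => simp [crit]
  | succ n => rw [crit, hν.star_iff]

theorem Post.precritical (hν : IsStarPeriodic ν p) (hx : Post ν x) : Precritical ν x :=
  fun _ h => hx.shift_succ_of_star hν h

theorem precritical_crit (hν : IsStarPeriodic ν p) : Precritical ν (crit ν) :=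
  (post_crit hν).precritical hν

theorem precritical_of_shift (hν : IsStarPeriodic ν p) (h : ∀ i < m, x i ≠ none)
    (h' : shift^[m] x = crit ν) : Precritical ν x := fun n hn => by
  have hmn : m ≤ n := by
    by_contra hlt
    exact h n (by omega) hn
  obtain ⟨n, rfl⟩ := Nat.exists_eq_add_of_le' hmn
  rw [show n + m + 1 = n + 1 + m by omega, ← shift_iterate_add, h']
  apply precritical_crit hν
  rw [← h', shift_iterate_apply, hn]

theorem shift_precrit_self : shift^[m] (precrit ν τ m) = crit ν := by
  funext i
  rw [shift_iterate_apply, Nat.add_comm, precrit_add]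

theorem precritical_precrit (hν : IsStarPeriodic ν p) (hτ : StarFree τ) (m : ℕ) :
    Precritical ν (precrit ν τ m) :=
  precritical_of_shift hν (fun i hi => by rw [precrit_of_lt hi]; exact hτ i) shift_precrit_self

theorem cur_succ_of_compat (h : cur ν τ x m m = none ∨ cur ν τ x m m = τ m) :
    cur ν τ x (m + 1) = cur ν τ x m := by rw [cur, if_pos h]

theorem cur_succ_of_not (h : ¬ (cur ν τ x m m = none ∨ cur ν τ x m m = τ m)) :
    cur ν τ x (m + 1) = precrit ν τ m := by rw [cur, if_neg h]

theorem precritical_cur (hν : IsStarPeriodic ν p) (hτ : StarFree τ) (hx : Precritical ν x)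
    (m : ℕ) : Precritical ν (cur ν τ x m) := by
  induction m with
  | zero => exact hx
  | succ m ih =>
    rw [cur]
    split_ifs
    · exact ih
    · exact precritical_precrit hν hτ m

theorem cur_compat {i : ℕ} (h : i < m) : cur ν τ x m i = none ∨ cur ν τ x m i = τ i := by
  induction m with
  | zero => omega
  | succ m ih =>
    rw [cur]
    split_ifs with h'
    · rcases Nat.lt_succ_iff_lt_or_eq.1 h with h | rfl
      · exact ih h
      · exact h'
    · rcases Nat.lt_succ_iff_lt_or_eq.1 h with h | rfl
      · exact Or.inr (precrit_of_lt h)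
      · exact Or.inl precrit_self

/-- A cut of `cur` at depth `m` leaves a `⋆` followed by `ν`, which is the effect of a reset of the
track. -/
theorem track_eq_cur (hν : IsStarPeriodic ν p) (hτ : StarFree τ) (hx : Precritical ν x) (m : ℕ) :
    track ν τ x m = shift^[m] (cur ν τ x m) := by
  induction m with
  | zero => rfl
  | succ m ih =>
    have h0 : track ν τ x m 0 = cur ν τ x m m := by rw [ih, shift_iterate_apply, Nat.zero_add]
    by_cases h : cur ν τ x m m = none ∨ cur ν τ x m m = τ m
    · rw [cur_succ_of_compat h]
      by_cases h1 : cur ν τ x m m = τ m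
      · rw [track_succ_of_eq (h0.trans h1), ih, Function.iterate_succ_apply']
      · rw [track_succ_of_ne (by rwa [h0]),
          precritical_cur hν hτ hx m m (h.resolve_right h1)]
    · rw [cur_succ_of_not h, shift_precrit]
      exact track_succ_of_ne (by rw [h0]; exact fun h' => h (Or.inr h'))

theorem track_zero_entry (hν : IsStarPeriodic ν p) (hτ : StarFree τ) (hx : Precritical ν x)
    (m : ℕ) : track ν τ x m 0 = cur ν τ x m m := by
  rw [track_eq_cur hν hτ hx, shift_iterate_apply, Nat.zero_add]

/-- Equivariance of the closest precritical points. It allows them to be pushed forward and pulled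
back by the dynamics. -/
theorem shift_cur (hν : IsStarPeriodic ν p) (hτ : StarFree τ) (hx : Precritical ν x) (k m : ℕ) :
    shift^[k] (cur ν τ x (k + m)) = cur ν (shift^[k] τ) (track ν τ x k) m := by
  induction m with
  | zero => exact (track_eq_cur hν hτ hx k).symm
  | succ m ih =>
    have h0 : cur ν τ x (k + m) (k + m) = cur ν (shift^[k] τ) (track ν τ x k) m m := by
      rw [← ih, shift_iterate_apply, Nat.add_comm]
    have h1 : (shift^[k] τ) m = τ (k + m) := by rw [shift_iterate_apply, Nat.add_comm]
    rw [← Nat.add_assoc, cur, cur, ← h0, h1]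
    split_ifs
    · exact ih
    · exact shift_precrit_add k

theorem cur_cases (N : ℕ) : (∀ m ≤ N, cur ν τ x m = x) ∨ ∃ j < N, cur ν τ x N = precrit ν τ j ∧
    (∀ m, j < m → m ≤ N → cur ν τ x m = cur ν τ x N) ∧
    ¬ (cur ν τ x j j = none ∨ cur ν τ x j j = τ j) := by
  induction N with
  | zero => exact Or.inl fun m hm => by rw [Nat.le_zero.1 hm]; rfl
  | succ N ih =>
    by_cases h : cur ν τ x N N = none ∨ cur ν τ x N N = τ N
    · rcases ih with ih | ⟨j, hj, h1, h2, h3⟩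
      · left
        intro m hm
        rcases Nat.le_succ_iff.1 hm with hm | rfl
        · exact ih m hm
        · rw [cur_succ_of_compat h, ih N le_rfl]
      · refine Or.inr ⟨j, by omega, by rw [cur_succ_of_compat h, h1], fun m hm hm' => ?_, h3⟩
        rcases Nat.le_succ_iff.1 hm' with hm' | rfl
        · rw [cur_succ_of_compat h, h2 m hm hm']
        · rfl
    · exact Or.inr ⟨N, by omega, cur_succ_of_not h, fun m hm hm' => by
        rw [show m = N + 1 by omega], h⟩

theorem cur_eq_of_forall {N : ℕ}
    (h : ∀ n ≥ N, cur ν τ x n n = none ∨ cur ν τ x n n = τ n) (hm : N ≤ m) :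
    cur ν τ x m = cur ν τ x N := by
  induction m, hm using Nat.le_induction with
  | base => rfl
  | succ m hm ih => rw [cur_succ_of_compat (h m hm), ih]

/-- The main case of `cur_eventually_eq`, where `i` is the last index at which the two closest
precritical points differ. The `⋆` of `c'` at `i` forces one of `c` at `i + p`, which must come from
a cut of `x`. At time `i + 1` the point `τ` continues like `ν`, while neither `x` nor `x''` is at
`ν`; so both show `e` at depth `i + p`. Since `x` is cut there, `x''` is reset together with it, and
they are on the same side. -/
theorem not_star_of_cur_const (hν : IsStarPeriodic ν p) (he : LastSymbol ν p e)
    (hτ : StarFree τ) {x' x'' : Itin A} (hx : Post ν x) (hx' : Post ν x') (hx'' : Post ν x'')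
    (hs : SameSide ν τ x x') (hns : ¬ SameSide ν τ x'' x) {N i : ℕ}
    (hN' : ∀ n ≥ N, cur ν τ x' n n = none ∨ cur ν τ x' n n = τ n)
    (h1 : cur ν τ x' N i = none) (h2 : cur ν τ x N i ≠ none)
    (h3 : ∀ j > i, cur ν τ x N j = cur ν τ x' N j) : False := by
  have hp := hν.two_le
  have hP' := precritical_cur hν hτ (hx'.precritical hν) N
  set c := cur ν τ x N with hc
  set c' := cur ν τ x' N with hc'
  have hσ' : shift^[i + 1] c' = ν := hP' i h1
  have hcur' : ∀ m, i < m → cur ν τ x' m = c' := by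
    intro m hm
    rcases le_total N m with hm' | hm'
    · exact cur_eq_of_forall hN' hm'
    rcases cur_cases (ν := ν) (τ := τ) (x := x') N with h | ⟨j, hj, h4, h5, -⟩
    · rw [h m hm', hc', h N le_rfl]
    · apply h5 m _ hm'
      by_contra hjm
      rw [hc', h4, precrit_of_lt (by omega)] at h1
      exact hτ i h1
  have htr' : track ν τ x' (i + 1) = ν := by
    rw [track_eq_cur hν hτ (hx'.precritical hν), hcur' _ (by omega), hσ']
  have hstar : c (i + p) = none := by
    rw [h3 _ (by omega), show i + p = p - 1 + (i + 1) by omega, ← shift_iterate_apply c', hσ',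
      hν.star_iff]
    exact ⟨1, by omega⟩
  -- The `⋆`s of an uncut `x`, and those behind a cut, recur with period `p`. As `c i` is not `⋆`,
  -- the `⋆` at `i + p` is the last cut itself.
  obtain ⟨hj, hcut⟩ : i + p < N ∧
      ¬ (cur ν τ x (i + p) (i + p) = none ∨ cur ν τ x (i + p) (i + p) = τ (i + p)) := by
    rcases cur_cases (ν := ν) (τ := τ) (x := x) N with h | ⟨j, hj, h4, h5, h6⟩
    · exfalso
      rw [hc, h N le_rfl] at hstar h2
      obtain ⟨k, rfl⟩ := hx
      rw [shift_iterate_apply] at hstar h2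
      rw [Nat.add_right_comm, hν.periodic] at hstar
      exact h2 hstar
    · have hjle : j ≤ i + p := by
        by_contra hlt
        rw [hc, h4, precrit_of_lt (by omega)] at hstar
        exact hτ _ hstar
      obtain ⟨k, hk⟩ := Nat.exists_eq_add_of_le hjle
      rw [hc, h4, hk, precrit_add, crit_eq_none_iff hν] at hstar
      have hji : i < j := by
        by_contra hle
        apply h2
        rw [hc, h4, show i = j + (i - j) by omega, precrit_add, crit_eq_none_iff hν]
        rw [show k = i - j + p by omega] at hstar
        exact (Nat.dvd_add_left dvd_rfl).1 hstar
      have hk0 : k = 0 := Nat.eq_zero_of_dvd_of_lt hstar (by omega)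
      obtain rfl : j = i + p := by omega
      exact ⟨hj, h6⟩
  rw [← track_zero_entry hν hτ (hx.precritical hν), not_or] at hcut
  have hX : track ν τ x (i + 1) ≠ ν := by
    intro h
    have h4 : track ν τ x (i + p) = track ν τ x' (i + p) :=
      track_eq_of_le (h.trans htr'.symm) (by omega)
    apply hcut.1
    rw [h4, track_zero_entry hν hτ (hx'.precritical hν), hcur' _ (by omega), ← h3 _ (by omega),
      hstar]
  have hX'' : track ν τ x'' (i + 1) ≠ ν := fun h =>
    hns (SameSide.trans ⟨i + 1, h.trans htr'.symm⟩ hs.symm)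
  have hτν : ∀ n < p - 1, shift^[i + 1] τ n = ν n := by
    intro n hn
    have h4 := cur_compat (ν := ν) (τ := τ) (x := x') (show n + (i + 1) < n + (i + 2) by omega)
    rw [hcur' _ (by omega), ← shift_iterate_apply c', hσ'] at h4
    rw [shift_iterate_apply, h4.resolve_left (hν.ne_none hn)]
  have h4 := he _ hτν _ (hx.track_mem (i + 1)) hX
  have h5 := he _ hτν _ (hx''.track_mem (i + 1)) hX''
  rw [← track_add, show i + 1 + (p - 1) = i + p by omega] at h4 h5
  exact hns ⟨i + p + 1, track_eq_of_ne_of_ne (by rw [h5, ← h4]; exact hcut.2) hcut.2⟩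

/-- If two postcritical points lie on the same side of `τ`, and some other one does not, then they
are eventually separated from `τ` by the same precritical points. -/
theorem cur_eventually_eq (hν : IsStarPeriodic ν p) (he : LastSymbol ν p e)
    (hτ : StarFree τ) {x' x'' : Itin A} (hx : Post ν x) (hx' : Post ν x') (hx'' : Post ν x'')
    (hs : SameSide ν τ x x') (hns : ¬ SameSide ν τ x'' x) :
    ∃ M, ∀ m ≥ M, cur ν τ x m = cur ν τ x' m := by
  have hP := hx.precritical hν
  have hP' := hx'.precritical hν
  obtain ⟨N, hN⟩ := eventually_atTop.1 hs.eventually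
  have hentry : ∀ n ≥ N, cur ν τ x n n = cur ν τ x' n n := fun n hn => by
    rw [← track_zero_entry hν hτ hP, ← track_zero_entry hν hτ hP', hN n hn]
  -- A cut after the tracks have merged happens in both directions at once and makes the two
  -- precritical points equal for good. Without such a cut both are constant from `N` on.
  by_cases hex : ∃ n ≥ N, ¬ (cur ν τ x n n = none ∨ cur ν τ x n n = τ n)
  · obtain ⟨n, hn, hcut⟩ := hex
    refine ⟨n + 1, fun m hm => ?_⟩
    induction m, hm using Nat.le_induction with
    | base =>
      rw [cur_succ_of_not hcut, cur_succ_of_not]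
      rwa [← hentry n hn]
    | succ m hm ih => rw [cur, cur, hentry m (by omega), ih]
  · push Not at hex
    have hN' : ∀ n ≥ N, cur ν τ x' n n = none ∨ cur ν τ x' n n = τ n := fun n hn => by
      rw [← hentry n hn]; exact hex n hn
    suffices H : cur ν τ x N = cur ν τ x' N from
      ⟨N, fun m hm => by rw [cur_eq_of_forall hex hm, cur_eq_of_forall hN' hm, H]⟩
    by_contra hne
    have hge : ∀ i ≥ N, cur ν τ x N i = cur ν τ x' N i := fun i hi => by
      have := congrFun (hN N le_rfl) (i - N)
      rwa [track_eq_cur hν hτ hP, track_eq_cur hν hτ hP', shift_iterate_apply,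
        shift_iterate_apply, Nat.sub_add_cancel hi] at this
    classical
    obtain ⟨i₀, hi₀⟩ := Function.ne_iff.1 hne
    have hi₀N : i₀ ≤ N := by
      by_contra h
      exact hi₀ (hge _ (by omega))
    let P : ℕ → Prop := fun i => cur ν τ x N i ≠ cur ν τ x' N i
    -- Beyond `N` both precritical points continue as the merged track, so there is a last
    -- disagreement. Both are compatible with `τ`, so exactly one of them has `⋆` there.
    set i := Nat.findGreatest P N with hi
    have hPi : P i := Nat.findGreatest_spec hi₀N hi₀
    have hiN : i < N := by
      by_contra h
      exact hPi (hge _ (by omega))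
    have hgr : ∀ j > i, cur ν τ x N j = cur ν τ x' N j := fun j hj => by
      rcases le_total N j with h | h
      · exact hge j h
      · by_contra h'
        exact Nat.findGreatest_is_greatest hj h h'
    have h1 := cur_compat (ν := ν) (τ := τ) (x := x) hiN
    have h2 := cur_compat (ν := ν) (τ := τ) (x := x') hiN
    by_cases h3 : cur ν τ x' N i = none
    · have h4 : cur ν τ x N i ≠ none := fun h4 => hPi (h4.trans h3.symm)
      exact not_star_of_cur_const hν he hτ hx hx' hx'' hs hns hN' h3 h4 hgr
    · have h5 := h2.resolve_left h3
      have h4 : cur ν τ x N i = none := by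
        by_contra h4
        exact hPi ((h1.resolve_left h4).trans h5.symm)
      exact not_star_of_cur_const hν he hτ hx' hx hx'' hs.symm (fun h => hns (h.trans hs.symm))
        hex h4 h3 fun j hj => (hgr j hj).symm

end cur

/-! ### First differences -/

/-- There are no differences up to and including the entry with index `i`. -/
def Agree (l r : Itin A) (i : ℕ) : Prop := ∀ j ≤ i, l j = none ∨ r j = none ∨ l j = r j

/-- The first difference occurs at the entry with index `k`. -/
def FirstDiff (l r : Itin A) (k : ℕ) : Prop :=
  (l k ≠ none ∧ r k ≠ none ∧ l k ≠ r k) ∧ ∀ j < k, l j = none ∨ r j = none ∨ l j = r j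

section diff

variable {l r : Itin A} {k : ℕ}

theorem diff_eq_top_iff : diff l r = ⊤ ↔ ∀ i, l i = none ∨ r i = none ∨ l i = r i := by
  rw [diff, sInf_eq_top]
  constructor
  · intro h i
    by_contra hc
    push Not at hc
    have := h ((i : ℕ∞) + 1) ⟨i, rfl, hc⟩
    exact absurd this (by exact_mod_cast ENat.natCast_ne_top (i + 1))
  · rintro h _ ⟨i, -, h1, h2, h3⟩
    rcases h i with h | h | h
    · exact absurd h h1
    · exact absurd h h2
    · exact absurd h h3

theorem FirstDiff.diff_eq (h : FirstDiff l r k) : diff l r = (k : ℕ∞) + 1 := by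
  apply le_antisymm
  · exact sInf_le ⟨k, rfl, h.1⟩
  · refine le_sInf ?_
    rintro _ ⟨i, rfl, h1, h2, h3⟩
    have : k ≤ i := by
      by_contra hlt
      rcases h.2 i (by omega) with h | h | h
      · exact h1 h
      · exact h2 h
      · exact h3 h
    gcongr

theorem exists_firstDiff (h : diff l r ≠ ⊤) : ∃ k, FirstDiff l r k := by
  classical
  rw [Ne, diff_eq_top_iff] at h
  push Not at h
  refine ⟨Nat.find h, Nat.find_spec h, fun j hj => ?_⟩
  have := Nat.find_min h hj
  tauto

theorem FirstDiff.not_gap (h : FirstDiff l r k) : diff l r ≠ ⊤ := by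
  rw [h.diff_eq]
  exact_mod_cast ENat.natCast_ne_top (k + 1)

theorem FirstDiff.agree_iff (h : FirstDiff l r k) {i : ℕ} : Agree l r i ↔ i < k := by
  constructor
  · intro hi
    by_contra hk
    have := hi k (by omega)
    have := h.1
    tauto
  · exact fun hi j hj => h.2 j (by omega)

theorem agree_of_diff_eq_top (h : diff l r = ⊤) (i : ℕ) : Agree l r i :=
  fun j _ => diff_eq_top_iff.1 h j

theorem lt_diff_iff {i : ℕ} : (i : ℕ∞) + 1 < diff l r ↔ Agree l r i := by
  by_cases h : diff l r = ⊤
  · refine ⟨fun _ => agree_of_diff_eq_top h i, fun _ => ?_⟩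
    rw [h]
    exact_mod_cast ENat.natCast_lt_top (i + 1)
  · obtain ⟨k, hk⟩ := exists_firstDiff h
    rw [hk.agree_iff, hk.diff_eq]
    norm_cast
    omega

theorem FirstDiff.mid_apply {ν : Itin A} (h : FirstDiff l r k) (i : ℕ) :
    (i < k → l i = none → mid ν l r i = r i) ∧ (i < k → l i ≠ none → mid ν l r i = l i) := by
  have hi : i < k → (i : ℕ∞) + 1 < diff l r := fun hi => lt_diff_iff.2 (h.agree_iff.2 hi)
  constructor <;> intro h1 h2
  · rw [mid, if_pos (hi h1), if_pos h2]
  · rw [mid, if_pos (hi h1), if_neg h2]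

theorem FirstDiff.mid_add {ν : Itin A} (h : FirstDiff l r k) (i : ℕ) :
    mid ν l r (k + i) = crit ν i := by
  rw [mid, h.diff_eq]
  rw [if_neg (by norm_cast; omega)]
  cases i with
  | zero => rw [if_pos (by simp)]; rfl
  | succ i =>
    rw [if_neg (by norm_cast; omega), crit]
    congr 1
    have : ((k : ℕ∞) + 1).toNat = k + 1 := by
      rw [show (k : ℕ∞) + 1 = ((k + 1 : ℕ) : ℕ∞) by norm_cast, ENat.toNat_natCast]
    rw [this]; omega

theorem FirstDiff.mid_eq_precrit {ν τ : Itin A} (h : FirstDiff l r k)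
    (hlr : ∀ i, ¬ (l i = none ∧ r i = none)) (hl : ∀ i < k, l i = none ∨ l i = τ i)
    (hr : ∀ i < k, r i = none ∨ r i = τ i) : mid ν l r = precrit ν τ k := by
  funext i
  rcases lt_or_ge i k with hi | hi
  · rw [precrit_of_lt hi]
    by_cases h1 : l i = none
    · rw [(h.mid_apply i).1 hi h1]
      exact (hr i hi).resolve_left fun h2 => hlr i ⟨h1, h2⟩
    · rw [(h.mid_apply i).2 hi h1]
      exact (hl i hi).resolve_left h1
  · obtain ⟨i, rfl⟩ := Nat.exists_eq_add_of_le hi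
    rw [h.mid_add, precrit_add]

end diff

/-! ### The adjacent pairs -/

/-- The properties of adjacent pairs that are inherited by the pairs obtained in the next step. -/
structure GoodArc [One A] (ν : Itin A) (p : ℕ) (I : Arc A) : Prop where
  no_common : ∀ i, ¬ (I.l i = none ∧ I.r i = none)
  pre_l : Precritical ν I.l
  pre_r : Precritical ν I.r
  per_l : ∀ k, FirstDiff I.l I.r k → ∀ i ≥ k, I.l (i + p) = none → I.l i = none
  per_r : ∀ k, FirstDiff I.l I.r k → ∀ i ≥ k, I.r (i + p) = none → I.r i = none
  star_l : ∃ i, I.l i = none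
  star_r : ∃ i, I.r i = none
  lt : I.x < I.y

/-- The sequence `w` looks like a sequence between the two points of the pair. -/
def Fits (w : Itin A) (I : Arc A) : Prop := ∀ i, Agree I.l I.r i →
  w i ≠ none ∧ (I.l i = none ∨ I.l i = w i) ∧ (I.r i = none ∨ I.r i = w i)

/-- The sequence `s` lies in all adjacent pairs given by `b`. -/
def Lies (ν : Itin A) (b : ℕ → Bool) (s : Itin A) : Prop :=
  StarFree s ∧ ∀ n, Fits s (arc ν b n)

section arcs

variable [One A] {ν τ w s s' x y z l r : Itin A} {p m n k : ℕ} {e : A} {I : Arc A} {c : Bool}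
  {b : ℕ → Bool}

theorem refine_of_gap (h : IsGap I) : refine ν I c = I := if_pos h

theorem refine_true (h : ¬ IsGap I) :
    refine ν I true = ⟨mid ν I.l I.r, I.r, (I.x + I.y) / 2, I.y⟩ := by
  rw [refine, if_neg (show ¬ diff I.l I.r = ⊤ from h), if_pos rfl]

theorem refine_false (h : ¬ IsGap I) :
    refine ν I false = ⟨I.l, mid ν I.l I.r, I.x, (I.x + I.y) / 2⟩ := by
  rw [refine, if_neg (show ¬ diff I.l I.r = ⊤ from h), if_neg (by simp)]

theorem FirstDiff.agree_left (h : FirstDiff l r k) : Agree l (mid ν l r) k := by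
  intro j hj
  rcases eq_or_lt_of_le hj with rfl | hj
  · exact Or.inr (Or.inl (h.mid_add 0))
  · by_cases h1 : l j = none
    · exact Or.inl h1
    · exact Or.inr (Or.inr ((h.mid_apply j).2 hj h1).symm)

theorem FirstDiff.agree_right (h : FirstDiff l r k) : Agree (mid ν l r) r k := by
  intro j hj
  rcases eq_or_lt_of_le hj with rfl | hj
  · exact Or.inl (h.mid_add 0)
  · by_cases h1 : l j = none
    · exact Or.inr (Or.inr ((h.mid_apply j).1 hj h1))
    · rw [(h.mid_apply j).2 hj h1]
      exact h.2 j hj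

theorem Agree.mono {i : ℕ} (h : Agree l r k) (hik : i ≤ k) : Agree l r i :=
  fun j hj => h j (hj.trans hik)

theorem agree_refine {i : ℕ} (h : Agree I.l I.r i) :
    Agree (refine ν I c).l (refine ν I c).r i := by
  by_cases hg : IsGap I
  · rwa [refine_of_gap hg]
  obtain ⟨k, hk⟩ := exists_firstDiff hg
  have hik := (hk.agree_iff.1 h).le
  cases c
  · rw [refine_false hg]; exact hk.agree_left.mono hik
  · rw [refine_true hg]; exact hk.agree_right.mono hik

theorem FirstDiff.agree_refine (h : FirstDiff I.l I.r k) :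
    Agree (refine ν I c).l (refine ν I c).r k := by
  cases c
  · rw [refine_false h.not_gap]; exact h.agree_left
  · rw [refine_true h.not_gap]; exact h.agree_right

theorem FirstDiff.precritical_mid (hν : IsStarPeriodic ν p) (hI : GoodArc ν p I)
    (h : FirstDiff I.l I.r k) : Precritical ν (mid ν I.l I.r) := by
  refine precritical_of_shift (m := k) hν (fun i hi => ?_) ?_
  · by_cases h1 : I.l i = none
    · rw [(h.mid_apply i).1 hi h1]
      exact fun h2 => hI.no_common i ⟨h1, h2⟩
    · rwa [(h.mid_apply i).2 hi h1]
  · funext i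
    rw [shift_iterate_apply, Nat.add_comm, h.mid_add]

/-- The `⋆`s of the inserted point are at the indices `k + p * t`. By `per_l` and `per_r`, a `⋆` of
an old endpoint at such an index would give one at `k`, where both endpoints have symbols because
they differ there. -/
theorem GoodArc.refine (hν : IsStarPeriodic ν p) (hI : GoodArc ν p I) :
    GoodArc ν p (refine ν I c) := by
  by_cases hg : IsGap I
  · rwa [refine_of_gap hg]
  obtain ⟨k, hk⟩ := exists_firstDiff hg
  have hmid := hk.precritical_mid hν hI
  have hmidk : mid ν I.l I.r k = none := hk.mid_add 0
  have hlt : I.x < (I.x + I.y) / 2 ∧ (I.x + I.y) / 2 < I.y := by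
    have := hI.lt
    constructor <;> linarith
  have hmidper : ∀ i ≥ k, mid ν I.l I.r (i + p) = none → mid ν I.l I.r i = none := by
    intro i hi h
    obtain ⟨i, rfl⟩ := Nat.exists_eq_add_of_le hi
    rw [Nat.add_assoc, hk.mid_add, crit_eq_none_iff hν] at h
    rw [hk.mid_add, crit_eq_none_iff hν]
    exact (Nat.dvd_add_left dvd_rfl).1 h
  have hcommon : ∀ x : Itin A, x k ≠ none → (∀ i < k, mid ν I.l I.r i ≠ none) →
      (∀ i ≥ k, x (i + p) = none → x i = none) →
      ∀ i, ¬ (x i = none ∧ mid ν I.l I.r i = none) := by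
    rintro x hx hm hper i ⟨h1, h2⟩
    rcases lt_or_ge i k with hi | hi
    · exact hm i hi h2
    obtain ⟨i, rfl⟩ := Nat.exists_eq_add_of_le hi
    rw [hk.mid_add, crit_eq_none_iff hν] at h2
    obtain ⟨t, rfl⟩ := h2
    apply hx
    clear hi
    induction t with
    | zero => exact h1
    | succ t ih =>
      rw [Nat.mul_succ, ← Nat.add_assoc] at h1
      exact ih (hper _ (by omega) h1)
  have hm : ∀ i < k, mid ν I.l I.r i ≠ none := fun i hi => by
    by_cases h1 : I.l i = none
    · rw [(hk.mid_apply i).1 hi h1]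
      exact fun h2 => hI.no_common i ⟨h1, h2⟩
    · rwa [(hk.mid_apply i).2 hi h1]
  cases c
  · rw [refine_false hg]
    have hle : ∀ k', FirstDiff I.l (mid ν I.l I.r) k' → k ≤ k' := fun k' h =>
      (h.agree_iff.1 hk.agree_left).le
    exact ⟨hcommon _ hk.1.1 hm (hI.per_l k hk), hI.pre_l, hmid,
      fun k' h i hi => hI.per_l k hk i ((hle k' h).trans hi),
      fun k' h i hi => hmidper i ((hle k' h).trans hi), hI.star_l, ⟨k, hmidk⟩, hlt.1⟩
  · rw [refine_true hg]
    have hle : ∀ k', FirstDiff (mid ν I.l I.r) I.r k' → k ≤ k' := fun k' h =>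
      (h.agree_iff.1 hk.agree_right).le
    exact ⟨fun i h => hcommon _ hk.1.2.1 hm (hI.per_r k hk) i h.symm, hmid, hI.pre_r,
      fun k' h i hi => hmidper i ((hle k' h).trans hi),
      fun k' h i hi => hI.per_r k hk i ((hle k' h).trans hi), ⟨k, hmidk⟩, hI.star_r, hlt.2⟩

theorem goodArc (hν : IsStarPeriodic ν p) (b : ℕ → Bool) (n : ℕ) : GoodArc ν p (arc ν b n) := by
  induction n with
  | zero =>
    have hp := hν.two_le
    refine ⟨fun i h => ?_, precritical_crit hν, (post_self).precritical hν, fun k _ i _ h => ?_,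
      fun k _ i _ h => ?_, ⟨0, rfl⟩, ⟨p - 1, ?_⟩, zero_lt_one⟩
    · obtain ⟨h1, h2⟩ := h
      rw [arc, crit_eq_none_iff hν] at h1
      rw [arc, hν.star_iff] at h2
      have := Nat.le_of_dvd one_pos ((Nat.dvd_add_right h1).1 h2)
      omega
    · rw [arc, crit_eq_none_iff hν] at *
      exact (Nat.dvd_add_left dvd_rfl).1 h
    · exact (hν.periodic i).symm.trans h
    · rw [arc, hν.star_iff]
      exact ⟨1, by omega⟩
  | succ n ih => exact ih.refine hν

/-- Each insertion puts a `⋆` at the current first difference, which therefore moves to the right in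
every step. -/
theorem agree_arc (b : ℕ → Bool) {n i : ℕ} (h : i < n) :
    Agree (arc ν b n).l (arc ν b n).r i := by
  induction n generalizing i with
  | zero => omega
  | succ n ih =>
    by_cases hg : IsGap (arc ν b n)
    · rw [arc, refine_of_gap hg]; exact agree_of_diff_eq_top hg i
    obtain ⟨k, hk⟩ := exists_firstDiff hg
    have : n ≤ k := by
      by_contra hlt
      have := hk.agree_iff.1 (ih (by omega : k < n))
      omega
    exact hk.agree_refine.mono (by omega)

theorem agree_arc_mono {n n' i : ℕ} (hn : n ≤ n') (h : Agree (arc ν b n).l (arc ν b n).r i) :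
    Agree (arc ν b n').l (arc ν b n').r i := by
  induction n', hn using Nat.le_induction with
  | base => exact h
  | succ n' hn ih => exact agree_refine ih

theorem arc_eq_of_gap (h : IsGap (arc ν b n)) (hn : n ≤ m) : arc ν b m = arc ν b n := by
  induction m, hn using Nat.le_induction with
  | base => rfl
  | succ m hm ih => rw [arc, ih, refine_of_gap h]

theorem arc_congr {b b' : ℕ → Bool} (h : ∀ i < n, b i = b' i) : arc ν b n = arc ν b' n := by
  induction n with
  | zero => rfl
  | succ n ih => rw [arc, arc, ih fun i hi => h i (by omega), h n (by omega)]

theorem fits_of_refine (h : Fits w (refine ν I c)) : Fits w I := by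
  by_cases hg : IsGap I
  · rwa [refine_of_gap hg] at h
  obtain ⟨k, hk⟩ := exists_firstDiff hg
  intro i hi
  have hik := hk.agree_iff.1 hi
  have h' := h i (agree_refine hi)
  cases c
  · rw [refine_false hg] at h'
    obtain ⟨h1, h2, h3⟩ := h'
    refine ⟨h1, h2, ?_⟩
    by_cases h4 : I.l i = none
    · rwa [← (hk.mid_apply (ν := ν) i).1 hik h4]
    · rw [or_iff_not_imp_left]
      intro h5
      rw [← h2.resolve_left h4]
      have := hi i le_rfl
      tauto
  · rw [refine_true hg] at h'
    obtain ⟨h1, h2, h3⟩ := h'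
    refine ⟨h1, ?_, h3⟩
    by_cases h4 : I.l i = none
    · exact Or.inl h4
    · rwa [← (hk.mid_apply (ν := ν) i).2 hik h4]

theorem fits_arc_mono (hmn : n ≤ m) (h : Fits w (arc ν b m)) : Fits w (arc ν b n) := by
  induction m, hmn using Nat.le_induction with
  | base => exact h
  | succ m hm ih => exact ih (fits_of_refine h)

theorem GoodArc.fits_mid (hI : GoodArc ν p I) (h : FirstDiff I.l I.r k) :
    Fits (mid ν I.l I.r) I := by
  intro i hi
  have hik := h.agree_iff.1 hi
  have h3 := h.2 i hik
  have h4 := hI.no_common i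
  by_cases h1 : I.l i = none
  · rw [(h.mid_apply i).1 hik h1]
    tauto
  · rw [(h.mid_apply i).2 hik h1]
    tauto

/-- Before the first difference at least one endpoint has a symbol, by `no_common`, and that symbol
is forced. -/
theorem GoodArc.fits_unique (hI : GoodArc ν p I) (h : Fits w I) (h' : Fits s I) {i : ℕ}
    (hi : Agree I.l I.r i) : w i = s i := by
  obtain ⟨-, h1, h2⟩ := h i hi
  obtain ⟨-, h3, h4⟩ := h' i hi
  by_cases h5 : I.l i = none
  · have h6 : I.r i ≠ none := fun h6 => hI.no_common i ⟨h5, h6⟩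
    rw [← h2.resolve_left h6, ← h4.resolve_left h6]
  · rw [← h1.resolve_left h5, ← h3.resolve_left h5]

theorem Lies.unique (hν : IsStarPeriodic ν p) (h : Lies ν b s) (h' : Lies ν b s') : s = s' :=
  funext fun i => (goodArc hν b (i + 1)).fits_unique (h.2 _) (h'.2 _)
    (agree_arc b (Nat.lt_succ_self i))

-- Entry `i` is read off at any stage whose first difference comes after `i`; refining the pair does
-- not change it.
open Classical in
theorem exists_lies (hν : IsStarPeriodic ν p) (b : ℕ → Bool) : ∃ s, Lies ν b s := by
  let v : ℕ → Itin A := fun n i =>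
    if (arc ν b n).l i = none then (arc ν b n).r i else (arc ν b n).l i
  have hv : ∀ n i, Agree (arc ν b n).l (arc ν b n).r i → v (n + 1) i = v n i := by
    intro n i hi
    by_cases hg : IsGap (arc ν b n)
    · simp only [v, arc_eq_of_gap hg (Nat.le_succ n)]
    obtain ⟨k, hk⟩ := exists_firstDiff hg
    have hik := hk.agree_iff.1 hi
    simp only [v]
    rw [arc]
    cases b n
    · rw [refine_false hg]
      by_cases h1 : (arc ν b n).l i = none
      · simp only [if_pos h1, (hk.mid_apply (ν := ν) i).1 hik h1]
      · simp only [if_neg h1]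
    · rw [refine_true hg]
      by_cases h1 : (arc ν b n).l i = none
      · simp only [if_pos h1, (hk.mid_apply (ν := ν) i).1 hik h1, ite_self]
      · simp only [if_neg h1, (hk.mid_apply (ν := ν) i).2 hik h1]
  have hv' : ∀ n n' i, n ≤ n' → Agree (arc ν b n).l (arc ν b n).r i → v n' i = v n i := by
    intro n n' i hn hi
    induction n', hn using Nat.le_induction with
    | base => rfl
    | succ n' hn ih => rw [hv n' i (agree_arc_mono hn hi), ih]
  have hne : ∀ n i, v n i ≠ none := by
    intro n i
    have := (goodArc hν b n).no_common i
    simp only [v]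
    split_ifs with h
    · tauto
    · exact h
  refine ⟨fun i => v (i + 1) i, fun i => hne _ _, fun n i hi => ?_⟩
  have h1 : v (i + 1) i = v n i := by
    rcases le_total n (i + 1) with h | h
    · exact hv' _ _ _ h hi
    · exact (hv' _ _ _ h (agree_arc b (Nat.lt_succ_self i))).symm
  have h2 := hne n i
  beta_reduce
  rw [h1]
  have h3 := hi i le_rfl
  refine ⟨h2, ?_⟩
  simp only [v] at h2 ⊢
  split_ifs with h
  · tauto
  · tauto

/-- Membership in all pairs replaces convergence, so that limit sequences and central itineraries
(`isCentralIn_iff`) can be treated alike. -/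
theorem isLimit_iff (hν : IsStarPeriodic ν p) :
    IsLimit ν b s ↔ Lies ν b s ∧ ∀ n, ¬ IsGap (arc ν b n) := by
  constructor
  · rintro ⟨h1, h2, h3⟩
    refine ⟨⟨h1, fun n i hi => ?_⟩, h2⟩
    rw [ENat.tendsto_nhds_top_iff_natCast_lt] at h3
    obtain ⟨m, hm, hmn⟩ := ((h3 (i + 1)).and (eventually_ge_atTop n)).exists
    obtain ⟨k, hk⟩ := exists_firstDiff (h2 m)
    have h4 := fits_arc_mono hmn ((goodArc hν b m).fits_mid hk) i hi
    have h5 : Agree (mid ν (arc ν b m).l (arc ν b m).r) s i := by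
      rw [← lt_diff_iff]; exact_mod_cast hm
    have h6 := h5 i le_rfl
    have h7 := h1 i
    have h8 : mid ν (arc ν b m).l (arc ν b m).r i = s i := by tauto
    rwa [h8] at h4
  · rintro ⟨⟨h1, h2⟩, h3⟩
    refine ⟨h1, h3, ?_⟩
    rw [ENat.tendsto_nhds_top_iff_natCast_lt]
    intro N
    filter_upwards [eventually_ge_atTop (N + 1)] with n hn
    obtain ⟨k, hk⟩ := exists_firstDiff (h3 n)
    have h4 : Agree (mid ν (arc ν b n).l (arc ν b n).r) s N := fun j hj => Or.inr (Or.inr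
      ((goodArc hν b n).fits_unique ((goodArc hν b n).fits_mid hk) (h2 n)
        (agree_arc b (by omega))))
    exact lt_of_le_of_lt le_self_add (lt_diff_iff.2 h4)

theorem isCentralIn_iff : IsCentralIn s (arc ν b n) ↔ IsGap (arc ν b n) ∧ Lies ν b s := by
  constructor
  · rintro ⟨h1, h2, h3, h4⟩
    refine ⟨h1, h2, fun m => ?_⟩
    have hn : Fits s (arc ν b n) := fun i _ => by
      have h5 := diff_eq_top_iff.1 h3 i
      have h6 := diff_eq_top_iff.1 h4 i
      have h7 := h2 i
      refine ⟨h7, by tauto, ?_⟩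
      rcases h6 with h | h | h
      · exact absurd h h7
      · exact Or.inl h
      · exact Or.inr h.symm
    rcases le_total m n with h | h
    · exact fits_arc_mono h hn
    · rwa [arc_eq_of_gap h1 h]
  · rintro ⟨h1, h2, h3⟩
    have h4 := fun i => h3 n i (agree_of_diff_eq_top h1 i)
    refine ⟨h1, h2, diff_eq_top_iff.2 fun i => ?_, diff_eq_top_iff.2 fun i => ?_⟩
    · have := h4 i; tauto
    · rcases (h4 i).2.2 with h | h
      · exact Or.inr (Or.inl h)
      · exact Or.inr (Or.inr h.symm)

/-! ### The pairs around a point, and the closest precritical points -/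

/-- The pair `I` consists of the precritical points closest to `τ` up to depth `m`. -/
def Surrounds (ν τ : Itin A) (I : Arc A) (m : ℕ) : Prop :=
  I.l = cur ν τ (crit ν) m ∧ I.r = cur ν τ ν m

theorem Surrounds.extend (h : Surrounds ν τ I m) (hmk : m ≤ k)
    (hc : ∀ j, m ≤ j → j < k → (I.l j = none ∨ I.l j = τ j) ∧ (I.r j = none ∨ I.r j = τ j)) :
    Surrounds ν τ I k := by
  induction k, hmk using Nat.le_induction with
  | base => exact h
  | succ k hk ih =>
    obtain ⟨h1, h2⟩ := ih fun j hj hj' => hc j hj (by omega)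
    obtain ⟨h3, h4⟩ := hc k hk (by omega)
    exact ⟨by rw [cur_succ_of_compat (by rwa [← h1]), h1],
      by rw [cur_succ_of_compat (by rwa [← h2]), h2]⟩

theorem Surrounds.le (h : Surrounds ν τ I m) (hk : FirstDiff I.l I.r k) : m ≤ k := by
  by_contra hlt
  have h1 := cur_compat (ν := ν) (τ := τ) (x := crit ν) (show k < m by omega)
  have h2 := cur_compat (ν := ν) (τ := τ) (x := ν) (show k < m by omega)
  rw [← h.1] at h1
  rw [← h.2] at h2
  exact hk.1.2.2 ((h1.resolve_left hk.1.1).trans (h2.resolve_left hk.1.2.1).symm)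

/-- The inserted point is the cut at depth `k` on the side whose entry disagrees with `τ`. -/
theorem Surrounds.step (hI : GoodArc ν p I) (h : Surrounds ν τ I k) (hk : FirstDiff I.l I.r k)
    (hc : I.r k = τ k ∧ c = true ∨ I.l k = τ k ∧ c = false) :
    Surrounds ν τ (refine ν I c) (k + 1) := by
  have hmid : mid ν I.l I.r = precrit ν τ k := hk.mid_eq_precrit hI.no_common
    (fun i hi => by rw [h.1]; exact cur_compat hi) (fun i hi => by rw [h.2]; exact cur_compat hi)
  rcases hc with ⟨hc, rfl⟩ | ⟨hc, rfl⟩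
  · rw [refine_true hk.not_gap]
    refine ⟨?_, ?_⟩
    · rw [cur_succ_of_not, ← hmid]
      rw [← h.1, not_or]
      exact ⟨hk.1.1, fun h' => hk.1.2.2 (h'.trans hc.symm)⟩
    · rw [cur_succ_of_compat, ← h.2]
      rw [← h.2]; exact Or.inr hc
  · rw [refine_false hk.not_gap]
    refine ⟨?_, ?_⟩
    · rw [cur_succ_of_compat, ← h.1]
      rw [← h.1]; exact Or.inr hc
    · rw [cur_succ_of_not, ← hmid]
      rw [← h.2, not_or]
      exact ⟨hk.1.2.1, fun h' => hk.1.2.2 (hc.trans h'.symm)⟩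

theorem Lies.step (hν : IsStarPeriodic ν p) (h : Lies ν b τ)
    (hm : Surrounds ν τ (arc ν b n) k) (hk : FirstDiff (arc ν b n).l (arc ν b n).r k) :
    Surrounds ν τ (arc ν b (n + 1)) (k + 1) := by
  refine hm.step (goodArc hν b n) hk ?_
  have h1 := h.2 (n + 1) k hk.agree_refine
  rw [arc] at h1
  cases hb : b n
  · rw [hb, refine_false hk.not_gap] at h1
    exact Or.inr ⟨h1.2.1.resolve_left hk.1.1, rfl⟩
  · rw [hb, refine_true hk.not_gap] at h1
    exact Or.inl ⟨h1.2.2.resolve_left hk.1.2.1, rfl⟩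

/-- The link between the construction of the path and tracks: the pairs around `τ` are the closest
precritical points in the directions of the critical point and of the critical value. -/
theorem Lies.exists_surrounds (hν : IsStarPeriodic ν p) (h : Lies ν b τ) (n : ℕ) :
    ∃ m ≥ n, Surrounds ν τ (arc ν b n) m := by
  induction n with
  | zero => exact ⟨0, le_rfl, rfl, rfl⟩
  | succ n ih =>
    obtain ⟨m, hmn, hm⟩ := ih
    by_cases hg : IsGap (arc ν b n)
    · rw [arc_eq_of_gap hg (Nat.le_succ n)]
      exact ⟨m + 1, by omega, hm.extend (Nat.le_succ m) fun j _ _ =>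
        (h.2 n j (agree_of_diff_eq_top hg j)).2⟩
    · obtain ⟨k, hk⟩ := exists_firstDiff hg
      refine ⟨k + 1, ?_, h.step hν (hm.extend (hm.le hk) fun j _ hj =>
        (h.2 n j (hk.agree_iff.2 hj)).2) hk⟩
      have := hm.le hk
      omega

theorem Lies.exists_surrounds' (hν : IsStarPeriodic ν p) (h : Lies ν b τ) (m : ℕ) :
    ∃ n, Surrounds ν τ (arc ν b n) m := by
  induction m with
  | zero => exact ⟨0, rfl, rfl⟩
  | succ m ih =>
    obtain ⟨n, hn⟩ := ih
    by_cases ha : Agree (arc ν b n).l (arc ν b n).r m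
    · refine ⟨n, hn.extend (Nat.le_succ m) fun j hj hj' => ?_⟩
      obtain rfl : j = m := by omega
      exact (h.2 n j ha).2
    · have hg : ¬ IsGap (arc ν b n) := fun hg => ha (agree_of_diff_eq_top hg m)
      obtain ⟨k, hk⟩ := exists_firstDiff hg
      have h1 := hn.le hk
      rw [hk.agree_iff] at ha
      obtain rfl : m = k := by omega
      exact ⟨n + 1, h.step hν hn hk⟩

/-- If the tracks merged, the endpoints of a surrounding pair would have a common tail with a `⋆` in
it, against `no_common`. -/
theorem Lies.not_sameSide (hν : IsStarPeriodic ν p) (h : Lies ν b τ) :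
    ¬ SameSide ν τ (crit ν) ν := by
  rintro ⟨m, hm⟩
  obtain ⟨n, hn⟩ := h.exists_surrounds' hν m
  have hI := goodArc hν b n
  rw [track_eq_cur hν h.1 (precritical_crit hν), track_eq_cur hν h.1 (post_self.precritical hν),
    ← hn.1, ← hn.2] at hm
  have hpost : Post ν (shift^[m] (arc ν b n).l) := by
    rw [hn.1, ← track_eq_cur hν h.1 (precritical_crit hν)]
    exact (post_crit hν).track_mem m
  obtain ⟨i, hi⟩ := hpost
  have hstar : shift^[m] (arc ν b n).l (p * (i + 1) - 1 - i) = none := by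
    have h1 : i + 1 ≤ p * (i + 1) := Nat.le_mul_of_pos_left _ hν.pos
    rw [hi, shift_iterate_apply, hν.star_iff,
      show p * (i + 1) - 1 - i + i + 1 = p * (i + 1) by omega]
    exact ⟨_, rfl⟩
  have hstar' := hstar
  rw [hm] at hstar'
  rw [shift_iterate_apply] at hstar hstar'
  exact hI.no_common _ ⟨hstar, hstar'⟩

/-- If both endpoints disagreed with `τ` at depth `m`, both would be cut there and the tracks would
merge. -/
theorem Surrounds.sep (hν : IsStarPeriodic ν p) (hτ : StarFree τ)
    (hsep : ¬ SameSide ν τ (crit ν) ν) (h : Surrounds ν τ I m) :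
    I.l m = τ m ∨ I.r m = τ m := by
  by_contra hc
  rw [not_or, h.1, h.2, ← track_zero_entry hν hτ (precritical_crit hν),
    ← track_zero_entry hν hτ (post_self.precritical hν)] at hc
  exact hsep ⟨m + 1, track_eq_of_ne_of_ne hc.1 hc.2⟩

theorem Surrounds.extend_of_agree (hν : IsStarPeriodic ν p) (hτ : StarFree τ)
    (hsep : ¬ SameSide ν τ (crit ν) ν) (h : Surrounds ν τ I m) (hmk : m ≤ k)
    (hc : ∀ j < k, I.l j = none ∨ I.r j = none ∨ I.l j = I.r j) : Surrounds ν τ I k := by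
  induction k, hmk using Nat.le_induction with
  | base => exact h
  | succ k hk ih =>
    have ih := ih fun j hj => hc j (by omega)
    refine ih.extend (Nat.le_succ k) fun j hj hj' => ?_
    obtain rfl : j = k := by omega
    have h1 := ih.sep hν hτ hsep
    have h2 := hc j (by omega)
    have h3 := hτ j
    rcases h1 with h1 | h1
    · refine ⟨Or.inr h1, ?_⟩
      rw [h1] at h2
      rcases h2 with h2 | h2 | h2
      · exact absurd h2 h3
      · exact Or.inl h2
      · exact Or.inr h2.symm
    · refine ⟨?_, Or.inr h1⟩
      rw [h1] at h2
      tauto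

open Classical in
/-- The points without `⋆` that separate the critical point from the critical value lie on the
critical path. -/
theorem exists_lies_of_sep (hν : IsStarPeriodic ν p) (hτ : StarFree τ)
    (hsep : ¬ SameSide ν τ (crit ν) ν) : ∃ b, Lies ν b τ := by
  -- The half in which `τ` lies: the right one if `τ` has the entry of the right endpoint at the
  -- first difference.
  let c : Arc A → Bool := fun I => decide (∃ k, FirstDiff I.l I.r k ∧ I.r k = τ k)
  let path : ℕ → Arc A := fun n => (fun I => refine ν I (c I))^[n] ⟨crit ν, ν, 0, 1⟩
  let b : ℕ → Bool := fun n => c (path n)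
  have hpath : ∀ n, arc ν b n = path n := fun n => by
    induction n with
    | zero => rfl
    | succ n ih =>
      rw [arc, ih]
      simp only [path, b, Function.iterate_succ_apply']
  have hb : ∀ n, b n = c (arc ν b n) := fun n => by rw [hpath]
  have hs : ∀ n, ∃ m, Surrounds ν τ (arc ν b n) m := by
    intro n
    induction n with
    | zero => exact ⟨0, rfl, rfl⟩
    | succ n ih =>
      obtain ⟨m, hm⟩ := ih
      by_cases hg : IsGap (arc ν b n)
      · rw [arc_eq_of_gap hg (Nat.le_succ n)]
        exact ⟨m, hm⟩
      obtain ⟨k, hk⟩ := exists_firstDiff hg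
      have hm' := hm.extend_of_agree hν hτ hsep (hm.le hk) hk.2
      refine ⟨k + 1, hm'.step (goodArc hν b n) hk ?_⟩
      rw [hb]
      by_cases h1 : (arc ν b n).r k = τ k
      · exact Or.inl ⟨h1, decide_eq_true ⟨k, hk, h1⟩⟩
      · refine Or.inr ⟨(hm'.sep hν hτ hsep).resolve_right h1, decide_eq_false ?_⟩
        rintro ⟨k', hk', h2⟩
        obtain rfl : k = k' := by
          have h3 := hk.diff_eq.symm.trans hk'.diff_eq
          norm_cast at h3
          omega
        exact h1 h2
  refine ⟨b, hτ, fun n i hi => ⟨hτ i, ?_⟩⟩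
  obtain ⟨m, hm⟩ := hs n
  obtain ⟨h1, h2⟩ := hm.extend_of_agree (k := max m (i + 1)) hν hτ hsep (le_max_left _ _) (by
    rintro j hj
    rcases lt_or_ge j m with hj' | hj'
    · have h3 := cur_compat (ν := ν) (x := crit ν) (τ := τ) hj'
      have h4 := cur_compat (ν := ν) (x := ν) (τ := τ) hj'
      rw [← hm.1] at h3
      rw [← hm.2] at h4
      rcases h3 with h3 | h3
      · exact Or.inl h3
      rcases h4 with h4 | h4
      · exact Or.inr (Or.inl h4)
      · exact Or.inr (Or.inr (h3.trans h4.symm))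
    · exact hi j (by omega))
  rw [h1, h2]
  exact ⟨cur_compat (by omega), cur_compat (by omega)⟩

end arcs

/-! ### Positions on the critical path -/

/-- The itinerary of a point; for a point in a Fatou interval, that of its end without `⋆`. -/
def Pt.sym : Pt A → Itin A
  | .itin s => s
  | .fatou u _ _ => u

/-- The itinerary of a point; for a point in a Fatou interval, that of its precritical end. -/
def Pt.rep : Pt A → Itin A
  | .itin s => s
  | .fatou _ c _ => c

open Classical in
/-- The half-open Fatou interval from `s` to `c`, parametrized by `[0, 1)`. -/
noncomputable def fatouPt (s c : Itin A) (t : ℝ) : Pt A :=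
  if h : t ∈ Set.Ioo (0 : ℝ) 1 then .fatou s c ⟨t, h⟩ else .itin s

/-- The point `z` at the position `k` lies between the endpoints of the pair `I`. -/
def InArc (z : Pt A) (k : ℝ ×ₗ ℝ) (I : Arc A) : Prop :=
  (k = toLex (I.x, 0) ∧ z = .itin I.l) ∨ (k = toLex (I.y, 0) ∧ z = .itin I.r) ∨
    (toLex (I.x, 0) < k ∧ k < toLex (I.y, 0) ∧ Fits z.sym I)

/-- The points that belong to all pairs of a nested sequence. -/
inductive Terminal (I : ℕ → Arc A) (s : Itin A) : Pt A → ℝ ×ₗ ℝ → Prop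
  | limit (v : ℝ) : (∀ n, ¬ IsGap (I n)) → (∀ n, ∃ m ≥ n, (I n).x < (I m).x) →
      (∀ n, ∃ m ≥ n, (I m).y < (I n).y) → Tendsto (fun n => (I n).x) atTop (𝓝 v) →
      Terminal I s (.itin s) (toLex (v, 0))
  | left (n : ℕ) (t : ℝ) : (∀ n, ¬ IsGap (I n)) →
      (∀ m ≥ n, (I m).y = (I n).y ∧ (I m).r = (I n).r ∧ (I m).x < (I (m + 1)).x) →
      t ∈ Set.Ico (0 : ℝ) 1 → Terminal I s (fatouPt s (I n).r t) (toLex ((I n).y, -1 + t))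
  | right (n : ℕ) (t : ℝ) : (∀ n, ¬ IsGap (I n)) →
      (∀ m ≥ n, (I m).x = (I n).x ∧ (I m).l = (I n).l ∧ (I (m + 1)).y < (I m).y) →
      t ∈ Set.Ico (0 : ℝ) 1 → Terminal I s (fatouPt s (I n).l t) (toLex ((I n).x, 1 - t))
  | gapL (n : ℕ) (t : ℝ) : IsGap (I n) → t ∈ Set.Ico (0 : ℝ) 1 →
      Terminal I s (fatouPt s (I n).l t)
        (toLex (((I n).x + (I n).y) / 2 - t * (((I n).y - (I n).x) / 2), 0))
  | gapR (n : ℕ) (t : ℝ) : IsGap (I n) → t ∈ Set.Ico (0 : ℝ) 1 →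
      Terminal I s (fatouPt s (I n).r t)
        (toLex (((I n).x + (I n).y) / 2 + t * (((I n).y - (I n).x) / 2), 0))

section positions

theorem fatouPt_zero (s c : Itin A) : fatouPt s c 0 = .itin s := dif_neg (by simp)

theorem fatouPt_coe (s c : Itin A) (t : Set.Ioo (0 : ℝ) 1) : fatouPt s c t = .fatou s c t :=
  dif_pos t.2

theorem fatouPt_sym (s c : Itin A) (t : ℝ) : (fatouPt s c t).sym = s := by
  rw [fatouPt]; split_ifs <;> rfl

theorem fatouPt_eq_iff {s c c' : Itin A} {t t' : ℝ} (ht : t ∈ Set.Ico (0 : ℝ) 1)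
    (ht' : t' ∈ Set.Ico (0 : ℝ) 1) :
    fatouPt s c t = fatouPt s c' t' ↔ t = t' ∧ (t = 0 ∨ c = c') := by
  rcases eq_or_lt_of_le ht.1 with h | h
  · subst h
    rw [fatouPt_zero]
    rcases eq_or_lt_of_le ht'.1 with h' | h'
    · subst h'; simp [fatouPt_zero]
    · rw [show fatouPt s c' t' = .fatou s c' ⟨t', h', ht'.2⟩ from dif_pos _]
      simp [h'.ne]
  · rw [show fatouPt s c t = .fatou s c ⟨t, h, ht.2⟩ from dif_pos _]
    rcases eq_or_lt_of_le ht'.1 with h' | h'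
    · subst h'; simp [fatouPt_zero, h.ne']
    · rw [show fatouPt s c' t' = .fatou s c' ⟨t', h', ht'.2⟩ from dif_pos _]
      simp [h.ne', and_comm, Subtype.ext_iff]

variable [One A] {ν τ w s s' : Itin A} {p m n : ℕ} {I : Arc A} {c : Bool} {b b' : ℕ → Bool}
  {z z' : Pt A} {k k' : ℝ ×ₗ ℝ}

theorem toLex_lt_of_fst {a b c d : ℝ} (h : a < c) : (toLex (a, b) : ℝ ×ₗ ℝ) < toLex (c, d) :=
  Prod.Lex.toLex_lt_toLex.2 (Or.inl h)

theorem toLex_lt_of_snd {a b d : ℝ} (h : b < d) : (toLex (a, b) : ℝ ×ₗ ℝ) < toLex (a, d) :=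
  Prod.Lex.toLex_lt_toLex.2 (Or.inr ⟨rfl, h⟩)

theorem GoodArc.mid_lt (hI : GoodArc ν p I) : I.x < (I.x + I.y) / 2 ∧ (I.x + I.y) / 2 < I.y := by
  have := hI.lt
  constructor <;> linarith

theorem inArc_of_refine (hI : GoodArc ν p I) (h : InArc z k (refine ν I c)) : InArc z k I := by
  by_cases hg : IsGap I
  · rwa [refine_of_gap hg] at h
  obtain ⟨j, hj⟩ := exists_firstDiff hg
  have hlt := hI.mid_lt
  have hup : Fits z.sym (refine ν I c) → Fits z.sym I := fits_of_refine
  cases c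
  · rw [refine_false hg] at h hup
    rcases h with ⟨h1, h2⟩ | ⟨h1, h2⟩ | ⟨h1, h2, h3⟩
    · exact Or.inl ⟨h1, h2⟩
    · refine Or.inr (Or.inr ⟨?_, ?_, ?_⟩)
      · rw [h1]; exact toLex_lt_of_fst hlt.1
      · rw [h1]; exact toLex_lt_of_fst hlt.2
      · rw [h2]; exact hI.fits_mid hj
    · exact Or.inr (Or.inr ⟨h1, h2.trans (toLex_lt_of_fst hlt.2), hup h3⟩)
  · rw [refine_true hg] at h hup
    rcases h with ⟨h1, h2⟩ | ⟨h1, h2⟩ | ⟨h1, h2, h3⟩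
    · refine Or.inr (Or.inr ⟨?_, ?_, ?_⟩)
      · rw [h1]; exact toLex_lt_of_fst hlt.1
      · rw [h1]; exact toLex_lt_of_fst hlt.2
      · rw [h2]; exact hI.fits_mid hj
    · exact Or.inr (Or.inl ⟨h1, h2⟩)
    · exact Or.inr (Or.inr ⟨(toLex_lt_of_fst hlt.1).trans h1, h2, hup h3⟩)

theorem inArc_mono (hν : IsStarPeriodic ν p) (hmn : n ≤ m) (h : InArc z k (arc ν b m)) :
    InArc z k (arc ν b n) := by
  induction m, hmn using Nat.le_induction with
  | base => exact h
  | succ m hm ih => exact ih (inArc_of_refine (goodArc hν b m) h)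

theorem arc_succ_true (hg : ¬ IsGap (arc ν b n)) (hb : b n = true) :
    arc ν b (n + 1) = ⟨mid ν (arc ν b n).l (arc ν b n).r, (arc ν b n).r,
      ((arc ν b n).x + (arc ν b n).y) / 2, (arc ν b n).y⟩ := by
  rw [arc, hb, refine_true hg]

theorem arc_succ_false (hg : ¬ IsGap (arc ν b n)) (hb : b n = false) :
    arc ν b (n + 1) = ⟨(arc ν b n).l, mid ν (arc ν b n).l (arc ν b n).r,
      (arc ν b n).x, ((arc ν b n).x + (arc ν b n).y) / 2⟩ := by
  rw [arc, hb, refine_false hg]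

theorem arc_right_const (hb : ∀ i ≥ n, b i = true) (hm : n ≤ m) :
    (arc ν b m).y = (arc ν b n).y ∧ (arc ν b m).r = (arc ν b n).r := by
  induction m, hm using Nat.le_induction with
  | base => exact ⟨rfl, rfl⟩
  | succ m hm ih =>
    by_cases hg : IsGap (arc ν b m)
    · rwa [arc_eq_of_gap hg (Nat.le_succ m)]
    · rwa [arc_succ_true hg (hb m hm)]

theorem arc_left_const (hb : ∀ i ≥ n, b i = false) (hm : n ≤ m) :
    (arc ν b m).x = (arc ν b n).x ∧ (arc ν b m).l = (arc ν b n).l := by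
  induction m, hm using Nat.le_induction with
  | base => exact ⟨rfl, rfl⟩
  | succ m hm ih =>
    by_cases hg : IsGap (arc ν b m)
    · rwa [arc_eq_of_gap hg (Nat.le_succ m)]
    · rwa [arc_succ_false hg (hb m hm)]

theorem arc_nested (hν : IsStarPeriodic ν p) (hmn : n ≤ m) :
    (arc ν b n).x ≤ (arc ν b m).x ∧ (arc ν b m).y ≤ (arc ν b n).y := by
  induction m, hmn using Nat.le_induction with
  | base => exact ⟨le_rfl, le_rfl⟩
  | succ m hm ih =>
    have := (goodArc hν b m).mid_lt
    by_cases hg : IsGap (arc ν b m)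
    · rwa [arc_eq_of_gap hg (Nat.le_succ m)]
    · cases hb : b m
      · rw [arc_succ_false hg hb]; exact ⟨ih.1, this.2.le.trans ih.2⟩
      · rw [arc_succ_true hg hb]; exact ⟨ih.1.trans this.1.le, ih.2⟩

theorem arc_lt_of_true (hν : IsStarPeriodic ν p) (hg : ¬ IsGap (arc ν b n)) (hb : b n = true) :
    (arc ν b n).x < (arc ν b (n + 1)).x := by
  rw [arc_succ_true hg hb]; exact (goodArc hν b n).mid_lt.1

theorem arc_lt_of_false (hν : IsStarPeriodic ν p) (hg : ¬ IsGap (arc ν b n)) (hb : b n = false) :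
    (arc ν b (n + 1)).y < (arc ν b n).y := by
  rw [arc_succ_false hg hb]; exact (goodArc hν b n).mid_lt.2

theorem gap_value_mem {x y t : ℝ} (h : x < y) (ht : t ∈ Set.Ico (0 : ℝ) 1) :
    (x < (x + y) / 2 - t * ((y - x) / 2) ∧ (x + y) / 2 - t * ((y - x) / 2) < y) ∧
    (x < (x + y) / 2 + t * ((y - x) / 2) ∧ (x + y) / 2 + t * ((y - x) / 2) < y) := by
  obtain ⟨h0, h1⟩ := ht
  have h2 : t * ((y - x) / 2) < 1 * ((y - x) / 2) := by
    apply mul_lt_mul_of_pos_right h1; linarith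
  have h3 : 0 ≤ t * ((y - x) / 2) := by
    apply mul_nonneg h0; linarith
  refine ⟨⟨?_, ?_⟩, ?_, ?_⟩ <;> linarith

theorem Terminal.inArc (hν : IsStarPeriodic ν p) (hs : Lies ν b s)
    (h : Terminal (arc ν b) s z k) (n : ℕ) : InArc z k (arc ν b n) := by
  have hlt := fun n => (goodArc hν b n).lt
  cases h with
  | limit v h1 h2 h3 h4 =>
    refine Or.inr (Or.inr ⟨toLex_lt_of_fst ?_, toLex_lt_of_fst ?_, hs.2 n⟩)
    · obtain ⟨m, -, hm⟩ := h2 n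
      refine lt_of_lt_of_le hm (ge_of_tendsto h4 ?_)
      filter_upwards [eventually_ge_atTop m] with i hi using (arc_nested hν hi).1
    · obtain ⟨m, -, hm⟩ := h3 n
      refine lt_of_le_of_lt (le_of_tendsto h4 ?_) hm
      filter_upwards [eventually_ge_atTop m] with i hi
      exact (hlt i).le.trans (arc_nested hν hi).2
  | left j t h1 h2 ht =>
    refine inArc_mono hν (le_max_left n j) (Or.inr (Or.inr ⟨?_, ?_, ?_⟩))
    · rw [← (h2 _ (le_max_right n j)).1]
      exact toLex_lt_of_fst (hlt _)
    · rw [(h2 _ (le_max_right n j)).1]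
      exact toLex_lt_of_snd (by have := ht.2; linarith)
    · rw [fatouPt_sym]; exact hs.2 _
  | right j t h1 h2 ht =>
    refine inArc_mono hν (le_max_left n j) (Or.inr (Or.inr ⟨?_, ?_, ?_⟩))
    · rw [(h2 _ (le_max_right n j)).1]
      exact toLex_lt_of_snd (by have := ht.2; linarith)
    · rw [← (h2 _ (le_max_right n j)).1]
      exact toLex_lt_of_fst (hlt _)
    · rw [fatouPt_sym]; exact hs.2 _
  | gapL j t h1 ht =>
    refine inArc_mono hν (le_max_left n j) (Or.inr (Or.inr ?_))
    rw [arc_eq_of_gap h1 (le_max_right n j), fatouPt_sym]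
    have := (gap_value_mem (hlt j) ht).1
    exact ⟨toLex_lt_of_fst this.1, toLex_lt_of_fst this.2, hs.2 _⟩
  | gapR j t h1 ht =>
    refine inArc_mono hν (le_max_left n j) (Or.inr (Or.inr ?_))
    rw [arc_eq_of_gap h1 (le_max_right n j), fatouPt_sym]
    have := (gap_value_mem (hlt j) ht).2
    exact ⟨toLex_lt_of_fst this.1, toLex_lt_of_fst this.2, hs.2 _⟩

/-- The points that belong to all pairs of a nested sequence are determined by their position, and
conversely. -/
theorem Terminal.eq_iff {I : ℕ → Arc A} (hI : ∀ n, (I n).x < (I n).y)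
    (hlr : ∀ n, (I n).l ≠ (I n).r)
    (hgap : ∀ n m, n ≤ m → IsGap (I n) → I m = I n)
    (h : Terminal I s z k) (h' : Terminal I s z' k') : z = z' ↔ k = k' := by
  have hcast : ∀ {a b c d : ℝ}, (toLex (a, b) : ℝ ×ₗ ℝ) = toLex (c, d) ↔ a = c ∧ b = d := by
    intro a b c d
    rw [toLex.injective.eq_iff, Prod.mk.injEq]
  have hgapeq : ∀ n m, IsGap (I n) → IsGap (I m) → I n = I m := fun n m h1 h2 => by
    rcases le_total n m with h | h
    · exact (hgap n m h h1).symm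
    · exact hgap m n h h2
  -- The kinds of terminal points exclude one another, according to which endpoint is eventually
  -- constant. Only the two halves of a gap overlap, in the central itinerary `t = 0`.
  have hLimLeft : ∀ n, (∀ n, ∃ m ≥ n, (I m).y < (I n).y) →
      ¬ (∀ m ≥ n, (I m).y = (I n).y ∧ (I m).r = (I n).r ∧ (I m).x < (I (m + 1)).x) :=
    fun n h1 h2 => by
      obtain ⟨m, hm, hlt⟩ := h1 n
      exact hlt.ne (h2 m hm).1
  have hLimRight : ∀ n, (∀ n, ∃ m ≥ n, (I n).x < (I m).x) →
      ¬ (∀ m ≥ n, (I m).x = (I n).x ∧ (I m).l = (I n).l ∧ (I (m + 1)).y < (I m).y) :=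
    fun n h1 h2 => by
      obtain ⟨m, hm, hlt⟩ := h1 n
      exact hlt.ne' (h2 m hm).1
  have hLeftRight : ∀ n n',
      (∀ m ≥ n, (I m).y = (I n).y ∧ (I m).r = (I n).r ∧ (I m).x < (I (m + 1)).x) →
      ¬ (∀ m ≥ n', (I m).x = (I n').x ∧ (I m).l = (I n').l ∧ (I (m + 1)).y < (I m).y) :=
    fun n n' h1 h2 => by
      have h3 := (h2 (max n n') (le_max_right _ _)).2.2
      rw [(h1 (max n n' + 1) (by omega)).1, (h1 (max n n') (by omega)).1] at h3
      exact lt_irrefl _ h3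
  cases h with
  | limit v h1 h2 h3 h4 =>
    cases h' with
    | limit v' h1' h2' h3' h4' => simp [tendsto_nhds_unique h4 h4']
    | left n' t' h1' h2' ht' => exact absurd h2' (hLimLeft n' h3)
    | right n' t' h1' h2' ht' => exact absurd h2' (hLimRight n' h2)
    | gapL n' t' h1' ht' => exact absurd h1' (h1 _)
    | gapR n' t' h1' ht' => exact absurd h1' (h1 _)
  | left n t h1 h2 ht =>
    cases h' with
    | limit v' h1' h2' h3' h4' => exact absurd h2 (hLimLeft n h3')
    | left n' t' h1' h2' ht' =>
      have e1 : (I n).r = (I n').r := by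
        rw [← (h2 (max n n') (by omega)).2.1, (h2' (max n n') (by omega)).2.1]
      have e2 : (I n).y = (I n').y := by
        rw [← (h2 (max n n') (by omega)).1, (h2' (max n n') (by omega)).1]
      rw [fatouPt_eq_iff ht ht', hcast, e1, e2]
      simp
    | right n' t' h1' h2' ht' => exact absurd h2' (hLeftRight n n' h2)
    | gapL n' t' h1' ht' => exact absurd h1' (h1 _)
    | gapR n' t' h1' ht' => exact absurd h1' (h1 _)
  | right n t h1 h2 ht =>
    cases h' with
    | limit v' h1' h2' h3' h4' => exact absurd h2 (hLimRight n h2')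
    | left n' t' h1' h2' ht' => exact absurd h2 (hLeftRight n' n h2')
    | right n' t' h1' h2' ht' =>
      have e1 : (I n).l = (I n').l := by
        rw [← (h2 (max n n') (by omega)).2.1, (h2' (max n n') (by omega)).2.1]
      have e2 : (I n).x = (I n').x := by
        rw [← (h2 (max n n') (by omega)).1, (h2' (max n n') (by omega)).1]
      rw [fatouPt_eq_iff ht ht', hcast, e1, e2]
      simp
    | gapL n' t' h1' ht' => exact absurd h1' (h1 _)
    | gapR n' t' h1' ht' => exact absurd h1' (h1 _)
  | gapL n t h1 ht =>
    cases h' with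
    | limit v' h1' h2' h3' h4' => exact absurd h1 (h1' _)
    | left n' t' h1' h2' ht' => exact absurd h1 (h1' _)
    | right n' t' h1' h2' ht' => exact absurd h1 (h1' _)
    | gapL n' t' h1' ht' =>
      have := hI n'
      rw [fatouPt_eq_iff ht ht', hcast, hgapeq n n' h1 h1']
      have h5 : (I n').y - (I n').x ≠ 0 := by linarith
      simp [h5]
    | gapR n' t' h1' ht' =>
      have := hI n'
      rw [fatouPt_eq_iff ht ht', hcast, hgapeq n n' h1 h1']
      have h5 : 0 < ((I n').y - (I n').x) / 2 := by linarith
      have h6 := hlr n'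
      obtain ⟨h7, -⟩ := ht
      obtain ⟨h8, -⟩ := ht'
      constructor
      · rintro ⟨rfl, h | h⟩
        · simp [h]
        · exact absurd h h6
      · rintro ⟨h, -⟩
        have h9 := mul_nonneg h7 h5.le
        have h10 := mul_nonneg h8 h5.le
        have h11 : t = 0 := (mul_eq_zero.1 (show t * (((I n').y - (I n').x) / 2) = 0 by
          linarith)).resolve_right h5.ne'
        have h12 : t' = 0 := (mul_eq_zero.1 (show t' * (((I n').y - (I n').x) / 2) = 0 by
          linarith)).resolve_right h5.ne'
        exact ⟨h11.trans h12.symm, Or.inl h11⟩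
  | gapR n t h1 ht =>
    cases h' with
    | limit v' h1' h2' h3' h4' => exact absurd h1 (h1' _)
    | left n' t' h1' h2' ht' => exact absurd h1 (h1' _)
    | right n' t' h1' h2' ht' => exact absurd h1 (h1' _)
    | gapL n' t' h1' ht' =>
      have := hI n'
      rw [fatouPt_eq_iff ht ht', hcast, hgapeq n n' h1 h1']
      have h5 : 0 < ((I n').y - (I n').x) / 2 := by linarith
      have h6 := hlr n'
      obtain ⟨h7, -⟩ := ht
      obtain ⟨h8, -⟩ := ht'
      constructor
      · rintro ⟨rfl, h | h⟩
        · simp [h]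
        · exact absurd h.symm h6
      · rintro ⟨h, -⟩
        have h9 := mul_nonneg h7 h5.le
        have h10 := mul_nonneg h8 h5.le
        have h11 : t = 0 := (mul_eq_zero.1 (show t * (((I n').y - (I n').x) / 2) = 0 by
          linarith)).resolve_right h5.ne'
        have h12 : t' = 0 := (mul_eq_zero.1 (show t' * (((I n').y - (I n').x) / 2) = 0 by
          linarith)).resolve_right h5.ne'
        exact ⟨h11.trans h12.symm, Or.inl h11⟩
    | gapR n' t' h1' ht' =>
      have := hI n'
      rw [fatouPt_eq_iff ht ht', hcast, hgapeq n n' h1 h1']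
      have h5 : (I n').y - (I n').x ≠ 0 := by linarith
      simp [h5]

end positions

/-! ### Codes of points by left and right choices, and the bijection between points and positions.
-/

section codes

variable [One A] {ν τ w s s' : Itin A} {p m n : ℕ} {I : Arc A} {c : Bool} {b b' : ℕ → Bool}
  {z z' : Pt A} {k k' : ℝ ×ₗ ℝ}

theorem GoodArc.ne (h : GoodArc ν p I) : I.l ≠ I.r := fun he => by
  obtain ⟨i, hi⟩ := h.star_l
  exact h.no_common i ⟨hi, he ▸ hi⟩

theorem GoodArc.key_lt (h : GoodArc ν p I) : (toLex (I.x, 0) : ℝ ×ₗ ℝ) < toLex (I.y, 0) :=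
  toLex_lt_of_fst h.lt

theorem InArc.le (hI : GoodArc ν p I) (h : InArc z k I) :
    toLex (I.x, 0) ≤ k ∧ k ≤ toLex (I.y, 0) := by
  rcases h with ⟨rfl, -⟩ | ⟨rfl, -⟩ | ⟨h, h', -⟩
  · exact ⟨le_rfl, hI.key_lt.le⟩
  · exact ⟨hI.key_lt.le, le_rfl⟩
  · exact ⟨h.le, h'.le⟩

theorem Terminal.strict (hν : IsStarPeriodic ν p) (hs : Lies ν b s)
    (h : Terminal (arc ν b) s z k) (n : ℕ) :
    toLex ((arc ν b n).x, 0) < k ∧ k < toLex ((arc ν b n).y, 0) ∧ z.sym = s := by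
  have hsym : z.sym = s := by cases h <;> first | rfl | exact fatouPt_sym _ _ _
  have hne : ∀ c : Itin A, z = .itin c → ∀ i, c i ≠ none := by
    intro c hc i
    rw [hc] at hsym
    rw [show c = s from hsym]
    exact hs.1 i
  have hI := goodArc hν b n
  rcases h.inArc hν hs n with ⟨-, h1⟩ | ⟨-, h1⟩ | ⟨h1, h2, -⟩
  · obtain ⟨i, hi⟩ := hI.star_l
    exact absurd hi (hne _ h1 i)
  · obtain ⟨i, hi⟩ := hI.star_r
    exact absurd hi (hne _ h1 i)
  · exact ⟨h1, h2, hsym⟩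

theorem Terminal.onPath (hν : IsStarPeriodic ν p) (hs : Lies ν b s)
    (h : Terminal (arc ν b) s z k) : OnPath ν z k := by
  cases h with
  | limit v h1 h2 h3 h4 =>
    refine .limit b s v ((isLimit_iff hν).2 ⟨hs, h1⟩) ?_ ?_ h4
    · intro n
      by_contra! hc
      obtain ⟨m, hm, hlt⟩ := h2 n
      have := arc_left_const (ν := ν) (fun i hi => by simpa using hc i hi) hm
      exact hlt.ne' this.1
    · intro n
      by_contra! hc
      obtain ⟨m, hm, hlt⟩ := h3 n
      have := arc_right_const (ν := ν) (fun i hi => by simpa using hc i hi) hm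
      exact hlt.ne this.1
  | left n t h1 h2 ht =>
    have hb : ∀ i ≥ n, b i = true := by
      intro i hi
      by_contra hb
      have h3 := arc_lt_of_false hν (h1 i) (by simpa using hb)
      rw [(h2 i hi).1, (h2 (i + 1) (by omega)).1] at h3
      exact lt_irrefl _ h3
    have hl := (isLimit_iff hν).2 ⟨hs, h1⟩
    rcases eq_or_lt_of_le ht.1 with rfl | h0
    · simpa [fatouPt_zero] using OnPath.limitL b s n hl hb
    · exact fatouPt_coe s _ ⟨t, h0, ht.2⟩ ▸ OnPath.fatouL b s n ⟨t, h0, ht.2⟩ hl hb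
  | right n t h1 h2 ht =>
    have hb : ∀ i ≥ n, b i = false := by
      intro i hi
      by_contra hb
      have h3 := arc_lt_of_true hν (h1 i) (by simpa using hb)
      rw [(h2 i hi).1, (h2 (i + 1) (by omega)).1] at h3
      exact lt_irrefl _ h3
    have hl := (isLimit_iff hν).2 ⟨hs, h1⟩
    rcases eq_or_lt_of_le ht.1 with rfl | h0
    · simpa [fatouPt_zero] using OnPath.limitR b s n hl hb
    · exact fatouPt_coe s _ ⟨t, h0, ht.2⟩ ▸ OnPath.fatouR b s n ⟨t, h0, ht.2⟩ hl hb
  | gapL n t h1 ht =>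
    have hc := isCentralIn_iff.2 ⟨h1, hs⟩
    rcases eq_or_lt_of_le ht.1 with rfl | h0
    · simpa [fatouPt_zero] using OnPath.central b s n hc
    · exact fatouPt_coe s _ ⟨t, h0, ht.2⟩ ▸ OnPath.gapL b s n ⟨t, h0, ht.2⟩ hc
  | gapR n t h1 ht =>
    have hc := isCentralIn_iff.2 ⟨h1, hs⟩
    rcases eq_or_lt_of_le ht.1 with rfl | h0
    · simpa [fatouPt_zero] using OnPath.central b s n hc
    · exact fatouPt_coe s _ ⟨t, h0, ht.2⟩ ▸ OnPath.gapR b s n ⟨t, h0, ht.2⟩ hc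

theorem exists_code_left (ν : Itin A) (b : ℕ → Bool) (n : ℕ) :
    ∃ b' : ℕ → Bool, (∀ i ≥ n, b' i = false) ∧ arc ν b' n = arc ν b n :=
  ⟨fun i => if i < n then b i else false, fun i hi => if_neg (by omega),
    arc_congr fun i hi => if_pos hi⟩

theorem exists_code_right (ν : Itin A) (b : ℕ → Bool) (n : ℕ) :
    ∃ b' : ℕ → Bool, (∀ i ≥ n, b' i = true) ∧ arc ν b' n = arc ν b n :=
  ⟨fun i => if i < n then b i else true, fun i hi => if_neg (by omega),
    arc_congr fun i hi => if_pos hi⟩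

theorem exists_code_fixed (ν : Itin A) (b : ℕ → Bool) (n : ℕ) (c : Bool) :
    ∃ b' : ℕ → Bool, arc ν b' n = arc ν b n ∧ b' n = c :=
  ⟨fun i => if i < n then b i else c, arc_congr fun _ hi => if_pos hi, if_neg (lt_irrefl n)⟩

/-- Every point of the critical path is described by a nested sequence of pairs. -/
theorem OnPath.exists_code (hν : IsStarPeriodic ν p) (h : OnPath ν z k) :
    ∃ b s, Lies ν b s ∧ (∀ n, InArc z k (arc ν b n)) ∧ (Terminal (arc ν b) s z k ∨
      ∃ n, (∀ m ≥ n, k = toLex ((arc ν b m).x, 0) ∧ z = .itin (arc ν b m).l) ∨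
        ∀ m ≥ n, k = toLex ((arc ν b m).y, 0) ∧ z = .itin (arc ν b m).r) := by
  have key : ∀ {b s}, Lies ν b s → Terminal (arc ν b) s z k →
      ∃ b s, Lies ν b s ∧ (∀ n, InArc z k (arc ν b n)) ∧ (Terminal (arc ν b) s z k ∨
      ∃ n, (∀ m ≥ n, k = toLex ((arc ν b m).x, 0) ∧ z = .itin (arc ν b m).l) ∨
        ∀ m ≥ n, k = toLex ((arc ν b m).y, 0) ∧ z = .itin (arc ν b m).r) :=
    fun h1 h2 => ⟨_, _, h1, h2.inArc hν h1, Or.inl h2⟩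
  have hL : ∀ {b s n}, IsLimit ν b s → (∀ i ≥ n, b i = true) → Lies ν b s ∧
      (∀ n, ¬ IsGap (arc ν b n)) ∧ ∀ m ≥ n, (arc ν b m).y = (arc ν b n).y ∧
        (arc ν b m).r = (arc ν b n).r ∧ (arc ν b m).x < (arc ν b (m + 1)).x := by
    intro b s n h1 h2
    obtain ⟨h3, h4⟩ := (isLimit_iff hν).1 h1
    exact ⟨h3, h4, fun m hm => ⟨(arc_right_const h2 hm).1, (arc_right_const h2 hm).2,
      arc_lt_of_true hν (h4 m) (h2 m hm)⟩⟩
  have hR : ∀ {b s n}, IsLimit ν b s → (∀ i ≥ n, b i = false) → Lies ν b s ∧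
      (∀ n, ¬ IsGap (arc ν b n)) ∧ ∀ m ≥ n, (arc ν b m).x = (arc ν b n).x ∧
        (arc ν b m).l = (arc ν b n).l ∧ (arc ν b (m + 1)).y < (arc ν b m).y := by
    intro b s n h1 h2
    obtain ⟨h3, h4⟩ := (isLimit_iff hν).1 h1
    exact ⟨h3, h4, fun m hm => ⟨(arc_left_const h2 hm).1, (arc_left_const h2 hm).2,
      arc_lt_of_false hν (h4 m) (h2 m hm)⟩⟩
  cases h with
  | left b n =>
    obtain ⟨b', h1, h2⟩ := exists_code_left ν b n
    obtain ⟨s, hs⟩ := exists_lies hν b'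
    have h3 : ∀ m ≥ n, toLex ((arc ν b n).x, (0 : ℝ)) = toLex ((arc ν b' m).x, 0) ∧
        Pt.itin (arc ν b n).l = .itin (arc ν b' m).l := fun m hm => by
      rw [(arc_left_const h1 hm).1, (arc_left_const h1 hm).2, h2]; exact ⟨rfl, rfl⟩
    exact ⟨b', s, hs, fun m => inArc_mono hν (le_max_left m n)
      (Or.inl (h3 _ (le_max_right m n))), Or.inr ⟨n, Or.inl h3⟩⟩
  | right b n =>
    obtain ⟨b', h1, h2⟩ := exists_code_right ν b n
    obtain ⟨s, hs⟩ := exists_lies hν b'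
    have h3 : ∀ m ≥ n, toLex ((arc ν b n).y, (0 : ℝ)) = toLex ((arc ν b' m).y, 0) ∧
        Pt.itin (arc ν b n).r = .itin (arc ν b' m).r := fun m hm => by
      rw [(arc_right_const h1 hm).1, (arc_right_const h1 hm).2, h2]; exact ⟨rfl, rfl⟩
    exact ⟨b', s, hs, fun m => inArc_mono hν (le_max_left m n)
      (Or.inr (Or.inl (h3 _ (le_max_right m n)))), Or.inr ⟨n, Or.inr h3⟩⟩
  | limit b s v h1 h2 h3 h4 =>
    obtain ⟨h5, h6⟩ := (isLimit_iff hν).1 h1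
    refine key h5 (.limit v h6 (fun n => ?_) (fun n => ?_) h4)
    · obtain ⟨i, hi, hb⟩ := h2 n
      exact ⟨i + 1, by omega, (arc_nested hν hi).1.trans_lt (arc_lt_of_true hν (h6 i) hb)⟩
    · obtain ⟨i, hi, hb⟩ := h3 n
      exact ⟨i + 1, by omega, (arc_lt_of_false hν (h6 i) hb).trans_le (arc_nested hν hi).2⟩
  | limitL b s n h1 h2 =>
    obtain ⟨h3, h4, h5⟩ := hL h1 h2
    have := Terminal.left (s := s) n 0 h4 h5 (by simp)
    rw [fatouPt_zero, add_zero] at this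
    exact key h3 this
  | fatouL b s n t h1 h2 =>
    obtain ⟨h3, h4, h5⟩ := hL h1 h2
    have := Terminal.left (s := s) n t h4 h5 ⟨t.2.1.le, t.2.2⟩
    rw [fatouPt_coe] at this
    exact key h3 this
  | limitR b s n h1 h2 =>
    obtain ⟨h3, h4, h5⟩ := hR h1 h2
    have := Terminal.right (s := s) n 0 h4 h5 (by simp)
    rw [fatouPt_zero, sub_zero] at this
    exact key h3 this
  | fatouR b s n t h1 h2 =>
    obtain ⟨h3, h4, h5⟩ := hR h1 h2
    have := Terminal.right (s := s) n t h4 h5 ⟨t.2.1.le, t.2.2⟩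
    rw [fatouPt_coe] at this
    exact key h3 this
  | central b s n h1 =>
    obtain ⟨h2, h3⟩ := isCentralIn_iff.1 h1
    have := Terminal.gapL (s := s) (I := arc ν b) n 0 h2 (by simp)
    rw [fatouPt_zero, zero_mul, sub_zero] at this
    exact key h3 this
  | gapL b s n t h1 =>
    obtain ⟨h2, h3⟩ := isCentralIn_iff.1 h1
    have := Terminal.gapL (s := s) (I := arc ν b) n t h2 ⟨t.2.1.le, t.2.2⟩
    rw [fatouPt_coe] at this
    exact key h3 this
  | gapR b s n t h1 =>
    obtain ⟨h2, h3⟩ := isCentralIn_iff.1 h1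
    have := Terminal.gapR (s := s) (I := arc ν b) n t h2 ⟨t.2.1.le, t.2.2⟩
    rw [fatouPt_coe] at this
    exact key h3 this

/-- Two nested sequences of pairs agree, or there is a first pair in which they choose different
halves. -/
theorem code_cases (ν : Itin A) (b b' : ℕ → Bool) : arc ν b = arc ν b' ∨
    ∃ n, arc ν b n = arc ν b' n ∧ ¬ IsGap (arc ν b n) ∧ b n ≠ b' n := by
  by_contra! hc
  refine hc.1 (funext fun n => ?_)
  induction n with
  | zero => rfl
  | succ n ih =>
    by_cases hg : IsGap (arc ν b n)
    · rw [arc_eq_of_gap hg (Nat.le_succ n), arc_eq_of_gap (ih ▸ hg) (Nat.le_succ n), ih]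
    · rw [arc, arc, ih, hc.2 n ih hg]

/-- Both the position and the entry at the first difference tell on which side of the inserted point
a point lies; so the two halves share only that point. -/
theorem InArc.left_half (hI : GoodArc ν p I) {j : ℕ} (hj : FirstDiff I.l I.r j)
    (h : InArc z k (refine ν I false)) :
    (k = toLex ((I.x + I.y) / 2, 0) ∧ z = .itin (mid ν I.l I.r)) ∨
      (k < toLex ((I.x + I.y) / 2, 0) ∧ z.sym j = I.l j) := by
  rw [refine_false hj.not_gap] at h
  rcases h with ⟨rfl, rfl⟩ | ⟨h1, h2⟩ | ⟨-, h1, h2⟩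
  · exact Or.inr ⟨toLex_lt_of_fst hI.mid_lt.1, rfl⟩
  · exact Or.inl ⟨h1, h2⟩
  · exact Or.inr ⟨h1, ((h2 j hj.agree_left).2.1.resolve_left hj.1.1).symm⟩

theorem InArc.right_half (hI : GoodArc ν p I) {j : ℕ} (hj : FirstDiff I.l I.r j)
    (h : InArc z k (refine ν I true)) :
    (k = toLex ((I.x + I.y) / 2, 0) ∧ z = .itin (mid ν I.l I.r)) ∨
      (toLex ((I.x + I.y) / 2, 0) < k ∧ z.sym j = I.r j) := by
  rw [refine_true hj.not_gap] at h
  rcases h with ⟨h1, h2⟩ | ⟨rfl, rfl⟩ | ⟨h1, -, h2⟩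
  · exact Or.inl ⟨h1, h2⟩
  · exact Or.inr ⟨toLex_lt_of_fst hI.mid_lt.2, rfl⟩
  · exact Or.inr ⟨h1, ((h2 j hj.agree_right).2.2.resolve_left hj.1.2.1).symm⟩

theorem InArc.eq_iff_of_halves (hI : GoodArc ν p I) (hg : ¬ IsGap I)
    (h : InArc z k (refine ν I false)) (h' : InArc z' k' (refine ν I true)) :
    z = z' ↔ k = k' := by
  obtain ⟨j, hj⟩ := exists_firstDiff hg
  have hmid : (Pt.itin (mid ν I.l I.r)).sym j = none := hj.mid_add 0
  rcases h.left_half hI hj with ⟨h1, h2⟩ | ⟨h1, h2⟩ <;>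
    rcases h'.right_half hI hj with ⟨h3, h4⟩ | ⟨h3, h4⟩
  · exact ⟨fun _ => h1.trans h3.symm, fun _ => h2.trans h4.symm⟩
  · refine ⟨fun he => ?_, fun he => absurd (h1 ▸ he ▸ h3) (lt_irrefl _)⟩
    rw [← he, h2, hmid] at h4
    exact absurd h4.symm hj.1.2.1
  · refine ⟨fun he => ?_, fun he => absurd (h3 ▸ he ▸ h1) (lt_irrefl _)⟩
    rw [he, h4, hmid] at h2
    exact absurd h2.symm hj.1.1
  · refine ⟨fun he => ?_, fun he => absurd (he ▸ h1.trans h3) (lt_irrefl _)⟩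
    rw [he, h4] at h2
    exact absurd h2.symm hj.1.2.2

/-- Points of the critical path are determined by their positions, and conversely. -/
theorem OnPath.eq_iff (hν : IsStarPeriodic ν p) (h : OnPath ν z k) (h' : OnPath ν z' k') :
    z = z' ↔ k = k' := by
  obtain ⟨b, s, hs, hb, hc⟩ := h.exists_code hν
  obtain ⟨b', s', hs', hb', hc'⟩ := h'.exists_code hν
  rcases code_cases ν b b' with he | ⟨n, h1, h2, h3⟩
  · have hI := fun n => goodArc hν b n
    obtain rfl : s = s' := hs.unique hν ⟨hs'.1, by rw [he]; exact hs'.2⟩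
    rw [← he] at hb' hc'
    have hend : ∀ {w : Pt A} {κ : ℝ ×ₗ ℝ}, (∃ n,
        (∀ m ≥ n, κ = toLex ((arc ν b m).x, 0) ∧ w = .itin (arc ν b m).l) ∨
        ∀ m ≥ n, κ = toLex ((arc ν b m).y, 0) ∧ w = .itin (arc ν b m).r) →
        (∃ i, w.sym i = none) ∧ ∃ n, toLex ((arc ν b n).x, 0) = κ ∨ κ = toLex ((arc ν b n).y, 0) := by
      rintro w κ ⟨n, h | h⟩
      · obtain ⟨h1, h2⟩ := h n le_rfl
        exact ⟨h2 ▸ (hI n).star_l, n, Or.inl h1.symm⟩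
      · obtain ⟨h1, h2⟩ := h n le_rfl
        exact ⟨h2 ▸ (hI n).star_r, n, Or.inr h1⟩
    rcases hc with hc | hc <;> rcases hc' with hc' | hc'
    · exact hc.eq_iff (fun n => (hI n).lt) (fun n => (hI n).ne)
        (fun n m hnm hg => arc_eq_of_gap hg hnm) hc'
    · obtain ⟨⟨i, hi⟩, m, hm⟩ := hend hc'
      obtain ⟨h1, h2, h3⟩ := hc.strict hν hs m
      constructor
      · rintro rfl
        exact absurd (h3 ▸ hi) (hs.1 i)
      · rintro rfl
        exact absurd (hm.elim (fun hm => hm ▸ h1) (fun hm => hm ▸ h2)) (lt_irrefl _)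
    · obtain ⟨⟨i, hi⟩, m, hm⟩ := hend hc
      obtain ⟨h1, h2, h3⟩ := hc'.strict hν hs m
      constructor
      · rintro rfl
        exact absurd (h3 ▸ hi) (hs.1 i)
      · rintro rfl
        exact absurd (hm.elim (fun hm => hm ▸ h1) (fun hm => hm ▸ h2)) (lt_irrefl _)
    · have hne : ∀ n, Pt.itin (arc ν b n).l ≠ Pt.itin (arc ν b n).r := fun n h => by
        injection h with h; exact (hI n).ne h
      obtain ⟨n, hc⟩ := hc
      obtain ⟨n', hc'⟩ := hc'
      rcases hc with hc | hc <;> rcases hc' with hc' | hc' <;>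
        obtain ⟨rfl, rfl⟩ := hc (max n n') (le_max_left _ _) <;>
        obtain ⟨rfl, rfl⟩ := hc' (max n n') (le_max_right _ _)
      · simp
      · simp [hne, (hI (max n n')).key_lt.ne]
      · simp [(hne _).symm, (hI (max n n')).key_lt.ne']
      · simp
  · have h4 := hb (n + 1)
    have h5 := hb' (n + 1)
    rw [arc] at h4 h5
    rw [← h1] at h5
    have hI := goodArc hν b n
    cases h6 : b n <;> cases h7 : b' n <;> rw [h6] at h4 <;> rw [h7] at h5
    · simp_all
    · exact h4.eq_iff_of_halves hI h2 h5
    · rw [eq_comm, h5.eq_iff_of_halves hI h2 h4, eq_comm]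
    · simp_all

/-- A point of the critical path in the interior of all pairs of a nested sequence. -/
theorem OnPath.terminal (hν : IsStarPeriodic ν p) (hs : Lies ν b s) (h : OnPath ν z k)
    (hb : ∀ n, toLex ((arc ν b n).x, 0) < k ∧ k < toLex ((arc ν b n).y, 0)) :
    Terminal (arc ν b) s z k := by
  obtain ⟨b', s', hs', hb', hc⟩ := h.exists_code hν
  rcases code_cases ν b b' with he | ⟨n, h1, h2, h3⟩
  · obtain rfl : s = s' := hs.unique hν ⟨hs'.1, by rw [he]; exact hs'.2⟩
    rw [← he] at hc
    rcases hc with hc | ⟨n, hc | hc⟩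
    · exact hc
    · exact absurd ((hc n le_rfl).1 ▸ (hb n).1) (lt_irrefl _)
    · exact absurd ((hc n le_rfl).1 ▸ (hb n).2) (lt_irrefl _)
  · obtain ⟨j, hj⟩ := exists_firstDiff h2
    have h4 := hb (n + 1)
    have h5 := hb' (n + 1)
    have hI := goodArc hν b n
    rw [arc, ← h1] at h5
    rw [arc] at h4
    cases h6 : b n <;> cases h7 : b' n <;> rw [h6] at h4 <;> rw [h7] at h5
    · simp_all
    · rw [refine_false h2] at h4
      rcases h5.right_half hI hj with ⟨h8, -⟩ | ⟨h8, -⟩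
      · exact absurd (h8 ▸ h4.2) (lt_irrefl _)
      · exact absurd (h8.trans h4.2) (lt_irrefl _)
    · rw [refine_true h2] at h4
      rcases h5.left_half hI hj with ⟨h8, -⟩ | ⟨h8, -⟩
      · exact absurd (h8 ▸ h4.1) (lt_irrefl _)
      · exact absurd (h8.trans h4.1) (lt_irrefl _)
    · simp_all

/-- A position strictly inside a pair forces the first `n` choices of any code of the point. -/
theorem OnPath.fits (hν : IsStarPeriodic ν p) (h : OnPath ν z k)
    (hb : toLex ((arc ν b n).x, 0) < k ∧ k < toLex ((arc ν b n).y, 0)) :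
    Fits z.sym (arc ν b n) := by
  obtain ⟨b', s', hs', hb', hc⟩ := h.exists_code hν
  have key : arc ν b n = arc ν b' n := by
    clear hc
    induction n with
    | zero => rfl
    | succ n ih =>
      have h0 := arc_nested (b := b) hν (Nat.le_succ n)
      have h1 := ih ⟨hb.1.trans_le' (Prod.Lex.toLex_mono (Prod.mk_le_mk.2 ⟨h0.1, le_rfl⟩)),
        hb.2.trans_le (Prod.Lex.toLex_mono (Prod.mk_le_mk.2 ⟨h0.2, le_rfl⟩))⟩
      by_cases h2 : IsGap (arc ν b n)
      · rw [arc_eq_of_gap h2 (Nat.le_succ n), arc_eq_of_gap (h1 ▸ h2) (Nat.le_succ n), h1]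
      obtain ⟨j, hj⟩ := exists_firstDiff h2
      have h5 := hb' (n + 1)
      have hI := goodArc hν b n
      rw [arc, ← h1] at h5
      rw [arc, arc, ← h1]
      rw [arc] at hb
      cases h6 : b n <;> cases h7 : b' n <;> rw [h6] at hb <;> rw [h7] at h5
      · rw [refine_false h2] at hb
        rcases h5.right_half hI hj with ⟨h8, -⟩ | ⟨h8, -⟩
        · exact absurd (h8 ▸ hb.2) (lt_irrefl _)
        · exact absurd (h8.trans hb.2) (lt_irrefl _)
      · rw [refine_true h2] at hb
        rcases h5.left_half hI hj with ⟨h8, -⟩ | ⟨h8, -⟩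
        · exact absurd (h8 ▸ hb.1) (lt_irrefl _)
        · exact absurd (h8.trans hb.1) (lt_irrefl _)
  rcases hb' n with h1 | h1 | h1
  · rw [← key] at h1
    exact absurd (h1.1 ▸ hb.1) (lt_irrefl _)
  · rw [← key] at h1
    exact absurd (h1.1 ▸ hb.2) (lt_irrefl _)
  · rw [key]
    exact h1.2.2

end codes

/-! ### The order of the critical path -/

section order

variable [One A] {ν τ w s s' : Itin A} {p m n : ℕ} {I : Arc A} {c : Bool} {b b' : ℕ → Bool}
  {z z' : Pt A} {k k' : ℝ ×ₗ ℝ}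

theorem arc_bounds (hν : IsStarPeriodic ν p) (b : ℕ → Bool) (n : ℕ) :
    0 ≤ (arc ν b n).x ∧ (arc ν b n).x < (arc ν b n).y ∧ (arc ν b n).y ≤ 1 :=
  ⟨(arc_nested hν (Nat.zero_le n)).1, (goodArc hν b n).lt, (arc_nested hν (Nat.zero_le n)).2⟩

theorem OnPath.fst_mem (hν : IsStarPeriodic ν p) (h : OnPath ν z k) :
    0 ≤ (ofLex k).1 ∧ (ofLex k).1 ≤ 1 := by
  obtain ⟨b, s, -, h1, -⟩ := h.exists_code hν
  obtain ⟨h2, h3⟩ := (h1 0).le (goodArc hν b 0)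
  rw [Prod.Lex.le_iff] at h2 h3
  simp only [arc, ofLex_toLex] at h2 h3
  constructor
  · rcases h2 with h | h
    · exact h.le
    · exact h.1.le
  · rcases h3 with h | h
    · exact h.le
    · exact h.1.le

theorem OnPath.snd_mem (h : OnPath ν z k) : -1 ≤ (ofLex k).2 ∧ (ofLex k).2 ≤ 1 := by
  cases h with
  | fatouL b s n t =>
    have := t.2
    simp only [Set.mem_Ioo] at this
    simp only [ofLex_toLex]
    constructor <;> linarith
  | fatouR b s n t =>
    have := t.2
    simp only [Set.mem_Ioo] at this
    simp only [ofLex_toLex]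
    constructor <;> linarith
  | _ => simp

/-- A positive second component occurs only right of a precritical point that is approached from the
right; then the entire range `(0, 1]` over this value is occupied. -/
theorem OnPath.fill_right (h : OnPath ν z k) (hk : 0 < (ofLex k).2) {a : ℝ} (ha : 0 < a)
    (ha' : a ≤ 1) : ∃ z', OnPath ν z' (toLex ((ofLex k).1, a)) := by
  have key : ∀ b s n, IsLimit ν b s → (∀ k ≥ n, b k = false) →
      ∃ z', OnPath ν z' (toLex ((arc ν b n).x, a)) := by
    intro b s n h1 h2
    rcases eq_or_lt_of_le ha' with rfl | ha'
    · exact ⟨_, .limitR b s n h1 h2⟩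
    · have := OnPath.fatouR b s n ⟨1 - a, by linarith, by linarith⟩ h1 h2
      simp only [sub_sub_cancel] at this
      exact ⟨_, this⟩
  cases h with
  | limitR b s n h1 h2 => exact key b s n h1 h2
  | fatouR b s n t h1 h2 => exact key b s n h1 h2
  | fatouL b s n t =>
    have := t.2.2
    simp only [ofLex_toLex] at hk
    linarith
  | limitL b s n => simp only [ofLex_toLex] at hk; linarith
  | _ => simp at hk

theorem OnPath.fill_left (h : OnPath ν z k) (hk : (ofLex k).2 < 0) {a : ℝ} (ha : -1 ≤ a)
    (ha' : a < 0) : ∃ z', OnPath ν z' (toLex ((ofLex k).1, a)) := by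
  have key : ∀ b s n, IsLimit ν b s → (∀ k ≥ n, b k = true) →
      ∃ z', OnPath ν z' (toLex ((arc ν b n).y, a)) := by
    intro b s n h1 h2
    rcases eq_or_lt_of_le ha with rfl | ha
    · exact ⟨_, .limitL b s n h1 h2⟩
    · have := OnPath.fatouL b s n ⟨1 + a, by linarith, by linarith⟩ h1 h2
      simp only [neg_add_cancel_left] at this
      exact ⟨_, this⟩
  cases h with
  | limitL b s n h1 h2 => exact key b s n h1 h2
  | fatouL b s n t h1 h2 => exact key b s n h1 h2
  | fatouR b s n t =>
    have := t.2.2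
    simp only [ofLex_toLex] at hk
    linarith
  | limitR b s n => simp only [ofLex_toLex] at hk; linarith
  | _ => simp at hk

open Classical in
/-- Every value of `φ` is attained. -/
theorem exists_onPath (hν : IsStarPeriodic ν p) {v : ℝ} (h0 : 0 ≤ v) (h1 : v ≤ 1) :
    ∃ z, OnPath ν z (toLex (v, 0)) := by
  -- Bisection towards `v`. If a gap is reached, `v` is the position of a point of one of its two
  -- Fatou intervals; otherwise the pairs have lengths `(1 / 2) ^ n` and their endpoints converge to
  -- `v`.
  let c : Arc A → Bool := fun I => decide ((I.x + I.y) / 2 ≤ v)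
  let path : ℕ → Arc A := fun n => (fun I => refine ν I (c I))^[n] ⟨crit ν, ν, 0, 1⟩
  let b : ℕ → Bool := fun n => c (path n)
  have hpath : ∀ n, arc ν b n = path n := fun n => by
    induction n with
    | zero => rfl
    | succ n ih =>
      rw [arc, ih]
      simp only [path, b, Function.iterate_succ_apply']
  have hb : ∀ n, b n = c (arc ν b n) := fun n => by rw [hpath]
  have hmem : ∀ n, (arc ν b n).x ≤ v ∧ v ≤ (arc ν b n).y := by
    intro n
    induction n with
    | zero => exact ⟨h0, h1⟩
    | succ n ih =>
      by_cases hg : IsGap (arc ν b n)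
      · rwa [arc_eq_of_gap hg (Nat.le_succ n)]
      by_cases hc : ((arc ν b n).x + (arc ν b n).y) / 2 ≤ v
      · rw [arc_succ_true hg (by rw [hb]; exact decide_eq_true hc)]
        exact ⟨hc, ih.2⟩
      · rw [arc_succ_false hg (by rw [hb]; exact decide_eq_false hc)]
        exact ⟨ih.1, (not_le.1 hc).le⟩
  by_cases hx : ∃ n, (arc ν b n).x = v
  · obtain ⟨n, hx⟩ := hx
    exact hx ▸ ⟨_, .left b n⟩
  by_cases hy : ∃ n, (arc ν b n).y = v
  · obtain ⟨n, hy⟩ := hy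
    exact hy ▸ ⟨_, .right b n⟩
  push Not at hx hy
  obtain ⟨s, hs⟩ := exists_lies hν b
  by_cases hg : ∃ n, IsGap (arc ν b n)
  · obtain ⟨n, hg⟩ := hg
    have h2 := lt_of_le_of_ne (hmem n).1 (hx n)
    have h3 := lt_of_le_of_ne (hmem n).2 (hy n).symm
    have h4 : 0 < ((arc ν b n).y - (arc ν b n).x) / 2 := by linarith
    rcases le_total (((arc ν b n).x + (arc ν b n).y) / 2) v with h5 | h5
    · have := Terminal.gapR (I := arc ν b) (s := s) n ((v - ((arc ν b n).x + (arc ν b n).y) / 2) / (((arc ν b n).y - (arc ν b n).x) / 2)) hg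
        ⟨div_nonneg (by linarith) h4.le, (div_lt_one h4).2 (by linarith)⟩
      rw [div_mul_cancel₀ _ h4.ne', add_sub_cancel] at this
      exact ⟨_, this.onPath hν hs⟩
    · have := Terminal.gapL (I := arc ν b) (s := s) n ((((arc ν b n).x + (arc ν b n).y) / 2 - v) / (((arc ν b n).y - (arc ν b n).x) / 2)) hg
        ⟨div_nonneg (by linarith) h4.le, (div_lt_one h4).2 (by linarith)⟩
      rw [div_mul_cancel₀ _ h4.ne', sub_sub_cancel] at this
      exact ⟨_, this.onPath hν hs⟩
  push Not at hg
  have hw : ∀ n, (arc ν b n).y - (arc ν b n).x = (1 / 2) ^ n := by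
    intro n
    induction n with
    | zero => simp [arc]
    | succ n ih =>
      rw [pow_succ, ← ih]
      cases h : b n
      · rw [arc_succ_false (hg n) h]; ring
      · rw [arc_succ_true (hg n) h]; ring
  have hw0 : Tendsto (fun n : ℕ => (1 / 2 : ℝ) ^ n) atTop (𝓝 0) :=
    tendsto_pow_atTop_nhds_zero_of_lt_one (by norm_num) (by norm_num)
  have hlim : Tendsto (fun n => (arc ν b n).x) atTop (𝓝 v) := by
    have h2 : Tendsto (fun n : ℕ => v - (1 / 2 : ℝ) ^ n) atTop (𝓝 v) := by
      simpa using tendsto_const_nhds.sub hw0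
    refine tendsto_of_tendsto_of_tendsto_of_le_of_le h2 tendsto_const_nhds (fun n => ?_)
      (fun n => (hmem n).1)
    have := hw n
    have := (hmem n).2
    beta_reduce
    linarith
  have hlim' : Tendsto (fun n => (arc ν b n).y) atTop (𝓝 v) := by
    have h2 : Tendsto (fun n : ℕ => (arc ν b n).x + (1 / 2 : ℝ) ^ n) atTop (𝓝 v) := by
      simpa using hlim.add hw0
    refine h2.congr fun n => ?_
    have := hw n
    linarith
  refine ⟨_, Terminal.onPath hν hs (.limit v hg (fun n => ?_) (fun n => ?_) hlim)⟩
  · have := hlim.eventually (lt_mem_nhds (lt_of_le_of_ne (hmem n).1 (hx n)))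
    obtain ⟨m, h2, h3⟩ := (this.and (eventually_ge_atTop n)).exists
    exact ⟨m, h3, h2⟩
  · have := hlim'.eventually (gt_mem_nhds (lt_of_le_of_ne (hmem n).2 (hy n).symm))
    obtain ⟨m, h2, h3⟩ := (this.and (eventually_ge_atTop n)).exists
    exact ⟨m, h3, h2⟩

/-- The position of a point of the critical path. -/
noncomputable def pos (z : critPath ν) : ℝ ×ₗ ℝ := z.2.choose

theorem onPath_pos (z : critPath ν) : OnPath ν z (pos z) := z.2.choose_spec

theorem OnPath.pos_eq (hν : IsStarPeriodic ν p) {z : critPath ν} (h : OnPath ν z k) : pos z = k :=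
  ((onPath_pos z).eq_iff hν h).1 rfl

theorem pos_injective (hν : IsStarPeriodic ν p) : Function.Injective (pos (ν := ν)) :=
  fun z w h => Subtype.ext (((onPath_pos z).eq_iff hν (onPath_pos w)).2 h)

theorem prec_iff (hν : IsStarPeriodic ν p) {z w : critPath ν} : Prec ν z w ↔ pos z < pos w := by
  constructor
  · rintro ⟨k, l, h1, h2, h3⟩
    rwa [h1.pos_eq hν, h2.pos_eq hν]
  · exact fun h => ⟨_, _, onPath_pos z, onPath_pos w, h⟩

theorem image_val_eq_setOf_lt (hν : IsStarPeriodic ν p) {U : Set (critPath ν)} {a : critPath ν} :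
    Subtype.val '' U = {z | Prec ν z a} ↔ U = {z | pos z < pos a} := by
  have : {z | Prec ν z a} = Subtype.val '' {z : critPath ν | pos z < pos a} := by
    ext z
    constructor
    · intro h
      have hz : z ∈ critPath ν := by obtain ⟨k, l, h1, -⟩ := h; exact ⟨k, h1⟩
      exact ⟨⟨z, hz⟩, (prec_iff hν (z := ⟨z, hz⟩)).1 h, rfl⟩
    · rintro ⟨z, h, rfl⟩
      exact (prec_iff hν).2 h
  rw [this, Subtype.val_injective.image_injective.eq_iff]

theorem image_val_eq_setOf_gt (hν : IsStarPeriodic ν p) {U : Set (critPath ν)} {a : critPath ν} :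
    Subtype.val '' U = {z | Prec ν a z} ↔ U = {z | pos a < pos z} := by
  have : {z | Prec ν a z} = Subtype.val '' {z : critPath ν | pos a < pos z} := by
    ext z
    constructor
    · intro h
      have hz : z ∈ critPath ν := by obtain ⟨k, l, -, h1, -⟩ := h; exact ⟨l, h1⟩
      exact ⟨⟨z, hz⟩, (prec_iff hν (w := ⟨z, hz⟩)).1 h, rfl⟩
    · rintro ⟨z, h, rfl⟩
      exact (prec_iff hν).2 h
  rw [this, Subtype.val_injective.image_injective.eq_iff]

theorem isOpen_lt_pos (hν : IsStarPeriodic ν p) (a : critPath ν) : IsOpen {z : critPath ν | pos z < pos a} := by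
  refine TopologicalSpace.isOpen_generateFrom_of_mem ⟨a, Or.inl ?_⟩
  exact (image_val_eq_setOf_lt hν).2 rfl

theorem isOpen_pos_lt (hν : IsStarPeriodic ν p) (a : critPath ν) : IsOpen {z : critPath ν | pos a < pos z} := by
  refine TopologicalSpace.isOpen_generateFrom_of_mem ⟨a, Or.inr ?_⟩
  exact (image_val_eq_setOf_gt hν).2 rfl

theorem exists_pos_between (hν : IsStarPeriodic ν p) {z w : critPath ν} (h : pos z < pos w) :
    ∃ u : critPath ν, pos z < pos u ∧ pos u < pos w := by
  suffices ∃ k, (∃ z', OnPath ν z' k) ∧ pos z < k ∧ k < pos w by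
    obtain ⟨k, ⟨z', h1⟩, h2⟩ := this
    refine ⟨⟨z', k, h1⟩, ?_⟩
    rwa [OnPath.pos_eq hν (z := ⟨z', k, h1⟩) h1]
  have hz := onPath_pos z
  have hw := onPath_pos w
  have hz1 := hz.fst_mem hν
  have hw1 := hw.fst_mem hν
  have hz2 := hz.snd_mem
  have hw2 := hw.snd_mem
  have hzr := hz.fill_left
  have hwr := hw.fill_right
  generalize pos z = k at *
  generalize pos w = l at *
  obtain ⟨v, a⟩ := k
  obtain ⟨v', a'⟩ := l
  change toLex (v, a) < toLex (v', a') at h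
  change 0 ≤ v ∧ v ≤ 1 at hz1
  change 0 ≤ v' ∧ v' ≤ 1 at hw1
  change -1 ≤ a ∧ a ≤ 1 at hz2
  change -1 ≤ a' ∧ a' ≤ 1 at hw2
  rcases Prod.Lex.toLex_lt_toLex.1 h with h | ⟨h, h'⟩
  · change v < v' at h
    exact ⟨toLex ((v + v') / 2, 0), exists_onPath hν (by linarith) (by linarith),
      toLex_lt_of_fst (by linarith), toLex_lt_of_fst (by linarith)⟩
  · change v = v' at h
    change a < a' at h'
    subst h
    rcases lt_or_ge a 0 with ha | ha
    · have h1 : a < min a' 0 := lt_min h' ha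
      have h2 := min_le_left a' 0
      have h3 := min_le_right a' 0
      exact ⟨toLex (v, (a + min a' 0) / 2), hzr ha (by linarith) (by linarith),
        toLex_lt_of_snd (by linarith), toLex_lt_of_snd (by linarith)⟩
    · exact ⟨toLex (v, (a + a') / 2), hwr (show 0 < a' by linarith) (by linarith) (by linarith),
        toLex_lt_of_snd (by linarith), toLex_lt_of_snd (by linarith)⟩

/-- The supremum lies over the supremum `v` of the values of `φ`. If `v` is attained, the second
components over `v` are maximized. If not, the least position over `v` is taken: `-1` if there are
points left of the precritical point, and `0` otherwise. -/
theorem exists_lub_pos (hν : IsStarPeriodic ν p) (S : Set (critPath ν)) (hS : S.Nonempty) :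
    ∃ u : critPath ν, (∀ z ∈ S, pos z ≤ pos u) ∧
      ∀ w : critPath ν, (∀ z ∈ S, pos z ≤ pos w) → pos u ≤ pos w := by
  suffices ∃ k, (∃ z', OnPath ν z' k) ∧ (∀ z ∈ S, pos z ≤ k) ∧
      ∀ w : critPath ν, (∀ z ∈ S, pos z ≤ pos w) → k ≤ pos w by
    obtain ⟨k, ⟨z', h1⟩, h2⟩ := this
    refine ⟨⟨z', k, h1⟩, ?_⟩
    rwa [OnPath.pos_eq hν (z := ⟨z', k, h1⟩) h1]
  let X : critPath ν → ℝ := fun z => (ofLex (pos z)).1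
  let Y : critPath ν → ℝ := fun z => (ofLex (pos z)).2
  have hle : ∀ {z w : critPath ν}, pos z ≤ pos w → X z ≤ X w := by
    intro z w h
    rcases (Prod.Lex.le_iff).1 h with h | h
    · exact h.le
    · exact h.1.le
  have hbdd : BddAbove (X '' S) := ⟨1, by
    rintro _ ⟨z, -, rfl⟩; exact ((onPath_pos z).fst_mem hν).2⟩
  have hv : IsLUB (X '' S) (sSup (X '' S)) := isLUB_csSup (hS.image X) hbdd
  generalize sSup (X '' S) = v at hv
  have hv0 : 0 ≤ v := by
    obtain ⟨z, hz⟩ := hS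
    exact ((onPath_pos z).fst_mem hν).1.trans (hv.1 ⟨z, hz, rfl⟩)
  have hv1 : v ≤ 1 := hv.2 (by rintro _ ⟨z, -, rfl⟩; exact ((onPath_pos z).fst_mem hν).2)
  have hvw : ∀ w : critPath ν, (∀ z ∈ S, pos z ≤ pos w) → v ≤ X w := fun w hw =>
    hv.2 (by rintro _ ⟨z, hz, rfl⟩; exact hle (hw z hz))
  by_cases hatt : ∃ z ∈ S, X z = v
  · let T : Set ℝ := Y '' {z | z ∈ S ∧ X z = v}
    have hT : T.Nonempty := by obtain ⟨z, h1, h2⟩ := hatt; exact ⟨_, z, ⟨h1, h2⟩, rfl⟩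
    have hTb : BddAbove T := ⟨1, by rintro _ ⟨z, -, rfl⟩; exact (onPath_pos z).snd_mem.2⟩
    have ha : IsLUB T (sSup T) := isLUB_csSup hT hTb
    generalize sSup T = a at ha
    have ha1 : a ≤ 1 := ha.2 (by rintro _ ⟨z, -, rfl⟩; exact (onPath_pos z).snd_mem.2)
    refine ⟨toLex (v, a), ?_, ?_, ?_⟩
    · rcases lt_trichotomy a 0 with h0 | rfl | h0
      · obtain ⟨_, z, ⟨h1, h2⟩, rfl⟩ := hT
        have h3 : Y z ≤ a := ha.1 ⟨z, ⟨h1, h2⟩, rfl⟩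
        have h4 := (onPath_pos z).fill_left (h3.trans_lt h0)
          ((onPath_pos z).snd_mem.1.trans h3) h0
        rwa [show (ofLex (pos z)).1 = v from h2] at h4
      · exact exists_onPath hν hv0 hv1
      · obtain ⟨_, ⟨z, ⟨h1, h2⟩, rfl⟩, h3⟩ := (lt_isLUB_iff ha).1 h0
        have h4 := (onPath_pos z).fill_right h3 h0 ha1
        rwa [show (ofLex (pos z)).1 = v from h2] at h4
    · intro z hz
      rw [Prod.Lex.le_iff]
      rcases lt_or_eq_of_le (hv.1 ⟨z, hz, rfl⟩) with h | h
      · exact Or.inl h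
      · exact Or.inr ⟨h, ha.1 ⟨z, ⟨hz, h⟩, rfl⟩⟩
    · intro w hw
      rw [Prod.Lex.le_iff]
      rcases lt_or_eq_of_le (hvw w hw) with h | h
      · exact Or.inl h
      · refine Or.inr ⟨h, ha.2 ?_⟩
        rintro _ ⟨z, ⟨h1, h2⟩, rfl⟩
        rcases (Prod.Lex.le_iff).1 (hw z h1) with h3 | h3
        · exact absurd (h2.trans h) h3.ne
        · exact h3.2
  · push Not at hatt
    have hlt : ∀ z ∈ S, X z < v := fun z hz => lt_of_le_of_ne (hv.1 ⟨z, hz, rfl⟩) (hatt z hz)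
    by_cases hneg : ∃ w : critPath ν, X w = v ∧ Y w < 0
    · obtain ⟨w, h1, h2⟩ := hneg
      refine ⟨toLex (v, -1), ?_, fun z hz => Prod.Lex.le_iff.2 (Or.inl (hlt z hz)), ?_⟩
      · have h4 := (onPath_pos w).fill_left h2 le_rfl (by norm_num)
        rwa [show (ofLex (pos w)).1 = v from h1] at h4
      · intro w hw
        rw [Prod.Lex.le_iff]
        rcases lt_or_eq_of_le (hvw w hw) with h | h
        · exact Or.inl h
        · exact Or.inr ⟨h, (onPath_pos w).snd_mem.1⟩
    · push Not at hneg
      refine ⟨toLex (v, 0), exists_onPath hν hv0 hv1,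
        fun z hz => Prod.Lex.le_iff.2 (Or.inl (hlt z hz)), ?_⟩
      intro w hw
      rw [Prod.Lex.le_iff]
      rcases lt_or_eq_of_le (hvw w hw) with h | h
      · exact Or.inl h
      · exact Or.inr ⟨h, hneg w h.symm⟩

theorem pos_crit (hν : IsStarPeriodic ν p) : pos (⟨_, crit_mem ν⟩ : critPath ν) = toLex (0, 0) :=
  OnPath.pos_eq hν (z := ⟨_, crit_mem ν⟩) (.left (fun _ => true) 0)

theorem pos_value (hν : IsStarPeriodic ν p) : pos (⟨_, value_mem ν⟩ : critPath ν) = toLex (1, 0) :=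
  OnPath.pos_eq hν (z := ⟨_, value_mem ν⟩) (.right (fun _ => true) 0)

theorem pos_mem (hν : IsStarPeriodic ν p) (z : critPath ν) :
    toLex (0, 0) ≤ pos z ∧ pos z ≤ toLex (1, 0) := by
  obtain ⟨b, s, -, h, -⟩ := (onPath_pos z).exists_code hν
  exact (h 0).le (goodArc hν b 0)

/-- The linear order of the critical path. -/
@[reducible] noncomputable def critPathOrder (hν : IsStarPeriodic ν p) :
    LinearOrder (critPath ν) :=
  LinearOrder.lift' pos (pos_injective hν)

open Classical in
/-- The order of the critical path is complete. -/
@[reducible] noncomputable def critPathComplete (hν : IsStarPeriodic ν p) :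
    ConditionallyCompleteLinearOrder (critPath ν) :=
  letI o := critPathOrder hν
  letI : SupSet (critPath ν) := ⟨fun S => if h : S.Nonempty then (exists_lub_pos hν S h).choose
    else ⟨_, value_mem ν⟩⟩
  letI L := conditionallyCompleteLatticeOfLatticeOfsSup (critPath ν) (fun S _ hS => by
    have : sSup S = (exists_lub_pos hν S hS).choose := dif_pos hS
    rw [this]
    exact ⟨fun z hz => (exists_lub_pos hν S hS).choose_spec.1 z hz,
      fun w hw => (exists_lub_pos hν S hS).choose_spec.2 w fun z hz => hw hz⟩)
  { L, o with
    csSup_of_not_bddAbove := fun S hS => absurd ⟨⟨_, value_mem ν⟩, fun z _ => by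
      change pos z ≤ pos _
      rw [pos_value hν]; exact (pos_mem hν z).2⟩ hS
    csInf_of_not_bddBelow := fun S hS => absurd ⟨⟨_, crit_mem ν⟩, fun z _ => by
      change pos _ ≤ pos z
      rw [pos_crit hν]; exact (pos_mem hν z).1⟩ hS }

theorem critPath_orderTopology (hν : IsStarPeriodic ν p) :
    let := critPathComplete hν
    OrderTopology (critPath ν) := by
  let := critPathComplete hν
  refine ⟨congrArg _ (Set.ext fun U => exists_congr fun c => ?_)⟩
  exact (or_congr (image_val_eq_setOf_lt hν) (image_val_eq_setOf_gt hν)).trans or_comm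

theorem critPath_denselyOrdered (hν : IsStarPeriodic ν p) :
    let := critPathComplete hν
    DenselyOrdered (critPath ν) := by
  let := critPathComplete hν
  exact ⟨fun _ _ h => exists_pos_between hν h⟩

/-- Order-convex subsets of the critical path are connected. -/
theorem isPreconnected_of_convex (hν : IsStarPeriodic ν p) {S : Set (critPath ν)}
    (hS : ∀ x ∈ S, ∀ y ∈ S, ∀ z, pos x ≤ pos z → pos z ≤ pos y → z ∈ S) : IsPreconnected S := by
  let := critPathComplete hν
  have := critPath_orderTopology hν
  have := critPath_denselyOrdered hν
  exact Set.OrdConnected.isPreconnected ⟨fun x hx y hy z hz => hS x hx y hy z hz.1 hz.2⟩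

/-- The first point of a closed set after a given point. -/
theorem exists_first_after (hν : IsStarPeriodic ν p) {T : Set (critPath ν)} (hT : IsClosed T)
    {x y : critPath ν} (hx : x ∉ T) (hy : y ∈ T) (hxy : pos x < pos y) :
    ∃ u ∈ T, pos x < pos u ∧ ∀ z, pos x ≤ pos z → pos z < pos u → z ∉ T := by
  let := critPathComplete hν
  have := critPath_orderTopology hν
  have hne : (T ∩ Set.Ici x).Nonempty := ⟨y, hy, hxy.le⟩
  have hb : BddBelow (T ∩ Set.Ici x) := ⟨x, fun z hz => hz.2⟩
  have hm := (hT.inter isClosed_Ici).csInf_mem hne hb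
  refine ⟨_, hm.1, lt_of_le_of_ne hm.2 fun h => ?_, fun z h1 h2 h3 => ?_⟩
  · exact hx (pos_injective hν h ▸ hm.1)
  · exact not_lt_of_ge (csInf_le hb ⟨h3, h1⟩) h2

/-- The last point of a closed set before a given point. -/
theorem exists_last_before (hν : IsStarPeriodic ν p) {T : Set (critPath ν)} (hT : IsClosed T)
    {x y : critPath ν} (hx : x ∉ T) (hy : y ∈ T) (hxy : pos y < pos x) :
    ∃ u ∈ T, pos u < pos x ∧ ∀ z, pos u < pos z → pos z ≤ pos x → z ∉ T := by
  let := critPathComplete hν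
  have := critPath_orderTopology hν
  have hne : (T ∩ Set.Iic x).Nonempty := ⟨y, hy, hxy.le⟩
  have hb : BddAbove (T ∩ Set.Iic x) := ⟨x, fun z hz => hz.2⟩
  have hm := (hT.inter isClosed_Iic).csSup_mem hne hb
  refine ⟨_, hm.1, lt_of_le_of_ne hm.2 fun h => ?_, fun z h1 h2 h3 => ?_⟩
  · exact hx (pos_injective hν h ▸ hm.1)
  · exact not_lt_of_ge (le_csSup hb ⟨h3, h2⟩) h1

end order

/-! ### Neighbourhoods in the critical path -/

section nbhd

variable [One A] {ν τ w s s' : Itin A} {p m n : ℕ} {I : Arc A} {c : Itin A} {b b' : ℕ → Bool}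
  {z z' : Pt A} {k k' : ℝ ×ₗ ℝ}

theorem Terminal.eq_iff' (hν : IsStarPeriodic ν p) (h : Terminal (arc ν b) s z k)
    (h' : Terminal (arc ν b) s z' k') : z = z' ↔ k = k' :=
  h.eq_iff (fun n => (goodArc hν b n).lt) (fun n => (goodArc hν b n).ne)
    (fun _ _ hnm hg => arc_eq_of_gap hg hnm) h'

theorem exists_terminal_itin (hν : IsStarPeriodic ν p) (b : ℕ → Bool) (s : Itin A) :
    ∃ k, Terminal (arc ν b) s (.itin s) k := by
  by_cases hg : ∃ n, IsGap (arc ν b n)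
  · obtain ⟨n, hg⟩ := hg
    have := Terminal.gapL (s := s) n 0 hg (by simp)
    rw [fatouPt_zero] at this
    exact ⟨_, this⟩
  push Not at hg
  by_cases h1 : ∃ n, ∀ i ≥ n, b i = true
  · obtain ⟨n, h1⟩ := h1
    have := Terminal.left (s := s) n 0 hg (fun m hm => ⟨(arc_right_const h1 hm).1,
      (arc_right_const h1 hm).2, arc_lt_of_true hν (hg m) (h1 m hm)⟩) (by simp)
    rw [fatouPt_zero] at this
    exact ⟨_, this⟩
  by_cases h2 : ∃ n, ∀ i ≥ n, b i = false
  · obtain ⟨n, h2⟩ := h2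
    have := Terminal.right (s := s) n 0 hg (fun m hm => ⟨(arc_left_const h2 hm).1,
      (arc_left_const h2 hm).2, arc_lt_of_false hν (hg m) (h2 m hm)⟩) (by simp)
    rw [fatouPt_zero] at this
    exact ⟨_, this⟩
  push Not at h1 h2
  have hmono : Monotone fun n => (arc ν b n).x := fun n m h => (arc_nested hν h).1
  have hbdd : BddAbove (Set.range fun n => (arc ν b n).x) := ⟨1, by
    rintro _ ⟨n, rfl⟩
    exact (arc_bounds hν b n).2.1.le.trans (arc_bounds hν b n).2.2⟩
  refine ⟨_, .limit _ hg (fun n => ?_) (fun n => ?_) (tendsto_atTop_ciSup hmono hbdd)⟩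
  · obtain ⟨i, hi, hb⟩ := h2 n
    exact ⟨i + 1, by omega, (arc_nested hν hi).1.trans_lt
      (arc_lt_of_true hν (hg i) (by simpa using hb))⟩
  · obtain ⟨i, hi, hb⟩ := h1 n
    exact ⟨i + 1, by omega, (arc_lt_of_false hν (hg i) (by simpa using hb)).trans_le
      (arc_nested hν hi).2⟩

/-- A terminal point other than the sequence itself lies on a Fatou interval, whose precritical end
is the endpoint of the pairs that is eventually constant. -/
theorem Terminal.rep (hν : IsStarPeriodic ν p) (h : Terminal (arc ν b) s z k)
    (h0 : Terminal (arc ν b) s (.itin s) k') (hz : z ≠ .itin s) :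
    (k' < k ∧ ∃ N, ∀ n ≥ N, z.rep = (arc ν b n).r ∧ (arc ν b n).y = (arc ν b N).y) ∨
      (k < k' ∧ ∃ N, ∀ n ≥ N, z.rep = (arc ν b n).l ∧ (arc ν b n).x = (arc ν b N).x) := by
  have hrep : ∀ {c t}, t ∈ Set.Ico (0 : ℝ) 1 → fatouPt s c t ≠ .itin s →
      0 < t ∧ (fatouPt s c t).rep = c := by
    intro c t ht hne
    rcases eq_or_lt_of_le ht.1 with rfl | h
    · rw [fatouPt_zero] at hne
      exact absurd rfl hne
    · rw [fatouPt_coe s c ⟨t, h, ht.2⟩]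
      exact ⟨h, rfl⟩
  cases h with
  | limit v h1 h2 h3 h4 => exact absurd rfl hz
  | left n t h1 h2 ht =>
    obtain ⟨h3, h4⟩ := hrep ht hz
    have h5 := Terminal.left (s := s) n 0 h1 h2 (by simp)
    rw [(h0.eq_iff' hν h5).1 (fatouPt_zero _ _).symm]
    exact Or.inl ⟨toLex_lt_of_snd (by linarith), n, fun m hm =>
      ⟨h4.trans (h2 m hm).2.1.symm, (h2 m hm).1⟩⟩
  | right n t h1 h2 ht =>
    obtain ⟨h3, h4⟩ := hrep ht hz
    have h5 := Terminal.right (s := s) n 0 h1 h2 (by simp)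
    rw [(h0.eq_iff' hν h5).1 (fatouPt_zero _ _).symm]
    exact Or.inr ⟨toLex_lt_of_snd (by linarith), n, fun m hm =>
      ⟨h4.trans (h2 m hm).2.1.symm, (h2 m hm).1⟩⟩
  | gapL n t h1 ht =>
    obtain ⟨h3, h4⟩ := hrep ht hz
    have h5 := Terminal.gapL (s := s) n 0 h1 (by simp)
    rw [(h0.eq_iff' hν h5).1 (fatouPt_zero _ _).symm]
    refine Or.inr ⟨toLex_lt_of_fst ?_, n, fun m hm => ?_⟩
    · have h6 := (goodArc hν b n).lt
      have := mul_pos h3 (show 0 < ((arc ν b n).y - (arc ν b n).x) / 2 by linarith)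
      linarith
    · rw [arc_eq_of_gap h1 hm]; exact ⟨h4, rfl⟩
  | gapR n t h1 ht =>
    obtain ⟨h3, h4⟩ := hrep ht hz
    have h5 := Terminal.gapR (s := s) n 0 h1 (by simp)
    rw [(h0.eq_iff' hν h5).1 (fatouPt_zero _ _).symm]
    refine Or.inl ⟨toLex_lt_of_fst ?_, n, fun m hm => ?_⟩
    · have h6 := (goodArc hν b n).lt
      have := mul_pos h3 (show 0 < ((arc ν b n).y - (arc ν b n).x) / 2 by linarith)
      linarith
    · rw [arc_eq_of_gap h1 hm]; exact ⟨h4, rfl⟩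

theorem strict_of_between (hν : IsStarPeriodic ν p) (hs : Lies ν b s)
    (h0 : Terminal (arc ν b) s (.itin s) k') {N : ℕ} :
    ((∀ n ≥ N, (arc ν b n).y = (arc ν b N).y) → k' < k → k < toLex ((arc ν b N).y, 0) →
      ∀ n, toLex ((arc ν b n).x, 0) < k ∧ k < toLex ((arc ν b n).y, 0)) ∧
    ((∀ n ≥ N, (arc ν b n).x = (arc ν b N).x) → toLex ((arc ν b N).x, 0) < k → k < k' →
      ∀ n, toLex ((arc ν b n).x, 0) < k ∧ k < toLex ((arc ν b n).y, 0)) := by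
  refine ⟨fun h h1 h2 n => ⟨(h0.strict hν hs n).1.trans h1, ?_⟩,
    fun h h1 h2 n => ⟨?_, h2.trans (h0.strict hν hs n).2.1⟩⟩
  · rcases le_total n N with hn | hn
    · exact h2.trans_le (Prod.Lex.toLex_mono (Prod.mk_le_mk.2 ⟨(arc_nested hν hn).2, le_rfl⟩))
    · rwa [h n hn]
  · rcases le_total n N with hn | hn
    · exact h1.trans_le' (Prod.Lex.toLex_mono (Prod.mk_le_mk.2 ⟨(arc_nested hν hn).1, le_rfl⟩))
    · rwa [h n hn]

/-- The points between a precritical point and the adjacent point without `⋆` have the same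
precritical end. -/
theorem rep_of_between_right (hν : IsStarPeriodic ν p) (hs : Lies ν b s)
    (h0 : Terminal (arc ν b) s (.itin s) k') {N : ℕ}
    (hN : ∀ n ≥ N, (arc ν b n).r = c ∧ (arc ν b n).y = (arc ν b N).y)
    (h : OnPath ν z k) (h1 : k' < k) (h2 : k < toLex ((arc ν b N).y, 0)) :
    z.rep = c ∧ z.sym = s := by
  have h3 := h.terminal hν hs ((strict_of_between hν hs h0).1 (fun n hn => (hN n hn).2) h1 h2)
  refine ⟨?_, (h3.strict hν hs 0).2.2⟩
  have hne : z ≠ .itin s := fun he => h1.ne' ((h3.eq_iff' hν h0).1 he)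
  rcases h3.rep hν h0 hne with ⟨-, M, hM⟩ | ⟨h4, -⟩
  · rw [(hM (max M N) (le_max_left _ _)).1, (hN (max M N) (le_max_right _ _)).1]
  · exact absurd h1 h4.asymm

theorem rep_of_between_left (hν : IsStarPeriodic ν p) (hs : Lies ν b s)
    (h0 : Terminal (arc ν b) s (.itin s) k') {N : ℕ}
    (hN : ∀ n ≥ N, (arc ν b n).l = c ∧ (arc ν b n).x = (arc ν b N).x)
    (h : OnPath ν z k) (h1 : toLex ((arc ν b N).x, 0) < k) (h2 : k < k') :
    z.rep = c ∧ z.sym = s := by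
  have h3 := h.terminal hν hs ((strict_of_between hν hs h0).2 (fun n hn => (hN n hn).2) h1 h2)
  refine ⟨?_, (h3.strict hν hs 0).2.2⟩
  have hne : z ≠ .itin s := fun he => h2.ne ((h3.eq_iff' hν h0).1 he)
  rcases h3.rep hν h0 hne with ⟨h4, -⟩ | ⟨-, M, hM⟩
  · exact absurd h2 h4.asymm
  · rw [(hM (max M N) (le_max_left _ _)).1, (hN (max M N) (le_max_right _ _)).1]

theorem Terminal.rep_compat (hν : IsStarPeriodic ν p) (hs : Lies ν b s)
    (h : Terminal (arc ν b) s z k) (i : ℕ) : z.rep i = none ∨ z.rep i = s i := by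
  by_cases hz : z = .itin s
  · rw [hz]; exact Or.inr rfl
  obtain ⟨k', h0⟩ := exists_terminal_itin hν b s
  rcases h.rep hν h0 hz with ⟨-, N, hN⟩ | ⟨-, N, hN⟩ <;> rw [(hN _ (le_max_left N (i + 1))).1]
  · exact (hs.2 _ i (agree_arc b (by omega))).2.2
  · exact (hs.2 _ i (agree_arc b (by omega))).2.1

theorem OnPath.rep_compat (hν : IsStarPeriodic ν p) (h : OnPath ν z k) (i : ℕ) :
    z.rep i = none ∨ z.rep i = z.sym i := by
  obtain ⟨b, s, hs, -, h1 | ⟨n, h1 | h1⟩⟩ := h.exists_code hν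
  · rw [(h1.strict hν hs 0).2.2]
    exact h1.rep_compat hν hs i
  · rw [(h1 n le_rfl).2]; exact Or.inr rfl
  · rw [(h1 n le_rfl).2]; exact Or.inr rfl

theorem OnPath.rep_starFree_or (hν : IsStarPeriodic ν p) (h : OnPath ν z k) :
    (StarFree z.rep ∧ z = .itin z.rep) ∨ (Precritical ν z.rep ∧ ∃ i, z.rep i = none) := by
  obtain ⟨b, s, hs, -, h1 | ⟨n, h1 | h1⟩⟩ := h.exists_code hν
  · by_cases hz : z = .itin s
    · rw [hz]; exact Or.inl ⟨hs.1, rfl⟩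
    obtain ⟨k', h0⟩ := exists_terminal_itin hν b s
    rcases h1.rep hν h0 hz with ⟨-, N, hN⟩ | ⟨-, N, hN⟩ <;> rw [(hN _ le_rfl).1]
    · exact Or.inr ⟨(goodArc hν b N).pre_r, (goodArc hν b N).star_r⟩
    · exact Or.inr ⟨(goodArc hν b N).pre_l, (goodArc hν b N).star_l⟩
  · rw [(h1 n le_rfl).2]
    exact Or.inr ⟨(goodArc hν b n).pre_l, (goodArc hν b n).star_l⟩
  · rw [(h1 n le_rfl).2]
    exact Or.inr ⟨(goodArc hν b n).pre_r, (goodArc hν b n).star_r⟩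

/-- The endpoints of the adjacent pairs are endpoints of pairs on their other side, too. -/
theorem exists_adjacent (ν : Itin A) (b : ℕ → Bool) (n : ℕ) :
    ((arc ν b n).x = 0 ∨ ∃ b' n', (arc ν b' n').r = (arc ν b n).l ∧
      (arc ν b' n').y = (arc ν b n).x) ∧
    ((arc ν b n).y = 1 ∨ ∃ b' n', (arc ν b' n').l = (arc ν b n).r ∧
      (arc ν b' n').x = (arc ν b n).y) := by
  induction n with
  | zero => exact ⟨Or.inl rfl, Or.inl rfl⟩
  | succ n ih =>
    by_cases hg : IsGap (arc ν b n)
    · rwa [arc_eq_of_gap hg (Nat.le_succ n)]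
    cases h : b n
    · rw [arc_succ_false hg h]
      refine ⟨ih.1, Or.inr ?_⟩
      obtain ⟨b', h1, h2⟩ := exists_code_fixed ν b n true
      refine ⟨b', n + 1, ?_⟩
      rw [arc_succ_true (h1 ▸ hg) h2, h1]
      exact ⟨rfl, rfl⟩
    · rw [arc_succ_true hg h]
      refine ⟨Or.inr ?_, ih.2⟩
      obtain ⟨b', h1, h2⟩ := exists_code_fixed ν b n false
      refine ⟨b', n + 1, ?_⟩
      rw [arc_succ_false (h1 ▸ hg) h2, h1]
      exact ⟨rfl, rfl⟩

/-- Choosing the left half forever leads to a point `y` without `⋆`; between it and `z` there is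
only a Fatou interval ending at `z`. -/
theorem exists_open_right (hν : IsStarPeriodic ν p) {z : critPath ν}
    (h : ∃ b n, z.1 = .itin (arc ν b n).l ∧ pos z = toLex ((arc ν b n).x, 0)) :
    ∃ O : Set (critPath ν), IsOpen O ∧ z ∈ O ∧ ∀ w ∈ O, pos z < pos w → w.1.rep = z.1.rep := by
  obtain ⟨b, n, h1, h2⟩ := h
  obtain ⟨b', h3, h4⟩ := exists_code_left ν b n
  obtain ⟨s, hs⟩ := exists_lies hν b'
  obtain ⟨k, h0⟩ := exists_terminal_itin hν b' s
  let y : critPath ν := ⟨_, k, h0.onPath hν hs⟩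
  have hy : pos y = k := (h0.onPath hν hs).pos_eq hν
  refine ⟨{w | pos w < pos y}, isOpen_lt_pos hν y, ?_, fun w hw hzw => ?_⟩
  · change pos z < pos y
    rw [hy, h2, ← h4]
    exact (h0.strict hν hs n).1
  · refine (rep_of_between_left hν hs h0 (N := n) (fun m hm => ?_) (onPath_pos w) ?_
      (hy ▸ hw)).1
    · rw [(arc_left_const h3 hm).2, (arc_left_const h3 hm).1, h4, h1]
      exact ⟨rfl, rfl⟩
    · rwa [h4, ← h2]

theorem exists_open_left (hν : IsStarPeriodic ν p) {z : critPath ν}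
    (h : ∃ b n, z.1 = .itin (arc ν b n).r ∧ pos z = toLex ((arc ν b n).y, 0)) :
    ∃ O : Set (critPath ν), IsOpen O ∧ z ∈ O ∧ ∀ w ∈ O, pos w < pos z → w.1.rep = z.1.rep := by
  obtain ⟨b, n, h1, h2⟩ := h
  obtain ⟨b', h3, h4⟩ := exists_code_right ν b n
  obtain ⟨s, hs⟩ := exists_lies hν b'
  obtain ⟨k, h0⟩ := exists_terminal_itin hν b' s
  let y : critPath ν := ⟨_, k, h0.onPath hν hs⟩
  have hy : pos y = k := (h0.onPath hν hs).pos_eq hν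
  refine ⟨{w | pos y < pos w}, isOpen_pos_lt hν y, ?_, fun w hw hzw => ?_⟩
  · change pos y < pos z
    rw [hy, h2, ← h4]
    exact (h0.strict hν hs n).2.1
  · refine (rep_of_between_right hν hs h0 (N := n) (fun m hm => ?_) (onPath_pos w)
      (hy ▸ hw) ?_).1
    · rw [(arc_right_const h3 hm).2, (arc_right_const h3 hm).1, h4, h1]
      exact ⟨rfl, rfl⟩
    · rwa [h4, ← h2]

theorem exists_open_rep_of_endpoint (hν : IsStarPeriodic ν p) {z : critPath ν} {b : ℕ → Bool}
    {n : ℕ} (h : (pos z = toLex ((arc ν b n).x, 0) ∧ z.1 = .itin (arc ν b n).l) ∨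
      pos z = toLex ((arc ν b n).y, 0) ∧ z.1 = .itin (arc ν b n).r) :
    ∃ O : Set (critPath ν), IsOpen O ∧ z ∈ O ∧ ∀ w ∈ O, w.1.rep = z.1.rep := by
  have hl : ∃ O : Set (critPath ν), IsOpen O ∧ z ∈ O ∧
      ∀ w ∈ O, pos w < pos z → w.1.rep = z.1.rep := by
    have hz : pos z = toLex (0, 0) ∨
        ∃ b n, z.1 = .itin (arc ν b n).r ∧ pos z = toLex ((arc ν b n).y, 0) := by
      rcases h with ⟨h1, h2⟩ | ⟨h1, h2⟩
      · rcases (exists_adjacent ν b n).1 with h3 | ⟨b', n', h3, h4⟩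
        · rw [h1, h3]; exact Or.inl rfl
        · exact Or.inr ⟨b', n', by rw [h3, h2], by rw [h4, h1]⟩
      · exact Or.inr ⟨b, n, h2, h1⟩
    rcases hz with hz | hz
    · exact ⟨Set.univ, isOpen_univ, Set.mem_univ _, fun w _ hw =>
        absurd (hz ▸ hw) (not_lt_of_ge (pos_mem hν w).1)⟩
    · exact exists_open_left hν hz
  have hr : ∃ O : Set (critPath ν), IsOpen O ∧ z ∈ O ∧
      ∀ w ∈ O, pos z < pos w → w.1.rep = z.1.rep := by
    have hz : pos z = toLex (1, 0) ∨
        ∃ b n, z.1 = .itin (arc ν b n).l ∧ pos z = toLex ((arc ν b n).x, 0) := by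
      rcases h with ⟨h1, h2⟩ | ⟨h1, h2⟩
      · exact Or.inr ⟨b, n, h2, h1⟩
      · rcases (exists_adjacent ν b n).2 with h3 | ⟨b', n', h3, h4⟩
        · rw [h1, h3]; exact Or.inl rfl
        · exact Or.inr ⟨b', n', by rw [h3, h2], by rw [h4, h1]⟩
    rcases hz with hz | hz
    · exact ⟨Set.univ, isOpen_univ, Set.mem_univ _, fun w _ hw =>
        absurd (hz ▸ hw) (not_lt_of_ge (pos_mem hν w).2)⟩
    · exact exists_open_right hν hz
  obtain ⟨O, h1, h2, h3⟩ := hl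
  obtain ⟨O', h1', h2', h3'⟩ := hr
  refine ⟨O ∩ O', h1.inter h1', ⟨h2, h2'⟩, fun w hw => ?_⟩
  rcases lt_trichotomy (pos w) (pos z) with h | h | h
  · exact h3 w hw.1 h
  · rw [pos_injective hν h]
  · exact h3' w hw.2 h

theorem isOpen_between (hν : IsStarPeriodic ν p) (a c : critPath ν) :
    IsOpen {w : critPath ν | pos a < pos w ∧ pos w < pos c} :=
  (isOpen_pos_lt hν a).inter (isOpen_lt_pos hν c)

/-- Each point has a neighbourhood whose points have the same precritical end or, for points without
`⋆`, whose precritical ends agree with it up to any given depth. -/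
theorem exists_open_rep (hν : IsStarPeriodic ν p) (z : critPath ν) (N : ℕ) :
    ∃ O : Set (critPath ν), IsOpen O ∧ z ∈ O ∧
      ((∃ i, z.1.rep i = none) ∧ (∀ w ∈ O, w.1.rep = z.1.rep) ∨
      StarFree z.1.rep ∧ z.1 = .itin z.1.rep ∧
        ∀ w ∈ O, ∀ i < N, w.1.rep i = none ∨ w.1.rep i = z.1.rep i) := by
  have hz := onPath_pos z
  obtain ⟨b, s, hs, -, h1 | ⟨n, h1⟩⟩ := hz.exists_code hν
  · have hI := goodArc hν b N
    let lpt : ∀ n, critPath ν := fun n => ⟨_, _, .left b n⟩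
    let rpt : ∀ n, critPath ν := fun n => ⟨_, _, .right b n⟩
    have hl : ∀ n, pos (lpt n) = toLex ((arc ν b n).x, 0) := fun n =>
      OnPath.pos_eq hν (z := lpt n) (.left b n)
    have hr : ∀ n, pos (rpt n) = toLex ((arc ν b n).y, 0) := fun n =>
      OnPath.pos_eq hν (z := rpt n) (.right b n)
    obtain ⟨k, h0⟩ := exists_terminal_itin hν b s
    let y : critPath ν := ⟨_, k, h0.onPath hν hs⟩
    have hy : pos y = k := (h0.onPath hν hs).pos_eq hν
    by_cases hzs : z.1 = .itin s
    · have hrep : z.1.rep = s := by rw [hzs]; rfl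
      refine ⟨_, isOpen_between hν (lpt N) (rpt N), ?_,
        Or.inr ⟨hrep ▸ hs.1, hrep.symm ▸ hzs, ?_⟩⟩
      · rw [Set.mem_ofPred, hl, hr]
        exact ⟨(h1.strict hν hs N).1, (h1.strict hν hs N).2.1⟩
      · intro w hw i hi
        rw [Set.mem_ofPred, hl, hr] at hw
        have h3 := (onPath_pos w).fits hν hw
        rw [hrep, ← hI.fits_unique h3 (hs.2 N) (agree_arc b hi)]
        exact (onPath_pos w).rep_compat hν i
    · rcases h1.rep hν h0 hzs with ⟨h2, M, hM⟩ | ⟨h2, M, hM⟩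
      · refine ⟨_, isOpen_between hν y (rpt M), ?_, Or.inl ⟨?_, fun w hw => ?_⟩⟩
        · rw [Set.mem_ofPred, hy, hr]
          exact ⟨h2, (h1.strict hν hs M).2.1⟩
        · rw [(hM M le_rfl).1]; exact (goodArc hν b M).star_r
        · rw [Set.mem_ofPred, hy, hr] at hw
          exact (rep_of_between_right hν hs h0 (fun n hn => ⟨(hM n hn).1.symm, (hM n hn).2⟩)
            (onPath_pos w) hw.1 hw.2).1
      · refine ⟨_, isOpen_between hν (lpt M) y, ?_, Or.inl ⟨?_, fun w hw => ?_⟩⟩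
        · rw [Set.mem_ofPred, hy, hl]
          exact ⟨(h1.strict hν hs M).1, h2⟩
        · rw [(hM M le_rfl).1]; exact (goodArc hν b M).star_l
        · rw [Set.mem_ofPred, hy, hl] at hw
          exact (rep_of_between_left hν hs h0 (fun n hn => ⟨(hM n hn).1.symm, (hM n hn).2⟩)
            (onPath_pos w) hw.1 hw.2).1
  · have h2 := h1.imp (fun h => h n le_rfl) (fun h => h n le_rfl)
    obtain ⟨O, h3, h4, h5⟩ := exists_open_rep_of_endpoint hν h2
    refine ⟨O, h3, h4, Or.inl ⟨?_, h5⟩⟩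
    rcases h2 with ⟨-, h⟩ | ⟨-, h⟩ <;> rw [h]
    · exact (goodArc hν b n).star_l
    · exact (goodArc hν b n).star_r

theorem Lies.exists_surrounds_ge (hν : IsStarPeriodic ν p) (h : Lies ν b τ) (N : ℕ) :
    ∃ M, ∀ m ≥ M, ∃ n ≥ N, Surrounds ν τ (arc ν b n) m := by
  obtain ⟨M, -, hM⟩ := h.exists_surrounds hν N
  refine ⟨M, fun m hm => ?_⟩
  induction m, hm using Nat.le_induction with
  | base => exact ⟨N, le_rfl, hM⟩
  | succ m _ ih =>
    obtain ⟨n, hn', hn⟩ := ih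
    by_cases ha : Agree (arc ν b n).l (arc ν b n).r m
    · refine ⟨n, hn', hn.extend (Nat.le_succ m) fun j hj hj' => ?_⟩
      obtain rfl : j = m := by omega
      exact (h.2 n j ha).2
    · have hg : ¬ IsGap (arc ν b n) := fun hg => ha (agree_of_diff_eq_top hg m)
      obtain ⟨k, hk⟩ := exists_firstDiff hg
      have h1 := hn.le hk
      rw [hk.agree_iff] at ha
      obtain rfl : m = k := by omega
      exact ⟨n + 1, by omega, h.step hν hn hk⟩

/-- The points `cur ν s (crit ν) m` approach the point `s` of the critical path from the left. -/
theorem exists_preconnected_left (hν : IsStarPeriodic ν p) {T : Set (critPath ν)}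
    {y w : critPath ν} (hs : StarFree s) (hy : y.1 = .itin s) (hwy : pos w < pos y)
    (hT : ∀ z ∈ T, StarFree z.1.rep ∧ z.1 = .itin z.1.rep)
    (hwT : ∀ z, pos w ≤ pos z → pos z < pos y → z ∉ T) :
    ∃ M, ∀ m ≥ M, ∃ S : Set (critPath ν), IsPreconnected S ∧ w ∈ S ∧ Disjoint S T ∧
      ∃ l ∈ S, l.1 = .itin (cur ν s (crit ν) m) := by
  obtain ⟨b, s', hs', -, h1 | ⟨n, h1⟩⟩ := (onPath_pos y).exists_code hν
  swap
  · rw [hy] at h1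
    rcases h1 with h1 | h1
    · obtain ⟨i, hi⟩ := (goodArc hν b n).star_l
      have := (h1 n le_rfl).2
      injection this with this
      exact absurd (this ▸ hi) (hs i)
    · obtain ⟨i, hi⟩ := (goodArc hν b n).star_r
      have := (h1 n le_rfl).2
      injection this with this
      exact absurd (this ▸ hi) (hs i)
  obtain rfl : s = s' := by
    have := (h1.strict hν hs' 0).2.2
    rwa [hy] at this
  rw [hy] at h1
  let lpt : ∀ n, critPath ν := fun n => ⟨_, _, .left b n⟩
  have hl : ∀ n, pos (lpt n) = toLex ((arc ν b n).x, 0) := fun n =>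
    OnPath.pos_eq hν (z := lpt n) (.left b n)
  have hly : ∀ n, pos (lpt n) < pos y := fun n => by
    rw [hl]; exact (h1.strict hν hs' n).1
  suffices ∃ N, ∀ n ≥ N, ∃ S : Set (critPath ν), IsPreconnected S ∧ w ∈ S ∧ Disjoint S T ∧
      lpt n ∈ S by
    obtain ⟨N, hN⟩ := this
    obtain ⟨M, hM⟩ := hs'.exists_surrounds_ge hν N
    refine ⟨M, fun m hm => ?_⟩
    obtain ⟨n, h2, h3⟩ := hM m hm
    obtain ⟨S, h4, h5, h6, h7⟩ := hN n h2
    exact ⟨S, h4, h5, h6, _, h7, congrArg _ h3.1⟩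
  -- Either the left endpoints pass `w`, and the interval from `w` to them avoids `T` by `hwT`. Or
  -- `w` is beyond all of them, hence on a Fatou interval next to `s`; the interval back to its
  -- precritical end contains only points whose `rep` has a `⋆`.
  by_cases hex : ∃ N, pos w ≤ pos (lpt N)
  · obtain ⟨N, hN⟩ := hex
    refine ⟨N, fun n hn => ⟨{z | pos w ≤ pos z ∧ pos z ≤ pos (lpt n)}, ?_, ?_, ?_, ?_⟩⟩
    · exact isPreconnected_of_convex hν fun x hx z hz u h2 h3 =>
        ⟨hx.1.trans h2, h3.trans hz.2⟩
    · refine ⟨le_rfl, hN.trans ?_⟩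
      rw [hl, hl]
      exact Prod.Lex.toLex_mono (Prod.mk_le_mk.2 ⟨(arc_nested hν hn).1, le_rfl⟩)
    · exact Set.disjoint_left.2 fun z hz => hwT z hz.1 (hz.2.trans_lt (hly n))
    · refine ⟨hN.trans ?_, le_rfl⟩
      rw [hl, hl]
      exact Prod.Lex.toLex_mono (Prod.mk_le_mk.2 ⟨(arc_nested hν hn).1, le_rfl⟩)
  · push Not at hex
    have hw : Terminal (arc ν b) s w.1 (pos w) := (onPath_pos w).terminal hν hs' fun n =>
      ⟨hl n ▸ hex n, hwy.trans (h1.strict hν hs' n).2.1⟩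
    have hws : w.1 ≠ .itin s := fun he => hwy.ne ((hw.eq_iff' hν h1).1 he)
    rcases hw.rep hν h1 hws with ⟨h2, -⟩ | ⟨-, N, hN⟩
    · exact absurd h2 hwy.asymm
    refine ⟨N, fun n hn => ⟨{z | pos (lpt n) ≤ pos z ∧ pos z ≤ pos w}, ?_, ?_, ?_, ?_⟩⟩
    · exact isPreconnected_of_convex hν fun x hx z hz u h2 h3 =>
        ⟨hx.1.trans h2, h3.trans hz.2⟩
    · exact ⟨(hex n).le, le_rfl⟩
    · rw [Set.disjoint_left]
      intro z hz hzT
      have hzn := hT z hzT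
      rcases lt_or_eq_of_le hz.1 with h3 | h3
      · have h4 := (rep_of_between_left hν hs' h1 (N := n) (c := w.1.rep) (fun m hm => by
          rw [(hN m (hn.trans hm)).2, (hN n hn).2]
          exact ⟨(hN m (hn.trans hm)).1.symm, rfl⟩) (onPath_pos z) (hl n ▸ h3)
          (hz.2.trans_lt hwy)).1
        obtain ⟨i, hi⟩ := (goodArc hν b n).star_l
        rw [h4, (hN n hn).1] at hzn
        exact hzn.1 i hi
      · rw [← pos_injective hν h3] at hzn
        obtain ⟨i, hi⟩ := (goodArc hν b n).star_l
        exact hzn.1 i hi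
    · exact ⟨le_rfl, (hex n).le⟩

/-- The points `cur ν s ν m` approach the point `s` of the critical path from the right. -/
theorem exists_preconnected_right (hν : IsStarPeriodic ν p) {T : Set (critPath ν)}
    {y w : critPath ν} (hs : StarFree s) (hy : y.1 = .itin s) (hwy : pos y < pos w)
    (hT : ∀ z ∈ T, StarFree z.1.rep ∧ z.1 = .itin z.1.rep)
    (hwT : ∀ z, pos y < pos z → pos z ≤ pos w → z ∉ T) :
    ∃ M, ∀ m ≥ M, ∃ S : Set (critPath ν), IsPreconnected S ∧ w ∈ S ∧ Disjoint S T ∧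
      ∃ l ∈ S, l.1 = .itin (cur ν s ν m) := by
  obtain ⟨b, s', hs', -, h1 | ⟨n, h1⟩⟩ := (onPath_pos y).exists_code hν
  swap
  · rw [hy] at h1
    rcases h1 with h1 | h1
    · obtain ⟨i, hi⟩ := (goodArc hν b n).star_l
      have := (h1 n le_rfl).2
      injection this with this
      exact absurd (this ▸ hi) (hs i)
    · obtain ⟨i, hi⟩ := (goodArc hν b n).star_r
      have := (h1 n le_rfl).2
      injection this with this
      exact absurd (this ▸ hi) (hs i)
  obtain rfl : s = s' := by
    have := (h1.strict hν hs' 0).2.2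
    rwa [hy] at this
  rw [hy] at h1
  let rpt : ∀ n, critPath ν := fun n => ⟨_, _, .right b n⟩
  have hr : ∀ n, pos (rpt n) = toLex ((arc ν b n).y, 0) := fun n =>
    OnPath.pos_eq hν (z := rpt n) (.right b n)
  have hry : ∀ n, pos y < pos (rpt n) := fun n => by
    rw [hr]; exact (h1.strict hν hs' n).2.1
  suffices ∃ N, ∀ n ≥ N, ∃ S : Set (critPath ν), IsPreconnected S ∧ w ∈ S ∧ Disjoint S T ∧
      rpt n ∈ S by
    obtain ⟨N, hN⟩ := this
    obtain ⟨M, hM⟩ := hs'.exists_surrounds_ge hν N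
    refine ⟨M, fun m hm => ?_⟩
    obtain ⟨n, h2, h3⟩ := hM m hm
    obtain ⟨S, h4, h5, h6, h7⟩ := hN n h2
    exact ⟨S, h4, h5, h6, _, h7, congrArg _ h3.2⟩
  by_cases hex : ∃ N, pos (rpt N) ≤ pos w
  · obtain ⟨N, hN⟩ := hex
    refine ⟨N, fun n hn => ⟨{z | pos (rpt n) ≤ pos z ∧ pos z ≤ pos w}, ?_, ?_, ?_, ?_⟩⟩
    · exact isPreconnected_of_convex hν fun x hx z hz u h2 h3 =>
        ⟨hx.1.trans h2, h3.trans hz.2⟩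
    · refine ⟨hN.trans' ?_, le_rfl⟩
      rw [hr, hr]
      exact Prod.Lex.toLex_mono (Prod.mk_le_mk.2 ⟨(arc_nested hν hn).2, le_rfl⟩)
    · exact Set.disjoint_left.2 fun z hz => hwT z (hz.1.trans_lt' (hry n)) hz.2
    · refine ⟨le_rfl, hN.trans' ?_⟩
      rw [hr, hr]
      exact Prod.Lex.toLex_mono (Prod.mk_le_mk.2 ⟨(arc_nested hν hn).2, le_rfl⟩)
  · push Not at hex
    have hw : Terminal (arc ν b) s w.1 (pos w) := (onPath_pos w).terminal hν hs' fun n =>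
      ⟨hwy.trans' (h1.strict hν hs' n).1, hr n ▸ hex n⟩
    have hws : w.1 ≠ .itin s := fun he => hwy.ne' ((hw.eq_iff' hν h1).1 he)
    rcases hw.rep hν h1 hws with ⟨-, N, hN⟩ | ⟨h2, -⟩
    swap
    · exact absurd h2 hwy.asymm
    refine ⟨N, fun n hn => ⟨{z | pos w ≤ pos z ∧ pos z ≤ pos (rpt n)}, ?_, ?_, ?_, ?_⟩⟩
    · exact isPreconnected_of_convex hν fun x hx z hz u h2 h3 =>
        ⟨hx.1.trans h2, h3.trans hz.2⟩
    · exact ⟨le_rfl, (hex n).le⟩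
    · rw [Set.disjoint_left]
      intro z hz hzT
      have hzn := hT z hzT
      rcases lt_or_eq_of_le hz.2 with h3 | h3
      · have h4 := (rep_of_between_right hν hs' h1 (N := n) (c := w.1.rep) (fun m hm => by
          rw [(hN m (hn.trans hm)).2, (hN n hn).2]
          exact ⟨(hN m (hn.trans hm)).1.symm, rfl⟩) (onPath_pos z)
          (hwy.trans_le hz.1) (hr n ▸ h3)).1
        obtain ⟨i, hi⟩ := (goodArc hν b n).star_r
        rw [h4, (hN n hn).1] at hzn
        exact hzn.1 i hi
      · rw [pos_injective hν h3] at hzn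
        obtain ⟨i, hi⟩ := (goodArc hν b n).star_r
        exact hzn.1 i hi
    · exact ⟨(hex n).le, le_rfl⟩

end nbhd

/-! ### Fatou intervals, and the images of the critical path -/

/-- The sequence `u` and the precritical point `c` bound a Fatou interval in the direction of
`x`. -/
def Germ (ν u x c : Itin A) : Prop := ∃ M, ∀ m ≥ M, cur ν u x m = c

section cover

variable [One A] {ν τ u w x x' y s s' : Itin A} {p m n : ℕ} {c : Itin A} {b b' : ℕ → Bool}
  {z z' : Pt A} {k : ℕ} {e : A} {h : FatouMaps A}

/-- Together with `fatou_mem_of_germ` this makes membership of a Fatou interval in the path a purely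
symbolic condition. -/
theorem OnPath.germ {κ : ℝ ×ₗ ℝ} {t : Set.Ioo (0 : ℝ) 1} (hν : IsStarPeriodic ν p)
    (hz : OnPath ν (.fatou u c t) κ) : StarFree u ∧ ¬ SameSide ν u (crit ν) ν ∧
      (Germ ν u (crit ν) c ∨ Germ ν u ν c) := by
  obtain ⟨b, s, hs, -, h1 | ⟨n, h1 | h1⟩⟩ := hz.exists_code hν
  · obtain rfl : u = s := (h1.strict hν hs 0).2.2
    refine ⟨hs.1, hs.not_sameSide hν, ?_⟩
    obtain ⟨k', h0⟩ := exists_terminal_itin hν b u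
    rcases h1.rep hν h0 (by simp) with ⟨-, N, hN⟩ | ⟨-, N, hN⟩ <;>
      obtain ⟨M, hM⟩ := hs.exists_surrounds_ge hν N
    · refine Or.inr ⟨M, fun m hm => ?_⟩
      obtain ⟨n, hn, h2⟩ := hM m hm
      rw [← h2.2, ← (hN n hn).1]; rfl
    · refine Or.inl ⟨M, fun m hm => ?_⟩
      obtain ⟨n, hn, h2⟩ := hM m hm
      rw [← h2.1, ← (hN n hn).1]; rfl
  · have := (h1 n le_rfl).2
    simp at this
  · have := (h1 n le_rfl).2
    simp at this

theorem mem_critPath_of_sep (hν : IsStarPeriodic ν p) (hτ : StarFree τ)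
    (hsep : ¬ SameSide ν τ (crit ν) ν) : Pt.itin τ ∈ critPath ν := by
  obtain ⟨b, hb⟩ := exists_lies_of_sep hν hτ hsep
  obtain ⟨k, hk⟩ := exists_terminal_itin hν b τ
  exact ⟨k, hk.onPath hν hb⟩

theorem OnPath.sep {κ : ℝ ×ₗ ℝ} (hν : IsStarPeriodic ν p) (hz : OnPath ν (.itin s) κ)
    (hs : StarFree s) : ¬ SameSide ν s (crit ν) ν := by
  obtain ⟨b, s', hs', -, h1 | ⟨n, h1 | h1⟩⟩ := hz.exists_code hν
  · obtain rfl : s = s' := (h1.strict hν hs' 0).2.2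
    exact hs'.not_sameSide hν
  · have h2 := (h1 n le_rfl).2
    injection h2 with h2
    obtain ⟨i, hi⟩ := (goodArc hν b n).star_l
    exact absurd (h2 ▸ hi) (hs i)
  · have h2 := (h1 n le_rfl).2
    injection h2 with h2
    obtain ⟨i, hi⟩ := (goodArc hν b n).star_r
    exact absurd (h2 ▸ hi) (hs i)

theorem mid_ne_left (hg : ¬ IsGap (arc ν b n)) :
    mid ν (arc ν b n).l (arc ν b n).r ≠ (arc ν b n).l ∧
      mid ν (arc ν b n).l (arc ν b n).r ≠ (arc ν b n).r := by
  obtain ⟨k, hk⟩ := exists_firstDiff hg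
  have hm : mid ν (arc ν b n).l (arc ν b n).r k = none := hk.mid_add 0
  exact ⟨fun h => hk.1.1 (h ▸ hm), fun h => hk.1.2.1 (h ▸ hm)⟩

theorem arc_mem_critPath (ν : Itin A) (b : ℕ → Bool) (n : ℕ) :
    Pt.itin (arc ν b n).l ∈ critPath ν ∧ Pt.itin (arc ν b n).r ∈ critPath ν :=
  ⟨⟨_, .left b n⟩, ⟨_, .right b n⟩⟩

theorem fatou_mem_of_left (hν : IsStarPeriodic ν p) (hs : Lies ν b s) {N : ℕ}
    (hc : ∀ n ≥ N, (arc ν b n).l = c) (t : Set.Ioo (0 : ℝ) 1) : Pt.fatou s c t ∈ critPath ν := by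
  have ht : (t : ℝ) ∈ Set.Ico (0 : ℝ) 1 := ⟨t.2.1.le, t.2.2⟩
  by_cases hg : ∃ n, IsGap (arc ν b n)
  · obtain ⟨n, hg⟩ := hg
    have h1 := Terminal.gapL (s := s) n (t : ℝ) hg ht
    rw [fatouPt_coe] at h1
    have h2 : (arc ν b n).l = c := by
      rw [← hc _ (le_max_left N n), arc_eq_of_gap hg (le_max_right N n)]
    exact h2 ▸ ⟨_, h1.onPath hν hs⟩
  · push Not at hg
    have hb : ∀ i ≥ N, b i = false := by
      intro i hi
      by_contra hb
      have h1 := hc (i + 1) (by omega)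
      rw [arc_succ_true (hg i) (by simpa using hb)] at h1
      exact (mid_ne_left (hg i)).1 (h1.trans (hc i hi).symm)
    have h1 := Terminal.right (s := s) N (t : ℝ) hg (fun m hm => ⟨(arc_left_const hb hm).1,
      (arc_left_const hb hm).2, arc_lt_of_false hν (hg m) (hb m hm)⟩) ht
    rw [fatouPt_coe] at h1
    exact hc N le_rfl ▸ ⟨_, h1.onPath hν hs⟩

theorem fatou_mem_of_right (hν : IsStarPeriodic ν p) (hs : Lies ν b s) {N : ℕ}
    (hc : ∀ n ≥ N, (arc ν b n).r = c) (t : Set.Ioo (0 : ℝ) 1) : Pt.fatou s c t ∈ critPath ν := by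
  have ht : (t : ℝ) ∈ Set.Ico (0 : ℝ) 1 := ⟨t.2.1.le, t.2.2⟩
  by_cases hg : ∃ n, IsGap (arc ν b n)
  · obtain ⟨n, hg⟩ := hg
    have h1 := Terminal.gapR (s := s) n (t : ℝ) hg ht
    rw [fatouPt_coe] at h1
    have h2 : (arc ν b n).r = c := by
      rw [← hc _ (le_max_left N n), arc_eq_of_gap hg (le_max_right N n)]
    exact h2 ▸ ⟨_, h1.onPath hν hs⟩
  · push Not at hg
    have hb : ∀ i ≥ N, b i = true := by
      intro i hi
      by_contra hb
      have h1 := hc (i + 1) (by omega)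
      rw [arc_succ_false (hg i) (by simpa using hb)] at h1
      exact (mid_ne_left (hg i)).2 (h1.trans (hc i hi).symm)
    have h1 := Terminal.left (s := s) N (t : ℝ) hg (fun m hm => ⟨(arc_right_const hb hm).1,
      (arc_right_const hb hm).2, arc_lt_of_true hν (hg m) (hb m hm)⟩) ht
    rw [fatouPt_coe] at h1
    exact hc N le_rfl ▸ ⟨_, h1.onPath hν hs⟩

theorem fatou_mem_of_germ (hν : IsStarPeriodic ν p) (hu : StarFree u)
    (hsep : ¬ SameSide ν u (crit ν) ν) (hc : Germ ν u (crit ν) c ∨ Germ ν u ν c) :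
    (∀ t, Pt.fatou u c t ∈ critPath ν) ∧ Pt.itin c ∈ critPath ν := by
  obtain ⟨b, hb⟩ := exists_lies_of_sep hν hu hsep
  rcases hc with ⟨M, hM⟩ | ⟨M, hM⟩
  · have h1 : ∀ n ≥ M, (arc ν b n).l = c := fun n hn => by
      obtain ⟨m, hm, h2⟩ := hb.exists_surrounds hν n
      rw [h2.1, hM m (by omega)]
    exact ⟨fatou_mem_of_left hν hb h1, h1 M le_rfl ▸ (arc_mem_critPath ν b M).1⟩
  · have h1 : ∀ n ≥ M, (arc ν b n).r = c := fun n hn => by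
      obtain ⟨m, hm, h2⟩ := hb.exists_surrounds hν n
      rw [h2.2, hM m (by omega)]
    exact ⟨fatou_mem_of_right hν hb h1, h1 M le_rfl ▸ (arc_mem_critPath ν b M).2⟩

/-- Every precritical point on the critical path is the end of a Fatou interval. -/
theorem exists_fatou_of_star (hν : IsStarPeriodic ν p) (hc : Pt.itin c ∈ critPath ν)
    (hstar : ¬ StarFree c) : ∃ u, ∀ t, Pt.fatou u c t ∈ critPath ν := by
  obtain ⟨κ, hκ⟩ := hc
  obtain ⟨b, s, hs, -, h1 | ⟨n, h1 | h1⟩⟩ := hκ.exists_code hν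
  · obtain rfl : c = s := (h1.strict hν hs 0).2.2
    exact absurd hs.1 hstar
  · refine ⟨s, fatou_mem_of_left hν hs (N := n) fun m hm => ?_⟩
    have := (h1 m hm).2
    injection this with this
    exact this.symm
  · refine ⟨s, fatou_mem_of_right hν hs (N := n) fun m hm => ?_⟩
    have := (h1 m hm).2
    injection this with this
    exact this.symm

theorem SameSide.forward (h : SameSide ν τ x y) :
    SameSide ν (shift τ) (track ν τ x 1) (track ν τ y 1) :=
  (sameSide_track (τ := τ) 1).2 h

/-- A point that separates two consecutive postcritical points is an image of a point on the
critical path, with the same sides. -/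
theorem exists_preimage_of_sep (hν : IsStarPeriodic ν p) (k : ℕ) (hτ : StarFree τ)
    (hsep : ¬ SameSide ν τ (shift^[k] (crit ν)) (shift^[k + 1] (crit ν)))
    (hx : x = shift^[k] (crit ν) ∨ x = shift^[k + 1] (crit ν)) :
    ∃ y, StarFree y ∧ shift^[k] y = τ ∧ ¬ SameSide ν y (crit ν) ν ∧
      (SameSide ν τ x (track ν y (crit ν) k) ∨ SameSide ν τ x (track ν y ν k)) := by
  induction k generalizing τ x with
  | zero =>
    refine ⟨τ, hτ, rfl, hsep, ?_⟩
    rcases hx with rfl | rfl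
    · exact Or.inl .refl
    · exact Or.inr .refl
  | succ k ih =>
    set a := shift^[k] (crit ν) with ha
    have ha1 : shift^[k + 1] (crit ν) = shift a := Function.iterate_succ_apply' _ _ _
    have ha2 : shift^[k + 2] (crit ν) = shift (shift a) := by
      rw [Function.iterate_succ_apply', ha1]
    have hpa : Post ν a := by
      rw [ha, hν.crit_eq, shift_iterate_add]; exact ⟨_, rfl⟩
    rw [ha1, ha2] at hsep hx
    -- Prepend a symbol to `τ` such that the new point separates `a` from `shift a`, with `x` on the
    -- image of one of the two sides. The candidates are the first symbols of `a` and of `shift a`.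
    suffices ∃ s : A, ¬ SameSide ν τ (track ν (fun n => n.casesOn (some s) τ) a 1)
        (track ν (fun n => n.casesOn (some s) τ) (shift a) 1) ∧
        (SameSide ν τ x (track ν (fun n => n.casesOn (some s) τ) a 1) ∨
          SameSide ν τ x (track ν (fun n => n.casesOn (some s) τ) (shift a) 1)) by
      obtain ⟨s, h1, h2⟩ := this
      set σ : Itin A := fun n => n.casesOn (some s) τ with hσ
      have hσf : StarFree σ := fun n => by
        cases n with
        | zero => simp [hσ]
        | succ n => exact hτ n
      have hσs : shift σ = τ := rfl
      have h3 : ∃ x0, (x0 = a ∨ x0 = shift a) ∧ SameSide ν τ x (track ν σ x0 1) := by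
        rcases h2 with h2 | h2
        · exact ⟨a, Or.inl rfl, h2⟩
        · exact ⟨_, Or.inr rfl, h2⟩
      obtain ⟨x0, hx0, h3⟩ := h3
      obtain ⟨y, hy, hyk, hysep, hy'⟩ := ih (τ := σ) (x := x0) hσf (by
        rw [ha1]; exact fun h => h1 h.forward) (by rw [ha1]; exact hx0)
      refine ⟨y, hy, ?_, hysep, ?_⟩
      · rw [Function.iterate_succ_apply', hyk]; rfl
      · rw [track_add, track_add, hyk]
        exact hy'.imp (fun h => h3.trans h.forward) (fun h => h3.trans h.forward)
    have htr : ∀ (s : A) (z : Itin A), (z 0 = some s →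
        track ν (fun n => n.casesOn (some s) τ) z 1 = shift z) ∧
        (z 0 ≠ some s → track ν (fun n => n.casesOn (some s) τ) z 1 = ν) := fun s z =>
      ⟨fun h => track_succ_of_eq h, fun h => track_succ_of_ne h⟩
    have hshift : ∀ z : Itin A, Post ν z → z 0 = none → shift z = ν := fun z hz h =>
      hz.shift_succ_of_star hν h
    have hpick : ∀ z : Itin A, z 0 = none ∨ ∃ s, z 0 = some s := fun z => by
      cases z 0 <;> simp
    rcases hpick a with h0 | ⟨s, h0⟩ <;> rcases hpick (shift a) with h1 | ⟨s', h1⟩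
    · rw [hshift _ hpa.shift_mem h1, hshift a hpa h0] at hsep
      exact absurd .refl hsep
    · refine ⟨s', ?_⟩
      rw [(htr s' a).2 (by simp [h0]), (htr s' _).1 h1]
      have h2 := hshift a hpa h0
      refine ⟨fun h => hsep (h2.symm ▸ h), ?_⟩
      rcases hx with hx | hx
      · exact Or.inl ((hx.trans h2) ▸ .refl)
      · exact Or.inr (hx ▸ .refl)
    · refine ⟨s, ?_⟩
      rw [(htr s a).1 h0, (htr s _).2 (by simp [h1])]
      rw [hshift _ hpa.shift_mem h1] at hsep hx
      refine ⟨hsep, ?_⟩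
      rcases hx with rfl | rfl
      · exact Or.inl .refl
      · exact Or.inr .refl
    · have e1 := (htr s a).1 h0
      have e2 := (htr s' _).1 h1
      by_cases hss : s = s'
      · subst hss
        refine ⟨s, ?_⟩
        rw [e1, e2]
        refine ⟨hsep, ?_⟩
        rcases hx with rfl | rfl
        · exact Or.inl .refl
        · exact Or.inr .refl
      have e3 := (htr s' a).2 (by simp [h0, hss])
      have e4 := (htr s (shift a)).2 (by simp [h1, Ne.symm hss])
      -- For `s ≠ s'`, prepending `s` leads to the images `shift a` and `ν`, prepending `s'` to `ν`
      -- and `shift (shift a)`. Since `τ` separates `shift a` from `shift (shift a)`, it separates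
      -- `ν` from at least one of them; if from both, `x` decides.
      by_cases hB : SameSide ν τ ν (shift a)
      · refine ⟨s', ?_⟩
        rw [e2, e3]
        refine ⟨fun h => hsep (hB.symm.trans h), ?_⟩
        rcases hx with rfl | rfl
        · exact Or.inl hB.symm
        · exact Or.inr .refl
      by_cases hC : SameSide ν τ ν (shift (shift a))
      · refine ⟨s, ?_⟩
        rw [e1, e4]
        refine ⟨fun h => hB h.symm, ?_⟩
        rcases hx with rfl | rfl
        · exact Or.inl .refl
        · exact Or.inr hC.symm
      rcases hx with rfl | rfl
      · refine ⟨s, ?_⟩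
        rw [e1, e4]
        exact ⟨fun h => hB h.symm, Or.inl .refl⟩
      · refine ⟨s', ?_⟩
        rw [e2, e3]
        exact ⟨hC, Or.inr .refl⟩

/-- The critical orbit is a cycle through all postcritical points. If no consecutive pair were
separated next to the side of `x`, this side would propagate around the whole cycle. -/
theorem exists_consecutive_of_sep (hν : IsStarPeriodic ν p) (hx : Post ν x) (hx' : Post ν x')
    (hs : ¬ SameSide ν τ x x') : ∃ k < p,
      ¬ SameSide ν τ (shift^[k] (crit ν)) (shift^[k + 1] (crit ν)) ∧
      (SameSide ν τ x (shift^[k] (crit ν)) ∨ SameSide ν τ x (shift^[k + 1] (crit ν))) := by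
  have hper : ∀ k, shift^[k] (crit ν) = shift^[k % p] (crit ν) := fun k => by
    rw [hν.crit_eq, shift_iterate_add, shift_iterate_add, hν.shift_eq_iff]
    exact (Nat.mod_modEq k p).symm.add_right _
  suffices ∃ k, ¬ SameSide ν τ (shift^[k] (crit ν)) (shift^[k + 1] (crit ν)) ∧
      (SameSide ν τ x (shift^[k] (crit ν)) ∨ SameSide ν τ x (shift^[k + 1] (crit ν))) by
    obtain ⟨k, hk⟩ := this
    refine ⟨k % p, Nat.mod_lt _ hν.pos, ?_⟩
    rwa [hper k, Function.iterate_succ_apply', hper k, ← Function.iterate_succ_apply' shift] at hk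
  by_contra! hc
  obtain ⟨i, rfl⟩ := hx
  obtain ⟨j, rfl⟩ := hx'
  have hsucc : ∀ i, shift^[i + 1] (crit ν) = shift^[i] ν := fun i => rfl
  have key : ∀ k, SameSide ν τ (shift^[i] ν) (shift^[i + k] ν) := by
    intro k
    induction k with
    | zero => exact .refl
    | succ k ih =>
      by_contra hk
      rw [← hsucc (i + k)] at ih
      exact (hc (i + k + 1) fun h => hk (ih.trans h)).1 ih
  have h1 := key (j + p * i - i)
  have h2 : i ≤ p * i := Nat.le_mul_of_pos_left _ hν.pos
  rw [show i + (j + p * i - i) = j + p * i by omega, hν.shift_eq_iff.2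
    (show j + p * i ≡ j [MOD p] by simp [Nat.ModEq])] at h1
  exact hs h1

theorem Germ.image (hν : IsStarPeriodic ν p) (hu : StarFree u) (hx : Precritical ν x)
    (h : Germ ν u x c) (k : ℕ) : Germ ν (shift^[k] u) (track ν u x k) (shift^[k] c) := by
  obtain ⟨M, hM⟩ := h
  exact ⟨M, fun m hm => by rw [← shift_cur hν hu hx, hM _ (by omega)]⟩

/-- By `cur_eventually_eq` the germ depends only on the side, provided that `τ` has another side. -/
theorem Germ.congr (hν : IsStarPeriodic ν p) (he : LastSymbol ν p e) (hτ : StarFree τ)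
    (h : Germ ν τ x c) (hx : Post ν x) (hx' : Post ν x') (hs : SameSide ν τ x x')
    {x'' : Itin A} (hx'' : Post ν x'') (hns : ¬ SameSide ν τ x'' x) : Germ ν τ x' c := by
  obtain ⟨M, hM⟩ := h
  obtain ⟨N, hN⟩ := cur_eventually_eq hν he hτ hx hx' hx'' hs hns
  exact ⟨max M N, fun m hm => by rw [← hN m (by omega), hM m (by omega)]⟩

/-- The first entries of the closest precritical points settle, and so do all of them if the
remaining entries do. -/
theorem Germ.of_shift (hν : IsStarPeriodic ν p) (hu : StarFree u) (hx : Precritical ν x)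
    (h : Germ ν (shift^[k] u) (track ν u x k) c) :
    ∃ c', shift^[k] c' = c ∧ Germ ν u x c' := by
  obtain ⟨M, hM⟩ := h
  have h1 : ∀ m ≥ M, shift^[k] (cur ν u x (k + m)) = c := fun m hm => by
    rw [shift_cur hν hu hx, hM m hm]
  have h2 : ∃ N ≥ M, ∀ m ≥ N, ∀ i < k, cur ν u x (k + m) i = cur ν u x (k + N) i := by
    by_cases hch : ∃ j ≥ k + M, ¬ (cur ν u x j j = none ∨ cur ν u x j j = u j)
    · obtain ⟨j, hj, hcj⟩ := hch
      have h3 : ∀ m ≥ j + 1, ∀ i < k, cur ν u x m i = u i := by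
        intro m hm i hi
        induction m, hm using Nat.le_induction with
        | base => rw [cur_succ_of_not hcj, precrit_of_lt (by omega)]
        | succ m hm ih =>
          rw [cur]
          split_ifs
          · exact ih
          · exact precrit_of_lt (by omega)
      exact ⟨j + 1, by omega, fun m hm i hi => by
        rw [h3 _ (by omega) i hi, h3 _ (by omega) i hi]⟩
    · push Not at hch
      refine ⟨M, le_rfl, fun m hm i _ => ?_⟩
      rw [cur_eq_of_forall (N := k + M) (fun n hn => by
        by_contra hc
        rw [not_or] at hc
        exact hc.2 ((hch n hn).resolve_left hc.1)) (by omega)]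
  obtain ⟨N, hNM, hN⟩ := h2
  refine ⟨cur ν u x (k + N), h1 N hNM, k + N, fun m hm => ?_⟩
  obtain ⟨m, rfl⟩ := Nat.exists_eq_add_of_le (show k ≤ m by omega)
  funext i
  rcases lt_or_ge i k with hi | hi
  · exact hN m (by omega) i hi
  · obtain ⟨i, rfl⟩ := Nat.exists_eq_add_of_le hi
    have h3 := congrFun ((h1 m (by omega)).trans (h1 N hNM).symm) i
    rwa [shift_iterate_apply, shift_iterate_apply, Nat.add_comm i k] at h3

/-- A germ at any point with at least two sides is the image of a germ on the critical path. -/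
theorem Germ.exists_preimage (h : Germ ν τ x c) (hν : IsStarPeriodic ν p)
    (he : LastSymbol ν p e) (hτ : StarFree τ) (hx : Post ν x) (hx' : Post ν x') (hs : ¬ SameSide ν τ x x') :
    ∃ k < p, ∃ u c', StarFree u ∧ shift^[k] u = τ ∧ shift^[k] c' = c ∧
      ¬ SameSide ν u (crit ν) ν ∧ (Germ ν u (crit ν) c' ∨ Germ ν u ν c') := by
  obtain ⟨k, hk, hsep, hxk⟩ := exists_consecutive_of_sep hν hx hx' hs
  have hpost : ∀ k, Post ν (shift^[k] (crit ν)) := fun k => by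
    rw [hν.crit_eq, shift_iterate_add]; exact ⟨_, rfl⟩
  have key : ∀ x0, (x0 = shift^[k] (crit ν) ∨ x0 = shift^[k + 1] (crit ν)) →
      SameSide ν τ x x0 → ∃ u c', StarFree u ∧ shift^[k] u = τ ∧ shift^[k] c' = c ∧
      ¬ SameSide ν u (crit ν) ν ∧ (Germ ν u (crit ν) c' ∨ Germ ν u ν c') := by
    intro x0 hx0 hxx0
    obtain ⟨u, h1, h2, h3, h4⟩ := exists_preimage_of_sep hν k hτ hsep hx0
    have h5 : ∀ y, Post ν y → SameSide ν τ x0 (track ν u y k) →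
        ∃ c', shift^[k] c' = c ∧ Germ ν u y c' := fun y hy h => by
      refine Germ.of_shift hν h1 (hy.precritical hν) ?_
      rw [h2]
      exact ‹Germ ν τ x c›.congr hν he hτ hx (hy.track_mem k) (hxx0.trans h) hx'
        fun h => hs h.symm
    rcases h4 with h4 | h4
    · obtain ⟨c', h6, h7⟩ := h5 _ (post_crit hν) h4
      exact ⟨u, c', h1, h2, h6, h3, Or.inl h7⟩
    · obtain ⟨c', h6, h7⟩ := h5 _ post_self h4
      exact ⟨u, c', h1, h2, h6, h3, Or.inr h7⟩
  rcases hxk with hxk | hxk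
  · exact ⟨k, hk, key _ (Or.inl rfl) hxk⟩
  · exact ⟨k, hk, key _ (Or.inr rfl) hxk⟩

theorem step_iterate_itin (h : FatouMaps A) (n : ℕ) (s : Itin A) :
    (step h)^[n] (.itin s) = .itin (shift^[n] s) := by
  induction n with
  | zero => rfl
  | succ n ih => rw [Function.iterate_succ_apply', ih, Function.iterate_succ_apply', step]

theorem step_iterate_fatou (h : FatouMaps A) (n : ℕ) (u c : Itin A) :
    ∃ f : Set.Ioo (0 : ℝ) 1 ≃o Set.Ioo (0 : ℝ) 1, ∀ t,
      (step h)^[n] (.fatou u c t) = .fatou (shift^[n] u) (shift^[n] c) (f t) := by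
  induction n with
  | zero => exact ⟨.refl _, fun t => rfl⟩
  | succ n ih =>
    obtain ⟨f, hf⟩ := ih
    refine ⟨f.trans (h (shift^[n] u) (shift^[n] c)), fun t => ?_⟩
    rw [Function.iterate_succ_apply', hf, Function.iterate_succ_apply',
      Function.iterate_succ_apply', step]
    rfl

theorem step_iterate_rep (h : FatouMaps A) (n : ℕ) (z : Pt A) :
    ((step h)^[n] z).rep = shift^[n] z.rep := by
  cases z with
  | itin s => rw [step_iterate_itin]; rfl
  | fatou u c t =>
    obtain ⟨f, hf⟩ := step_iterate_fatou h n u c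
    rw [hf]; rfl

/-- The images of the critical path under the first `p` iterates cover the tree. -/
theorem exists_lt_of_iterate (hν : IsStarPeriodic ν p) (he : LastSymbol ν p e) (h : FatouMaps A)
    (hz : z ∈ critPath ν) (n : ℕ) :
    ∃ k < p, ∃ w ∈ critPath ν, (step h)^[k] w = (step h)^[n] z := by
  -- Fatou intervals are pushed forward by `n` steps and pulled back by some `k < p` steps as germs.
  -- Precritical points are covered as ends of Fatou intervals.
  have hgerm : ∀ u c, (∃ t, Pt.fatou u c t ∈ critPath ν) → ∃ k < p, ∃ u' c',
      shift^[k] u' = shift^[n] u ∧ shift^[k] c' = shift^[n] c ∧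
      (∀ t, Pt.fatou u' c' t ∈ critPath ν) ∧ Pt.itin c' ∈ critPath ν := by
    rintro u c ⟨t, κ, hκ⟩
    obtain ⟨h1, h2, h3⟩ := hκ.germ hν
    have h4 : ¬ SameSide ν (shift^[n] u) (track ν u (crit ν) n) (track ν u ν n) := fun h =>
      h2 ((sameSide_track n).1 h)
    have h5 : StarFree (shift^[n] u) := fun i => by rw [shift_iterate_apply]; exact h1 _
    have h6 : ∃ k < p, ∃ u' c', StarFree u' ∧ shift^[k] u' = shift^[n] u ∧
        shift^[k] c' = shift^[n] c ∧ ¬ SameSide ν u' (crit ν) ν ∧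
        (Germ ν u' (crit ν) c' ∨ Germ ν u' ν c') := by
      rcases h3 with h3 | h3
      · exact Germ.exists_preimage (h3.image hν h1 (precritical_crit hν) n) hν he h5
          ((post_crit hν).track_mem n) (post_self.track_mem n) h4
      · exact Germ.exists_preimage (h3.image hν h1 (post_self.precritical hν) n) hν he h5
          (post_self.track_mem n) ((post_crit hν).track_mem n) fun h => h4 h.symm
    obtain ⟨k, hk, u', c', h7, h8, h9, h10, h11⟩ := h6
    obtain ⟨h12, h13⟩ := fatou_mem_of_germ hν h7 h10 h11
    exact ⟨k, hk, u', c', h8, h9, h12, h13⟩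
  cases z with
  | itin s =>
    by_cases hs : StarFree s
    · obtain ⟨κ, hκ⟩ := hz
      have h2 := hκ.sep hν hs
      have h4 : ¬ SameSide ν (shift^[n] s) (track ν s (crit ν) n) (track ν s ν n) := fun h =>
        h2 ((sameSide_track n).1 h)
      have h5 : StarFree (shift^[n] s) := fun i => by rw [shift_iterate_apply]; exact hs _
      obtain ⟨k, hk, h6, -⟩ := exists_consecutive_of_sep hν ((post_crit hν).track_mem n)
        (post_self.track_mem n) h4
      obtain ⟨y, h7, h8, h9, -⟩ := exists_preimage_of_sep hν k h5 h6 (Or.inl rfl)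
      exact ⟨k, hk, _, mem_critPath_of_sep hν h7 h9, by
        rw [step_iterate_itin, step_iterate_itin, h8]⟩
    · obtain ⟨u, hu⟩ := exists_fatou_of_star hν hz hs
      obtain ⟨k, hk, u', c', -, h1, -, h2⟩ := hgerm u s ⟨⟨1 / 2, by norm_num⟩, hu _⟩
      exact ⟨k, hk, _, h2, by rw [step_iterate_itin, step_iterate_itin, h1]⟩
  | fatou u c t =>
    obtain ⟨k, hk, u', c', h1, h2, h3, -⟩ := hgerm u c ⟨t, hz⟩
    -- The chosen homeomorphisms only change the coordinate, which is corrected by `g.symm (f t)`.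
    obtain ⟨f, hf⟩ := step_iterate_fatou h n u c
    obtain ⟨g, hg⟩ := step_iterate_fatou h k u' c'
    exact ⟨k, hk, _, h3 (g.symm (f t)), by rw [hf, hg, h1, h2, g.apply_symm_apply]⟩

end cover

/-! ### The arms of the Hubbard tree -/

section tree

variable [One A] {ν s s' x y c : Itin A} {p m n k : ℕ} {e : A} {h : FatouMaps A}
  {τ z z' : HubbardTree h ν p}

theorem Precritical.shift_iterate (hc : Precritical ν c) (k : ℕ) :
    Precritical ν (shift^[k] c) := fun n hn => by
  rw [shift_iterate_apply] at hn
  rw [shift_iterate_add, show n + 1 + k = n + k + 1 by omega, hc _ hn]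

theorem Precritical.exists_star (hν : IsStarPeriodic ν p) (hc : Precritical ν c)
    (hstar : ∃ i, c i = none) (k : ℕ) : ∃ j, shift^[k] c j = none := by
  obtain ⟨i, hi⟩ := hstar
  have h1 := congrFun (hc i hi) (p * (k + 1) - 1)
  have h2 : k + 1 ≤ p * (k + 1) := Nat.le_mul_of_pos_left _ hν.pos
  rw [shift_iterate_apply, (hν.star_iff _).2 ⟨k + 1, by omega⟩] at h1
  refine ⟨p * (k + 1) - 1 + (i + 1) - k, ?_⟩
  rw [shift_iterate_apply, show p * (k + 1) - 1 + (i + 1) - k + k = p * (k + 1) - 1 + (i + 1) by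
    omega, h1]

theorem StarFree.shift_iterate (hs : StarFree s) (k : ℕ) : StarFree (shift^[k] s) := fun n => by
  rw [shift_iterate_apply]; exact hs _

theorem StarFree.precritical (hs : StarFree s) : Precritical ν s := fun n hn => absurd hn (hs n)

theorem Post.exists_star (hν : IsStarPeriodic ν p) (hx : Post ν x) : ∃ i, x i = none := by
  obtain ⟨i, rfl⟩ := hx
  exact (post_self.precritical hν).exists_star hν ⟨p - 1, (hν.star_iff _).2
    ⟨1, by have := hν.pos; omega⟩⟩ i

/-- The first difference replaces a precritical point by the critical value. -/
theorem track_of_first_ne (hx : Precritical ν x) {i : ℕ}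
    (h1 : ∀ j < i, x j = none ∨ x j = s j) (h2 : x i ≠ s i) : track ν s x (i + 1) = ν := by
  apply track_succ_of_ne
  rwa [track_eq_shift (fun j _ hj => hx j hj) h1, shift_iterate_apply, Nat.zero_add]

/-- After the first difference the track of `x` is postcritical and contains `⋆`, whereas that of
`s` is a shift of `s`. -/
theorem not_sameSide_self (hν : IsStarPeriodic ν p) (hs : StarFree s) (hx : Precritical ν x)
    (hne : x ≠ s) : ¬ SameSide ν s s x := by
  obtain ⟨i, h1, h2⟩ := exists_first_ne hne
  intro h3
  obtain ⟨n, hn, hni⟩ := (h3.eventually.and (eventually_ge_atTop (i + 1))).exists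
  rw [track_eq_shift_of_eq fun i _ => rfl] at hn
  obtain ⟨k, rfl⟩ := Nat.exists_eq_add_of_le hni
  rw [track_add, track_of_first_ne hx (fun j hj => Or.inr (h2 j hj)) h1] at hn
  obtain ⟨j, hj⟩ := Post.exists_star hν (post_self.track_mem (τ := shift^[i + 1] s) k)
  exact hs.shift_iterate (i + 1 + k) j (hn ▸ hj)

theorem tree_rep_cases (hν : IsStarPeriodic ν p) (z : HubbardTree h ν p) :
    (StarFree z.1.rep ∧ z.1 = .itin z.1.rep) ∨
      (Precritical ν z.1.rep ∧ ∃ i, z.1.rep i = none) := by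
  obtain ⟨z, n, ⟨w, κ, hw⟩, rfl⟩ := z
  rcases hw.rep_starFree_or hν with ⟨h1, h2⟩ | ⟨h1, h2⟩
  · refine Or.inl ?_
    simp only [step_iterate_rep]
    exact ⟨h1.shift_iterate n, by rw [h2, step_iterate_itin]; rfl⟩
  · refine Or.inr ?_
    simp only [step_iterate_rep]
    exact ⟨h1.shift_iterate n, h1.exists_star hν h2 n⟩

theorem tree_rep_precritical (hν : IsStarPeriodic ν p) (z : HubbardTree h ν p) :
    Precritical ν z.1.rep := by
  rcases tree_rep_cases hν z with ⟨h1, -⟩ | ⟨h1, -⟩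
  · exact h1.precritical
  · exact h1

theorem tree_eq_of_rep (hν : IsStarPeriodic ν p) (hτ : τ.1 = .itin s) (hs : StarFree s)
    (hz : z.1.rep = s) : z = τ := by
  rcases tree_rep_cases hν z with ⟨-, h2⟩ | ⟨-, i, h2⟩
  · exact Subtype.ext (by rw [h2, hτ, hz])
  · exact absurd (hz ▸ h2) (hs i)

theorem continuous_pathToTree (h : FatouMaps A) (ν : Itin A) (hk : k < p) :
    Continuous (pathToTree h ν p k) :=
  continuous_iff_coinduced_le.2 (le_iSup (fun k : Fin p =>
    TopologicalSpace.coinduced (pathToTree h ν p k) inferInstance) ⟨k, hk⟩)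

theorem isOpen_tree_iff {U : Set (HubbardTree h ν p)} :
    IsOpen U ↔ ∀ k < p, IsOpen (pathToTree h ν p k ⁻¹' U) := by
  rw [isOpen_iSup_iff]
  exact ⟨fun h k hk => h ⟨k, hk⟩, fun h k => h k k.2⟩

/-- By `exists_open_rep`, sets described by precritical ends have open preimages under all iterates.
The open sets needed below are all of this kind. -/
theorem isOpen_tree_of_rep (hν : IsStarPeriodic ν p) {U : Set (HubbardTree h ν p)}
    (h1 : ∀ z ∈ U, (∃ i, z.1.rep i = none) → ∀ w : HubbardTree h ν p, w.1.rep = z.1.rep → w ∈ U)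
    (h2 : ∀ z ∈ U, StarFree z.1.rep → ∃ N, ∀ w : HubbardTree h ν p,
      (∀ i < N, w.1.rep i = none ∨ w.1.rep i = z.1.rep i) → w ∈ U) : IsOpen U := by
  refine isOpen_tree_iff.2 fun k _ => isOpen_iff_forall_mem_open.2 fun z hz => ?_
  have hrep : ∀ w : critPath ν, (pathToTree h ν p k w).1.rep = shift^[k] w.1.rep :=
    fun w => step_iterate_rep h k w
  by_cases hs : StarFree z.1.rep
  · obtain ⟨N, hN⟩ := h2 _ hz (by rw [hrep]; exact hs.shift_iterate k)
    obtain ⟨O, h3, h4, ⟨⟨i, hi⟩, -⟩ | ⟨-, -, h5⟩⟩ := exists_open_rep hν z (N + k)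
    · exact absurd hi (hs i)
    refine ⟨O, fun w hw => hN _ fun i hi => ?_, h3, h4⟩
    rw [hrep, hrep, shift_iterate_apply, shift_iterate_apply]
    exact h5 w hw _ (by omega)
  · obtain ⟨O, h3, h4, ⟨-, h5⟩ | ⟨h5, -⟩⟩ := exists_open_rep hν z 0
    · refine ⟨O, fun w hw => h1 _ hz ?_ _ ?_, h3, h4⟩
      · rcases (onPath_pos z).rep_starFree_or hν with ⟨h6, -⟩ | ⟨h6, h7⟩
        · exact absurd h6 hs
        · rw [hrep]
          exact h6.exists_star hν h7 k
      · rw [hrep, hrep, h5 w hw]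
    · exact absurd h5 hs

/-- The points on the side of `x` seen from `τ`. -/
def arm (τ : HubbardTree h ν p) (x : Itin A) : Set (HubbardTree h ν p) :=
  {z | SameSide ν τ.1.rep z.1.rep x}

theorem isOpen_compl_point (hν : IsStarPeriodic ν p) (hτ : τ.1 = .itin s) (hs : StarFree s) :
    IsOpen ({τ}ᶜ : Set (HubbardTree h ν p)) := by
  have hrep : τ.1.rep = s := by rw [hτ]; rfl
  refine isOpen_tree_of_rep hν ?_ ?_
  · rintro z - ⟨i, hi⟩ w hw rfl
    exact hs i (by rw [← hrep, hw, hi])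
  · intro z hz hzs
    have hne : s ≠ z.1.rep := fun h => hz (tree_eq_of_rep hν hτ hs h.symm)
    obtain ⟨i, h1, -⟩ := exists_first_ne hne
    refine ⟨i + 1, fun w hw hwτ => ?_⟩
    have h2 := hw i (by omega)
    rw [show w = τ from hwτ, hrep] at h2
    exact h2.elim (hs i) h1

/-- Points near a point without `⋆` first differ from `s` at the same index as it does; so they are
reset there and have the same track afterwards. -/
theorem isOpen_arm (hν : IsStarPeriodic ν p) (hτ : τ.1 = .itin s) (hs : StarFree s)
    (hx : ¬ SameSide ν s s x) : IsOpen (arm τ x) := by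
  have hrep : τ.1.rep = s := by rw [hτ]; rfl
  refine isOpen_tree_of_rep hν ?_ ?_
  · intro z hz _ w hw
    rw [arm, Set.mem_ofPred, hw]
    exact hz
  · intro z hz hzs
    rw [arm, Set.mem_ofPred, hrep] at hz
    have hne : z.1.rep ≠ s := fun h => hx (h ▸ hz)
    obtain ⟨i, h1, h2⟩ := exists_first_ne hne
    refine ⟨i + 1, fun w hw => ?_⟩
    rw [arm, Set.mem_ofPred, hrep]
    refine SameSide.trans ⟨i + 1, ?_⟩ hz
    have h4 : w.1.rep i ≠ s i := by
      rcases hw i (by omega) with h3 | h3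
      · rw [h3]; exact fun h => hs i h.symm
      · rwa [h3]
    rw [track_of_first_ne hzs.precritical (fun j hj => Or.inr (h2 j hj)) h1,
      track_of_first_ne (tree_rep_precritical hν w) (fun j hj => h2 j hj ▸ hw j (by omega)) h4]

theorem isOpen_cylinder (hν : IsStarPeriodic ν p) (h : FatouMaps A) (s : Itin A) (N : ℕ) :
    IsOpen {z : HubbardTree h ν p | ∀ i < N, z.1.rep i = none ∨ z.1.rep i = s i} := by
  refine isOpen_tree_of_rep hν ?_ ?_
  · intro z hz _ w hw
    rw [Set.mem_ofPred, hw]; exact hz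
  · intro z hz hzs
    refine ⟨N, fun w hw i hi => ?_⟩
    rw [← (hz i hi).resolve_left (hzs i)]
    exact hw i hi

theorem exists_post_point (h : FatouMaps A) (p : ℕ) (hx : Post ν x) :
    ∃ z : HubbardTree h ν p, z.1 = .itin x := by
  obtain ⟨i, rfl⟩ := hx
  exact ⟨⟨_, i, ⟨_, value_mem ν⟩, rfl⟩, step_iterate_itin h i ν⟩

theorem exists_lt_pathToTree (hν : IsStarPeriodic ν p) (he : LastSymbol ν p e)
    (z : HubbardTree h ν p) : ∃ k < p, ∃ w, pathToTree h ν p k w = z := by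
  obtain ⟨z, n, w, rfl⟩ := z
  obtain ⟨k, hk, w', h1, h2⟩ := exists_lt_of_iterate hν he h w.2 n
  exact ⟨k, hk, ⟨w', h1⟩, Subtype.ext h2⟩

/-- Points without `⋆` of the tree separate some postcritical points. -/
theorem exists_not_sameSide (hν : IsStarPeriodic ν p) (hτ : τ.1 = .itin s) (hs : StarFree s) :
    ∃ x x', Post ν x ∧ Post ν x' ∧ ¬ SameSide ν s x x' := by
  obtain ⟨z, n, ⟨w, κ, hw⟩, rfl⟩ := τ
  have h0 : s = shift^[n] w.rep := by
    rw [← step_iterate_rep h]; exact (congrArg Pt.rep hτ).symm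
  rcases hw.rep_starFree_or hν with ⟨h1, h2⟩ | ⟨h1, h2⟩
  · rw [h2] at hw
    refine ⟨track ν w.rep (crit ν) n, track ν w.rep ν n, (post_crit hν).track_mem n,
      post_self.track_mem n, ?_⟩
    rw [h0]
    exact fun h => hw.sep hν h1 ((sameSide_track n).1 h)
  · obtain ⟨j, hj⟩ := h1.exists_star hν h2 n
    exact absurd (h0 ▸ hj) (hs j)

/-- The component of a point in the complement of `τ` contains all precritical points that are
sufficiently close to `τ`, in some direction. -/
theorem exists_germ_in_component (hν : IsStarPeriodic ν p) (he : LastSymbol ν p e)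
    (hτ : τ.1 = .itin s) (hs : StarFree s) (hz : z ≠ τ) :
    ∃ x, Post ν x ∧ ∃ M, ∀ m ≥ M, ∃ y ∈ connectedComponentIn {τ}ᶜ z,
      y.1 = .itin (cur ν s x m) := by
  by_contra! hcon
  set K := connectedComponentIn {τ}ᶜ z with hK
  have hrep : ∀ k (w : critPath ν), (pathToTree h ν p k w).1.rep = shift^[k] w.1.rep :=
    fun k w => step_iterate_rep h k w
  have hτrep : τ.1.rep = s := by rw [hτ]; rfl
  have hextend : ∀ {S : Set (HubbardTree h ν p)}, IsPreconnected S → τ ∉ S →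
      ∀ a ∈ S, a ∈ K → S ⊆ K := by
    intro S hS hτS a ha haK
    rw [hK, connectedComponentIn_eq haK]
    exact hS.subset_connectedComponentIn ha (Set.subset_compl_singleton_iff.2 hτS)
  have hτK : τ ∉ K := fun h => connectedComponentIn_subset _ _ h rfl
  -- Suppose that the component `K` contains no germ at `τ`. Then an image of the path that meets
  -- `K` avoids `τ`: moving from `w` towards the nearest preimage of `τ` would yield points `cur`,
  -- whose images form a germ in `K`. So this connected image lies in `K`.
  have hall : ∀ k < p, ∀ w : critPath ν, pathToTree h ν p k w ∈ K →
      Set.range (pathToTree h ν p k) ⊆ K := by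
    intro k hk w hw
    set T : Set (critPath ν) := pathToTree h ν p k ⁻¹' {τ} with hTdef
    have hcont := continuous_pathToTree h ν hk
    have hT : IsClosed T := by
      rw [← isOpen_compl_iff]
      exact (isOpen_compl_point hν hτ hs).preimage hcont
    have hTs : ∀ u ∈ T, StarFree u.1.rep ∧ u.1 = .itin u.1.rep := by
      intro u hu
      rcases (onPath_pos u).rep_starFree_or hν with h1 | ⟨h1, h2⟩
      · exact h1
      · obtain ⟨j, hj⟩ := h1.exists_star hν h2 k
        rw [← hrep, show pathToTree h ν p k u = τ from hu, hτrep] at hj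
        exact absurd hj (hs j)
    have hwT : w ∉ T := fun hwT => hτK (Set.mem_singleton_iff.1 hwT ▸ hw)
    have hpush : ∀ (y : critPath ν) (x : Itin A), y ∈ T → Post ν x →
        (∃ M, ∀ m ≥ M, ∃ S : Set (critPath ν), IsPreconnected S ∧ w ∈ S ∧ Disjoint S T ∧
          ∃ l ∈ S, l.1 = .itin (cur ν y.1.rep x m)) → False := by
      rintro y x hyT hx ⟨M, hM⟩
      obtain ⟨m, hm, hm'⟩ := hcon (track ν y.1.rep x k) (hx.track_mem k) M
      obtain ⟨S, hS, hwS, hST, l, hl, hl'⟩ := hM (k + m) (by omega)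
      have h1 : pathToTree h ν p k '' S ⊆ K := by
        refine hextend (hS.image _ hcont.continuousOn) ?_ _ ⟨w, hwS, rfl⟩ hw
        rintro ⟨a, haS, ha⟩
        exact Set.disjoint_left.1 hST haS ha
      refine hm' _ (h1 ⟨l, hl, rfl⟩) ?_
      have h2 : shift^[k] y.1.rep = s := by
        rw [← hrep, show pathToTree h ν p k y = τ from hyT, hτrep]
      change (step h)^[k] l.1 = _
      rw [hl', step_iterate_itin, shift_cur hν (hTs y hyT).1 (hx.precritical hν), h2]
    by_cases hne : T.Nonempty
    · obtain ⟨y, hy⟩ := hne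
      rcases lt_trichotomy (pos w) (pos y) with hwy | hwy | hwy
      · obtain ⟨u, h1, h2, h3⟩ := exists_first_after hν hT hwT hy hwy
        exact (hpush u _ h1 (post_crit hν)
          (exists_preconnected_left hν (hTs u h1).1 (hTs u h1).2 h2 hTs h3)).elim
      · exact absurd (pos_injective hν hwy ▸ hy) hwT
      · obtain ⟨u, h1, h2, h3⟩ := exists_last_before hν hT hwT hy hwy
        exact (hpush u _ h1 post_self
          (exists_preconnected_right hν (hTs u h1).1 (hTs u h1).2 h2 hTs h3)).elim
    · refine hextend ?_ ?_ _ ⟨w, rfl⟩ hw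
      · rw [← Set.image_univ]
        exact (isPreconnected_of_convex hν fun _ _ _ _ _ _ _ => Set.mem_univ _).image _
          hcont.continuousOn
      · rintro ⟨a, ha⟩
        exact hne ⟨a, ha⟩
  have hzK : z ∈ K := mem_connectedComponentIn hz
  have hcrit : ∀ k, ((step h)^[k + 1] (.itin (crit ν)) : Pt A) = (step h)^[k] (.itin ν) :=
    fun k => rfl
  -- Consecutive images share a postcritical point. Going around the cycle, `K` contains all images,
  -- hence `τ`, a contradiction.
  have hnext : ∀ k < p, Set.range (pathToTree h ν p k) ⊆ K →
      Set.range (pathToTree h ν p ((k + 1) % p)) ⊆ K := by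
    intro k hk hkK
    refine hall _ (Nat.mod_lt _ hν.pos) ⟨_, crit_mem ν⟩ ?_
    have h1 := hkK ⟨⟨_, value_mem ν⟩, rfl⟩
    convert h1 using 1
    refine Subtype.ext ?_
    change (step h)^[(k + 1) % p] (.itin (crit ν)) = (step h)^[k] (.itin ν)
    rw [step_iterate_itin, step_iterate_itin]
    congr 1
    rw [hν.crit_eq, shift_iterate_add, hν.shift_eq_iff]
    have h2 : (k + 1) % p + (p - 1) ≡ k + 1 + (p - 1) [MOD p] := (Nat.mod_modEq _ _).add_right _
    rw [show k + 1 + (p - 1) = k + p by have := hν.pos; omega] at h2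
    exact h2.trans (by simp [Nat.ModEq])
  obtain ⟨k, hk, w, hw⟩ := exists_lt_pathToTree hν he z
  have hk0 := hall k hk w (hw ▸ hzK)
  have hcycle : ∀ j, Set.range (pathToTree h ν p ((k + j) % p)) ⊆ K := by
    intro j
    induction j with
    | zero => rwa [Nat.add_zero, Nat.mod_eq_of_lt hk]
    | succ j ih =>
      have := hnext _ (Nat.mod_lt _ hν.pos) ih
      rwa [Nat.mod_add_mod] at this
  obtain ⟨k', hk', w', hw'⟩ := exists_lt_pathToTree hν he τ
  have h1 := hcycle (p - k + k')
  rw [show k + (p - k + k') = k' + p by omega, Nat.add_mod_right, Nat.mod_eq_of_lt hk'] at h1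
  exact hτK (h1 ⟨w', hw'⟩)

theorem sameSide_cur (hν : IsStarPeriodic ν p) (hs : StarFree s) (hx : Precritical ν x) (m : ℕ) :
    SameSide ν s (cur ν s x m) x := by
  refine ⟨m, ?_⟩
  rw [track_eq_cur hν hs hx, track_eq_shift (fun i _ hi => precritical_cur hν hs hx m i hi)
    fun i hi => cur_compat hi]

/-- Sides are open and partition the complement of `τ`, so a component stays in one side.
Conversely, the components of two points on one side contain germs in directions on that side; by
`cur_eventually_eq` these germs have common points. -/
theorem connectedComponentIn_eq_arm (hν : IsStarPeriodic ν p) (he : LastSymbol ν p e)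
    (hτ : τ.1 = .itin s) (hs : StarFree s) (hz : z ≠ τ) :
    connectedComponentIn {τ}ᶜ z = arm τ z.1.rep := by
  have hτrep : τ.1.rep = s := by rw [hτ]; rfl
  have hself : ∀ {w : HubbardTree h ν p}, w ≠ τ → ¬ SameSide ν s s w.1.rep := fun {w} hw =>
    not_sameSide_self hν hs (tree_rep_precritical hν w) fun h => hw (tree_eq_of_rep hν hτ hs h)
  have hsub : ∀ {w : HubbardTree h ν p}, w ≠ τ → connectedComponentIn {τ}ᶜ w ⊆ arm τ w.1.rep := by
    intro w hw
    have h1 := isPreconnected_connectedComponentIn (x := w) (F := {τ}ᶜ)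
    have h2 : w ∈ connectedComponentIn {τ}ᶜ w := mem_connectedComponentIn hw
    refine h1.subset_left_of_subset_union (v := ⋃ u ∈ {u : HubbardTree h ν p | u ≠ τ ∧
        ¬ SameSide ν s u.1.rep w.1.rep}, arm τ u.1.rep) (isOpen_arm hν hτ hs (hself hw)) ?_ ?_ ?_
      ⟨w, h2, .refl⟩
    · exact isOpen_biUnion fun u hu => isOpen_arm hν hτ hs (hself hu.1)
    · rw [Set.disjoint_left]
      intro a ha hb
      simp only [Set.mem_iUnion] at hb
      obtain ⟨u, ⟨-, hu⟩, hau⟩ := hb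
      rw [arm, Set.mem_ofPred, hτrep] at ha hau
      exact hu (hau.symm.trans ha)
    · intro a ha
      by_cases hc : SameSide ν s a.1.rep w.1.rep
      · exact Or.inl (show SameSide ν τ.1.rep _ _ by rwa [hτrep])
      · refine Or.inr ?_
        simp only [Set.mem_iUnion]
        exact ⟨a, ⟨connectedComponentIn_subset _ _ ha, hc⟩, .refl⟩
  refine Set.Subset.antisymm (hsub hz) fun w hw => ?_
  rw [arm, Set.mem_ofPred, hτrep] at hw
  have hwτ : w ≠ τ := by
    rintro rfl
    rw [hτrep] at hw
    exact hself hz hw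
  obtain ⟨x, hx, M, hM⟩ := exists_germ_in_component hν he hτ hs hz
  obtain ⟨x', hx', M', hM'⟩ := exists_germ_in_component hν he hτ hs hwτ
  have hgerm : ∀ {v : HubbardTree h ν p} {x m}, v ≠ τ → Post ν x →
      (∃ y ∈ connectedComponentIn {τ}ᶜ v, y.1 = .itin (cur ν s x m)) →
      SameSide ν s x v.1.rep := by
    rintro v x m hv hx ⟨y, hy, hy'⟩
    have h1 := hsub hv hy
    rw [arm, Set.mem_ofPred, hτrep, hy'] at h1
    exact (sameSide_cur hν hs (hx.precritical hν) m).symm.trans h1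
  have h1 : SameSide ν s x x' := (hgerm hz hx (hM M le_rfl)).trans
    (hw.symm.trans (hgerm hwτ hx' (hM' M' le_rfl)).symm)
  obtain ⟨x'', hx'', hns⟩ : ∃ x'', Post ν x'' ∧ ¬ SameSide ν s x'' x := by
    obtain ⟨a, b, ha, hb, hab⟩ := exists_not_sameSide hν hτ hs
    by_cases hax : SameSide ν s a x
    · exact ⟨b, hb, fun h => hab (hax.trans h.symm)⟩
    · exact ⟨a, ha, hax⟩
  obtain ⟨N, hN⟩ := cur_eventually_eq hν he hs hx hx' hx'' h1 hns
  obtain ⟨y, hy, hy1⟩ := hM (max N (max M M')) (by omega)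
  obtain ⟨y', hy', hy1'⟩ := hM' (max N (max M M')) (by omega)
  have h2 : y = y' := Subtype.ext (by rw [hy1, hy1', hN _ (le_max_left _ _)])
  subst h2
  rw [connectedComponentIn_eq hy, ← connectedComponentIn_eq hy']
  exact mem_connectedComponentIn hwτ

/-- The branches are the sets of points on the sides of the postcritical points. -/
theorem arms_eq (hν : IsStarPeriodic ν p) (he : LastSymbol ν p e)
    (hτ : τ.1 = .itin s) (hs : StarFree s) : arms τ = {G | ∃ x, Post ν x ∧ G = arm τ x} := by
  have hτrep : τ.1.rep = s := by rw [hτ]; rfl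
  ext G
  constructor
  · rintro ⟨z, hz, rfl⟩
    obtain ⟨x, hx, M, hM⟩ := exists_germ_in_component hν he hτ hs hz
    obtain ⟨y, hy, hy'⟩ := hM M le_rfl
    rw [connectedComponentIn_eq_arm hν he hτ hs hz] at hy ⊢
    rw [arm, Set.mem_ofPred, hy', hτrep] at hy
    refine ⟨x, hx, Set.ext fun w => ?_⟩
    have h1 := (sameSide_cur hν hs (hx.precritical hν) M).symm.trans hy
    rw [arm, arm, Set.mem_ofPred, Set.mem_ofPred, hτrep]
    exact ⟨fun h => h.trans h1.symm, fun h => h.trans h1⟩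
  · rintro ⟨x, hx, rfl⟩
    obtain ⟨z, hz⟩ := exists_post_point h p hx
    have hzτ : z ≠ τ := by
      rintro rfl
      rw [hτ] at hz
      injection hz with hz
      obtain ⟨i, hi⟩ := hx.exists_star hν
      exact hs i (hz ▸ hi)
    refine ⟨z, hzτ, ?_⟩
    rw [connectedComponentIn_eq_arm hν he hτ hs hzτ, hz]
    rfl

theorem arm_eq_iff (hτ : τ.1 = .itin s) (hx : Post ν x) :
    arm τ x = arm τ y ↔ SameSide ν s x y := by
  have hτrep : τ.1.rep = s := by rw [hτ]; rfl
  constructor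
  · intro heq
    obtain ⟨z, hz⟩ := exists_post_point h p hx
    have h1 : z ∈ arm τ x := by rw [arm, Set.mem_ofPred, hz]; exact .refl
    rw [heq, arm, Set.mem_ofPred, hz, hτrep] at h1
    exact h1
  · intro h1
    ext w
    rw [arm, arm, Set.mem_ofPred, Set.mem_ofPred, hτrep]
    exact ⟨fun h => h.trans h1, fun h => h.trans h1.symm⟩

theorem treeMap_iterate_coe (n : ℕ) (z : HubbardTree h ν p) :
    (treeMap^[n] z).1 = (step h)^[n] z.1 := by
  induction n with
  | zero => rfl
  | succ n ih => rw [Function.iterate_succ_apply', Function.iterate_succ_apply', ← ih]; rfl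

theorem treeMap_iterate_itin (hτ : τ.1 = .itin s) (n : ℕ) :
    (treeMap^[n] τ).1 = .itin (shift^[n] s) := by
  rw [treeMap_iterate_coe, hτ, step_iterate_itin]

/-- The first `n` entries of the precritical end of a point near `τ` are `⋆` or those of `s`, so
following it for `n` steps is the actual dynamics. -/
theorem localArmMap (hν : IsStarPeriodic ν p) (hτ : τ.1 = .itin s) (n : ℕ) (x : Itin A) :
    LocalArmMap n τ (arm τ x) (arm (treeMap^[n] τ) (track ν s x n)) := by
  have hτrep : τ.1.rep = s := by rw [hτ]; rfl
  rw [LocalArmMap, eventually_nhdsWithin_iff]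
  have hmem : τ ∈ {z : HubbardTree h ν p | ∀ i < n, z.1.rep i = none ∨ z.1.rep i = s i} :=
    fun i _ => Or.inr (by rw [hτrep])
  filter_upwards [(isOpen_cylinder hν h s n).mem_nhds hmem] with z hz hzx
  rw [arm, Set.mem_ofPred, hτrep] at hzx
  rw [arm, Set.mem_ofPred, treeMap_iterate_itin hτ, treeMap_iterate_coe, step_iterate_rep]
  change SameSide ν (shift^[n] s) _ _
  rw [← track_eq_shift (fun i _ hi => tree_rep_precritical hν z i hi) hz]
  exact (sameSide_track n).2 hzx

end tree

/-! ### Counting and permuting the arms -/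

/-- The sides of the postcritical points seen from `s`, labelled by `L`. -/
structure Labeling [One A] (ν s : Itin A) {L : Type*} (l : Itin A → L) : Prop where
  surj : ∀ a, ∃ x, Post ν x ∧ l x = a
  eq_iff : ∀ x y, Post ν x → Post ν y → (l x = l y ↔ SameSide ν s x y)

section labels

variable [One A] {ν s s' x y c : Itin A} {p q m n k N : ℕ} {e : A} {h : FatouMaps A}
  {τ z z' : HubbardTree h ν p} {L : Type*} {l : Itin A → L} {g : Equiv.Perm L}

theorem Labeling.exists_equiv (hl : Labeling ν s l) (hν : IsStarPeriodic ν p)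
    (he : LastSymbol ν p e) (hτ : τ.1 = .itin s) (hs : StarFree s) :
    ∃ E : L ≃ arms τ, ∀ x, Post ν x → (E (l x) : Set (HubbardTree h ν p)) = arm τ x := by
  have harms := arms_eq hν he hτ hs
  choose f hf hlf using hl.surj
  let F : L → arms τ := fun a => ⟨arm τ (f a), by rw [harms]; exact ⟨_, hf a, rfl⟩⟩
  have hF : ∀ x, Post ν x → (F (l x) : Set (HubbardTree h ν p)) = arm τ x := fun x hx =>
    (arm_eq_iff hτ (hf _)).2 ((hl.eq_iff _ _ (hf _) hx).1 (hlf _))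
  have hbij : Function.Bijective F := by
    constructor
    · intro a b hab
      have h1 : arm τ (f a) = arm τ (f b) := congrArg Subtype.val hab
      rw [arm_eq_iff hτ (hf a), ← hl.eq_iff _ _ (hf a) (hf b), hlf, hlf] at h1
      exact h1
    · rintro ⟨G, hG⟩
      obtain ⟨x, hx, rfl⟩ := harms ▸ hG
      exact ⟨l x, Subtype.ext (hF x hx)⟩
  exact ⟨Equiv.ofBijective F hbij, hF⟩

theorem Labeling.encard_arms (hl : Labeling ν s l) (hν : IsStarPeriodic ν p)
    (he : LastSymbol ν p e) (hτ : τ.1 = .itin s) (hs : StarFree s) :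
    (arms τ).encard = ENat.card L := by
  obtain ⟨E, -⟩ := hl.exists_equiv hν he hτ hs
  exact (ENat.card_congr E).symm

/-- What `q` steps of tracking do to labels, the return map does to local arms; the rest of the
classification is a computation with labels. -/
theorem Labeling.exists_returnPermutes (hl : Labeling ν s l) (hν : IsStarPeriodic ν p)
    (he : LastSymbol ν p e) (hτ : τ.1 = .itin s) (hs : StarFree s)
    (hN : Function.minimalPeriod treeMap τ = N) (hg : ∀ x, Post ν x → l (track ν s x N) = g (l x)) :
    ∃ E : L ≃ arms τ, (∀ x, Post ν x → (E (l x) : Set (HubbardTree h ν p)) = arm τ x) ∧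
      ReturnPermutes τ (E.permCongr g) := by
  obtain ⟨E, hE⟩ := hl.exists_equiv hν he hτ hs
  refine ⟨E, hE, fun G => ?_⟩
  obtain ⟨a, rfl⟩ := E.surjective G
  obtain ⟨x, hx, rfl⟩ := hl.surj a
  have hper : treeMap^[N] τ = τ := by rw [← hN]; exact Function.iterate_minimalPeriod
  rw [hN, Equiv.permCongr_apply, E.symm_apply_apply, ← hg x hx, hE x hx, hE _ (hx.track_mem N)]
  have := localArmMap hν hτ N x
  rwa [hper] at this

theorem sameCycle_permCongr {α β : Type*} (E : α ≃ β) {g : Equiv.Perm α} {a b : α}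
    (hab : g.SameCycle a b) : (E.permCongr g).SameCycle (E a) (E b) := by
  obtain ⟨i, hi⟩ := hab
  refine ⟨i, ?_⟩
  have h1 : (E.permCongr g) ^ i = E.permCongr (g ^ i) := (map_zpow E.permCongrHom g i).symm
  rw [h1, Equiv.permCongr_apply, E.symm_apply_apply, hi]

/-- A labelling at `ω` induces one at the points of the orbit of `ω`. -/
theorem Labeling.orbit {ω : Itin A} (hl : Labeling ν ω l) (hper : shift^[q] ω = ω) (hq : 0 < q)
    (hg : ∀ x, Post ν x → l (track ν ω x q) = g (l x)) (k : ℕ) :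
    ∃ l' : Itin A → L, Labeling ν (shift^[k] ω) l' ∧
      ∀ x, Post ν x → l' (track ν (shift^[k] ω) x q) = g (l' x) := by
  have hperk : ∀ j, shift^[q * j] ω = ω := fun j => by
    induction j with
    | zero => rfl
    | succ j ih => rw [Nat.mul_succ, ← shift_iterate_add, hper, ih]
  have hgk : ∀ j x, Post ν x → l (track ν ω x (q * j)) = (g ^ j) (l x) := fun j => by
    induction j with
    | zero => intro x _; rfl
    | succ j ih =>
      intro x hx
      rw [Nat.mul_succ, track_add, hperk, hg _ (hx.track_mem _), ih x hx, pow_succ']; rfl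
  -- With `k + K = q * k`, another `K` steps lead from `shift^[k] ω` back to `ω`, where the given
  -- labels are used.
  obtain ⟨K, hK⟩ := Nat.exists_eq_add_of_le (Nat.le_mul_of_pos_left k hq)
  have hKω : shift^[K] (shift^[k] ω) = ω := by
    rw [shift_iterate_add, Nat.add_comm, ← hK, hperk]
  refine ⟨fun x => l (track ν (shift^[k] ω) x K), ⟨fun a => ?_, fun x y hx hy => ?_⟩,
    fun x hx => ?_⟩
  · obtain ⟨x, hx, hxa⟩ := hl.surj ((g ^ k).symm a)
    refine ⟨track ν ω x k, hx.track_mem k, ?_⟩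
    rw [← track_add, ← hK, hgk k x hx, hxa, Equiv.apply_symm_apply]
  · rw [hl.eq_iff _ _ (hx.track_mem K) (hy.track_mem K), ← sameSide_track (τ := shift^[k] ω) K, hKω]
  · have hqk : shift^[q] (shift^[k] ω) = shift^[k] ω := by rw [shift_iterate_comm, hper]
    have h1 : track ν (shift^[k] ω) (track ν (shift^[k] ω) x q) K =
        track ν ω (track ν (shift^[k] ω) x K) q := by
      have h2 := track_add (ν := ν) (τ := shift^[k] ω) (x := x) q K
      have h3 := track_add (ν := ν) (τ := shift^[k] ω) (x := x) K q
      rw [hqk] at h2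
      rw [hKω] at h3
      rw [← h2, ← h3, Nat.add_comm]
    beta_reduce
    rw [h1, hg _ (hx.track_mem K)]

theorem minimalPeriod_treeMap (hτ : τ.1 = .itin s) :
    Function.minimalPeriod treeMap τ = Function.minimalPeriod shift s := by
  have hiff : ∀ n, Function.IsPeriodicPt treeMap n τ ↔ Function.IsPeriodicPt shift n s := by
    intro n
    change treeMap^[n] τ = τ ↔ shift^[n] s = s
    have h1 : treeMap^[n] τ = τ ↔ (treeMap^[n] τ).1 = τ.1 := Subtype.ext_iff
    rw [h1, treeMap_iterate_itin hτ, hτ, Pt.itin.injEq]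
  apply Nat.dvd_antisymm
  · rw [← Function.isPeriodicPt_iff_minimalPeriod_dvd, hiff]
    exact Function.isPeriodicPt_minimalPeriod _ _
  · rw [← Function.isPeriodicPt_iff_minimalPeriod_dvd, ← hiff]
    exact Function.isPeriodicPt_minimalPeriod _ _

theorem noncriticalPeriodic (hτ : τ.1 = .itin s) (hs : StarFree s)
    (hq : 0 < Function.minimalPeriod shift s) : NoncriticalPeriodic τ := by
  refine ⟨?_, fun k hk => ?_⟩
  · rw [← Function.minimalPeriod_pos_iff_mem_periodicPts, minimalPeriod_treeMap hτ]
    exact hq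
  · have h1 := congrArg Subtype.val hk
    rw [treeMap_iterate_itin hτ] at h1
    have h2 : shift^[k] s = crit ν := by injection h1
    exact hs.shift_iterate k 0 (h2 ▸ rfl)

/-- The labels of the sides at the lower sequence if the critical point is mapped to the critical
value. -/
theorem exists_labeling_of_value (hν : IsStarPeriodic ν p)
    (hq : Function.minimalPeriod shift (fill e ν) = q)
    (hB : track ν (fill e ν) (crit ν) q = ν) :
    ∃ l : Itin A → ZMod (p / q), Labeling ν (fill e ν) l ∧
      ∀ x, Post ν x → l (track ν (fill e ν) x q) = Equiv.addRight 1 (l x) := by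
  classical
  have hm : NeZero (p / q) := ⟨(Nat.div_pos (Nat.le_of_dvd hν.pos (period_dvd hν hq))
    (period_pos hν hq)).ne'⟩
  -- The default `0` does not occur at postcritical points, by `exists_sameSide_of_value`.
  let l : Itin A → ZMod (p / q) := fun x =>
    if hx : ∃ s, SameSide ν (fill e ν) x (shift^[s * q] ν) then (hx.choose : ZMod (p / q)) else 0
  have hl : ∀ {x s}, SameSide ν (fill e ν) x (shift^[s * q] ν) → l x = s := by
    intro x s hxs
    have hx : ∃ s, SameSide ν (fill e ν) x (shift^[s * q] ν) := ⟨s, hxs⟩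
    have h1 : l x = hx.choose := dif_pos hx
    rw [h1, ZMod.natCast_eq_natCast_iff]
    exact (sameSide_cycle_iff hν hq).1 (hx.choose_spec.symm.trans hxs)
  refine ⟨l, ⟨fun a => ⟨shift^[a.val * q] ν, ⟨_, rfl⟩, ?_⟩, fun x y hx hy => ?_⟩, fun x hx => ?_⟩
  · rw [hl .refl, ZMod.natCast_zmod_val]
  · obtain ⟨a, ha⟩ := exists_sameSide_of_value hν hq hB hx
    obtain ⟨b, hb⟩ := exists_sameSide_of_value hν hq hB hy
    rw [hl ha, hl hb, ZMod.natCast_eq_natCast_iff, ← sameSide_cycle_iff hν hq (e := e)]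
    exact ⟨fun h => ha.trans (h.trans hb.symm), fun h => ha.symm.trans (h.trans hb)⟩
  · obtain ⟨a, ha⟩ := exists_sameSide_of_value hν hq hB hx
    have h1 : SameSide ν (fill e ν) (track ν (fill e ν) x q) (shift^[(a + 1) * q] ν) := by
      have h2 := (sameSide_track_fill hq (i := q) dvd_rfl).2 ha
      rw [track_fill_post hν hq ⟨a, Nat.mul_comm _ _⟩] at h2
      rwa [Nat.add_mul, Nat.one_mul, Nat.add_comm]
    rw [hl ha, hl h1]
    simp

/-- The labels of the sides at the lower sequence if the side of the critical point is fixed. -/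
theorem exists_labeling_of_crit (hν : IsStarPeriodic ν p) (he : LastSymbol ν p e)
    (hq : Function.minimalPeriod shift (fill e ν) = q)
    (hA : SameSide ν (fill e ν) (track ν (fill e ν) (crit ν) q) (crit ν)) :
    ∃ l : Itin A → Option (ZMod (p / q)), Labeling ν (fill e ν) l ∧ l (crit ν) = none ∧
      ∀ x, Post ν x → l (track ν (fill e ν) x q) = (Equiv.addRight 1).optionCongr (l x) := by
  classical
  have hm : NeZero (p / q) := ⟨(Nat.div_pos (Nat.le_of_dvd hν.pos (period_dvd hν hq))
    (period_pos hν hq)).ne'⟩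
  -- Here the default `none` is the label of the critical side, which is outside the cycle.
  let l : Itin A → Option (ZMod (p / q)) := fun x =>
    if hx : ∃ s, SameSide ν (fill e ν) x (shift^[s * q] ν) then
      some (hx.choose : ZMod (p / q)) else none
  have hl : ∀ {x s}, SameSide ν (fill e ν) x (shift^[s * q] ν) → l x = some (s : ZMod (p / q)) := by
    intro x s hxs
    have hx : ∃ s, SameSide ν (fill e ν) x (shift^[s * q] ν) := ⟨s, hxs⟩
    have h1 : l x = some (hx.choose : ZMod (p / q)) := dif_pos hx
    rw [h1, Option.some_inj, ZMod.natCast_eq_natCast_iff]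
    exact (sameSide_cycle_iff hν hq).1 (hx.choose_spec.symm.trans hxs)
  have hl' : ∀ {x}, SameSide ν (fill e ν) x (crit ν) → l x = none := fun {x} hx =>
    dif_neg (by
      rintro ⟨s, hs⟩
      exact not_sameSide_crit_cycle hν he hq hA s (hx.symm.trans hs))
  have hcases := fun {x} (hx : Post ν x) => sameSide_cycle_or_crit hν hq hA hx
  refine ⟨l, ⟨fun a => ?_, fun x y hx hy => ?_⟩, hl' .refl, fun x hx => ?_⟩
  · cases a with
    | none => exact ⟨crit ν, post_crit hν, hl' .refl⟩
    | some a =>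
      exact ⟨shift^[a.val * q] ν, ⟨_, rfl⟩, by rw [hl .refl, ZMod.natCast_zmod_val]⟩
  · rcases hcases hx with ⟨a, ha⟩ | ha <;> rcases hcases hy with ⟨b, hb⟩ | hb
    · rw [hl ha, hl hb, Option.some_inj, ZMod.natCast_eq_natCast_iff,
        ← sameSide_cycle_iff hν hq (e := e)]
      exact ⟨fun h => ha.trans (h.trans hb.symm), fun h => ha.symm.trans (h.trans hb)⟩
    · rw [hl ha, hl' hb]
      refine ⟨fun h => by simp at h, fun h => ?_⟩
      exact absurd (hb.symm.trans (h.symm.trans ha)) (not_sameSide_crit_cycle hν he hq hA a)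
    · rw [hl' ha, hl hb]
      refine ⟨fun h => by simp at h, fun h => ?_⟩
      exact absurd (ha.symm.trans (h.trans hb)) (not_sameSide_crit_cycle hν he hq hA b)
    · rw [hl' ha, hl' hb]
      exact ⟨fun _ => ha.trans hb.symm, fun _ => rfl⟩
  · rcases hcases hx with ⟨a, ha⟩ | ha
    · have h1 : SameSide ν (fill e ν) (track ν (fill e ν) x q) (shift^[(a + 1) * q] ν) := by
        have h2 := (sameSide_track_fill hq (i := q) dvd_rfl).2 ha
        rw [track_fill_post hν hq ⟨a, Nat.mul_comm _ _⟩] at h2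
        rwa [Nat.add_mul, Nat.one_mul, Nat.add_comm]
      rw [hl ha, hl h1]
      simp
    · have h1 : SameSide ν (fill e ν) (track ν (fill e ν) x q) (crit ν) :=
        ((sameSide_track_fill hq (i := q) dvd_rfl).2 ha).trans hA
      rw [hl' ha, hl' h1]
      rfl

theorem exists_pow_addRight_one {m : ℕ} [NeZero m] (a b : ZMod m) :
    ∃ n : ℕ, ((Equiv.addRight (1 : ZMod m)) ^ n) a = b := by
  have h1 : ∀ n : ℕ, ((Equiv.addRight (1 : ZMod m)) ^ n) a = a + n := fun n => by
    induction n with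
    | zero => simp
    | succ n ih =>
      rw [pow_succ', Equiv.Perm.mul_apply, ih, Equiv.coe_addRight]; push_cast; ring
  refine ⟨(b - a).val, ?_⟩
  rw [h1, ZMod.natCast_zmod_val]
  ring

theorem optionCongr_pow {α : Type*} (g : Equiv.Perm α) (n : ℕ) (a : α) :
    ((Equiv.optionCongr g : Equiv.Perm (Option α)) ^ n) (some a) = some ((g ^ n) a) := by
  induction n with
  | zero => rfl
  | succ n ih => rw [pow_succ', pow_succ', Equiv.Perm.mul_apply, ih]; rfl

/-! ### The three types of orbits -/

theorem isCharacteristic (hν : IsStarPeriodic ν p) (he : LastSymbol ν p e)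
    (hτ : τ.1 = .itin (fill e ν)) : IsCharacteristic τ := by
  refine ⟨arm τ (crit ν), ?_, ?_, fun n hn => ?_, fun hv => ?_⟩
  · rw [arms_eq hν he hτ starFree_fill]; exact ⟨_, post_crit hν, rfl⟩
  · exact SameSide.refl
  · rw [arm, Set.mem_ofPred, treeMap_iterate_itin hτ, hτ]
    refine sameSide_crit_of_ne hν fun h => hn (Subtype.ext ?_)
    rw [treeMap_iterate_itin hτ, hτ, h]
  · rw [arm, Set.mem_ofPred, hτ] at hv
    exact not_sameSide_fill hν he (post_crit hν) (crit_ne_self hν) hv.symm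

theorem periodData (hν : IsStarPeriodic ν p) (hτ : τ.1 = .itin (fill e ν))
    (hq : Function.minimalPeriod shift (fill e ν) = q) (k : ℕ) :
    (treeMap^[k] τ).1 = .itin (shift^[k] (fill e ν)) ∧ StarFree (shift^[k] (fill e ν)) ∧
      Function.minimalPeriod treeMap (treeMap^[k] τ) = q := by
  refine ⟨treeMap_iterate_itin hτ k, starFree_fill.shift_iterate k, ?_⟩
  rw [Function.minimalPeriod_apply_iterate, minimalPeriod_treeMap hτ, hq]
  rw [← Function.minimalPeriod_pos_iff_mem_periodicPts, minimalPeriod_treeMap hτ, hq]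
  exact period_pos hν hq

theorem neZero_quotient (hν : IsStarPeriodic ν p)
    (hq : Function.minimalPeriod shift (fill e ν) = q) : NeZero (p / q) :=
  ⟨(Nat.div_pos (Nat.le_of_dvd hν.pos (period_dvd hν hq)) (period_pos hν hq)).ne'⟩

theorem two_le_quotient (hν : IsStarPeriodic ν p)
    (hq : Function.minimalPeriod shift (fill e ν) = q) (hqp : q < p) : 2 ≤ p / q := by
  obtain ⟨m, hm⟩ := period_dvd hν hq
  have h0 := period_pos hν hq
  rw [hm, Nat.mul_div_cancel_left _ h0]
  by_contra hlt
  have h1 : m = 0 ∨ m = 1 := by omega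
  rcases h1 with rfl | rfl
  · have := hν.pos
    omega
  · omega

theorem card_zmod_quotient (hν : IsStarPeriodic ν p)
    (hq : Function.minimalPeriod shift (fill e ν) = q) :
    ENat.card (ZMod (p / q)) = ((p / q : ℕ) : ℕ∞) ∧
      ENat.card (Option (ZMod (p / q))) = ((p / q + 1 : ℕ) : ℕ∞) := by
  have := neZero_quotient hν hq
  constructor
  · rw [ENat.card_eq_coe_fintype_card, ZMod.card]
  · rw [ENat.card_eq_coe_fintype_card, Fintype.card_option, ZMod.card]

theorem satelliteType (hν : IsStarPeriodic ν p) (he : LastSymbol ν p e)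
    (hτ : τ.1 = .itin (fill e ν)) (hq : Function.minimalPeriod shift (fill e ν) = q)
    (hqp : q < p) (hB : track ν (fill e ν) (crit ν) q = ν) :
    (arms τ).encard = ((p / q : ℕ) : ℕ∞) ∧ SatelliteType τ := by
  obtain ⟨l, hl, hlg⟩ := exists_labeling_of_value hν hq hB
  have hm := neZero_quotient hν hq
  have hcard := (card_zmod_quotient hν hq).1
  refine ⟨(hl.encard_arms hν he hτ starFree_fill).trans hcard,
    noncriticalPeriodic hτ starFree_fill (hq ▸ period_pos hν hq), fun k => ?_⟩
  obtain ⟨h1, h2, h3⟩ := periodData hν hτ hq k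
  obtain ⟨l', hl', hlg'⟩ := hl.orbit ((shift_fill_eq_iff hq).2 dvd_rfl) (period_pos hν hq) hlg k
  obtain ⟨E, -, hE⟩ := hl'.exists_returnPermutes hν he h1 h2 h3 hlg'
  refine ⟨?_, _, hE, Set.bijOn_univ.2 (Equiv.bijective _), fun G _ G' _ => ?_⟩
  · rw [hl'.encard_arms hν he h1 h2, hcard]
    exact_mod_cast two_le_quotient hν hq hqp
  · obtain ⟨a, rfl⟩ := E.surjective G
    obtain ⟨b, rfl⟩ := E.surjective G'
    obtain ⟨n, hn⟩ := exists_pow_addRight_one a b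
    exact sameCycle_permCongr E ⟨n, by rwa [zpow_natCast]⟩

theorem evilType (hν : IsStarPeriodic ν p) (he : LastSymbol ν p e)
    (hτ : τ.1 = .itin (fill e ν)) (hq : Function.minimalPeriod shift (fill e ν) = q)
    (hqp : q < p) (hA : SameSide ν (fill e ν) (track ν (fill e ν) (crit ν) q) (crit ν)) :
    (arms τ).encard = ((p / q + 1 : ℕ) : ℕ∞) ∧ EvilType τ := by
  obtain ⟨l, hl, hlc, hlg⟩ := exists_labeling_of_crit hν he hq hA
  have hm := neZero_quotient hν hq
  have hcard := (card_zmod_quotient hν hq).2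
  have hfix : ∀ {α : Type _} (E : Option (ZMod (p / q)) ≃ α),
      E.permCongr (Equiv.addRight 1).optionCongr (E none) = E none := fun E => by
    rw [Equiv.permCongr_apply, E.symm_apply_apply]; rfl
  refine ⟨(hl.encard_arms hν he hτ starFree_fill).trans hcard,
    noncriticalPeriodic hτ starFree_fill (hq ▸ period_pos hν hq), fun k => ?_, 0,
    isCharacteristic hν he hτ, ?_⟩
  · obtain ⟨h1, h2, h3⟩ := periodData hν hτ hq k
    obtain ⟨l', hl', hlg'⟩ := hl.orbit ((shift_fill_eq_iff hq).2 dvd_rfl) (period_pos hν hq) hlg k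
    obtain ⟨E, -, hE⟩ := hl'.exists_returnPermutes hν he h1 h2 h3 hlg'
    refine ⟨?_, _, hE, fun hcyc => ?_⟩
    · rw [hl'.encard_arms hν he h1 h2, hcard]
      have := two_le_quotient hν hq hqp
      exact_mod_cast Nat.succ_le_succ this
    · obtain ⟨i, hi⟩ := hcyc (E none) (E (some 0))
      rw [Function.IsFixedPt.perm_zpow (hfix E) i] at hi
      exact absurd (E.injective hi) (by simp)
  · obtain ⟨E, hE, hE'⟩ := hl.exists_returnPermutes hν he hτ starFree_fill
      ((minimalPeriod_treeMap hτ).trans hq) hlg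
    refine ⟨_, hE', E none, ?_, hfix E, ?_⟩
    · rw [← hlc, hE _ (post_crit hν)]
      exact SameSide.refl
    · have hinj := (E.permCongr (Equiv.addRight (1 : ZMod (p / q))).optionCongr).injective
      refine ⟨⟨fun G hG h => hG (hinj (h.trans (hfix E).symm)), hinj.injOn, fun G hG => ?_⟩,
        fun G hG G' hG' => ?_⟩
      · refine ⟨(E.permCongr (Equiv.addRight (1 : ZMod (p / q))).optionCongr).symm G,
          fun h => hG (((Equiv.symm_apply_eq _).1 h).trans (hfix E)), Equiv.apply_symm_apply _ _⟩
      · obtain ⟨a, rfl⟩ := E.surjective G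
        obtain ⟨b, rfl⟩ := E.surjective G'
        obtain ⟨a, rfl⟩ := Option.ne_none_iff_exists'.1 (fun h => hG (congrArg E h))
        obtain ⟨b, rfl⟩ := Option.ne_none_iff_exists'.1 (fun h => hG' (congrArg E h))
        obtain ⟨n, hn⟩ := exists_pow_addRight_one a b
        exact sameCycle_permCongr E ⟨n, by rw [zpow_natCast, optionCongr_pow, hn]⟩

/-- For `q = p` the cycle consists of the side of `ν` alone. If the critical side returned to it,
the critical point would be on the side of `ν`. -/
theorem sameSide_crit_of_period_eq (hν : IsStarPeriodic ν p) (he : LastSymbol ν p e)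
    (hq : Function.minimalPeriod shift (fill e ν) = p) :
    SameSide ν (fill e ν) (track ν (fill e ν) (crit ν) p) (crit ν) := by
  rcases track_crit_orbit hν hq with hB | hA
  · obtain ⟨s, hs⟩ := exists_sameSide_of_value hν hq hB (post_crit hν)
    rw [hν.shift_of_dvd ⟨s, Nat.mul_comm _ _⟩] at hs
    exact absurd hs (not_sameSide_fill hν he (post_crit hν) (crit_ne_self hν))
  · exact hA

theorem optionCongr_addRight_one_eq (hm : p / q = 1) :
    (Equiv.addRight (1 : ZMod (p / q))).optionCongr = Equiv.refl _ := by
  have : Subsingleton (ZMod (p / q)) := by rw [hm]; infer_instance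
  rw [Subsingleton.elim (Equiv.addRight (1 : ZMod (p / q))) (Equiv.refl _), Equiv.optionCongr_refl]

/-- The labels are `Option (ZMod 1)`: two sides, both fixed. -/
theorem primitiveType (hν : IsStarPeriodic ν p) (he : LastSymbol ν p e)
    (hτ : τ.1 = .itin (fill e ν)) (hq : Function.minimalPeriod shift (fill e ν) = p) :
    PrimitiveType τ ∧ ∀ (n : ℕ) (z : HubbardTree h ν p), treeMap^[n] z = τ →
      (arms z).encard = 2 := by
  have hA := sameSide_crit_of_period_eq hν he hq
  obtain ⟨l, hl, hlc, hlg⟩ := exists_labeling_of_crit hν he hq hA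
  have hpp : p / p = 1 := Nat.div_self hν.pos
  rw [optionCongr_addRight_one_eq hpp] at hlg
  have hcard := (card_zmod_quotient hν hq).2
  have hcard2 : ENat.card (Option (ZMod (p / p))) = 2 := by rw [hcard, hpp]; rfl
  refine ⟨⟨noncriticalPeriodic hτ starFree_fill (hq ▸ hν.pos), fun k => ?_⟩, fun n z hz => ?_⟩
  · obtain ⟨h1, h2, h3⟩ := periodData hν hτ hq k
    obtain ⟨l', hl', hlg'⟩ := hl.orbit ((shift_fill_eq_iff hq).2 dvd_rfl) hν.pos hlg k
    obtain ⟨E, -, hE⟩ := hl'.exists_returnPermutes hν he h1 h2 h3 hlg'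
    refine ⟨(hl'.encard_arms hν he h1 h2).trans hcard2, ?_⟩
    have hrefl : E.permCongr (Equiv.refl _) = Equiv.refl _ := by ext; simp
    rwa [hrefl] at hE
  · have hz1 : (step h)^[n] z.1 = .itin (fill e ν) := by rw [← treeMap_iterate_coe, hz, hτ]
    have hrep : shift^[n] z.1.rep = fill e ν := by rw [← step_iterate_rep h, hz1]; rfl
    rcases tree_rep_cases hν z with ⟨h1, h2⟩ | ⟨h1, h2⟩
    swap
    · obtain ⟨j, hj⟩ := h1.exists_star hν h2 n
      exact absurd (hrep ▸ hj) (starFree_fill j)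
    generalize z.1.rep = s at *
    have hinj : ∀ x y, Post ν x → Post ν y →
        (l (track ν s x n) = l (track ν s y n) ↔ SameSide ν s x y) := fun x y hx hy => by
      rw [hl.eq_iff _ _ (hx.track_mem n) (hy.track_mem n), ← hrep, sameSide_track]
    -- The labels after `n` steps distinguish the sides of `z`. There are at least two sides by
    -- `exists_not_sameSide`, so both labels occur.
    have hl' : Labeling ν s (fun x => l (track ν s x n)) := by
      refine ⟨fun a => ?_, hinj⟩
      obtain ⟨x, x', hx, hx', hne⟩ := exists_not_sameSide hν h2 h1
      rw [← hinj x x' hx hx'] at hne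
      have : Subsingleton (ZMod (p / p)) := by rw [hpp]; infer_instance
      by_cases hax : l (track ν s x n) = a
      · exact ⟨x, hx, hax⟩
      · refine ⟨x', hx', ?_⟩
        revert hne hax
        cases l (track ν s x n) <;> cases l (track ν s x' n) <;> cases a <;>
          simp [eq_iff_true_of_subsingleton]
    exact (hl'.encard_arms hν he h2 h1).trans hcard2

/-! ### The lower sequence -/

theorem cur_fill_value (m : ℕ) : cur ν (fill e ν) ν m = ν := by
  induction m with
  | zero => rfl
  | succ m ih => rw [cur_succ_of_compat (by rw [ih]; exact fill_compat m), ih]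

theorem isLowerSequence (hν : IsStarPeriodic ν p) (he : LastSymbol ν p e) :
    IsLowerSequence ν (fill e ν) :=
  ⟨starFree_fill, (fatou_mem_of_germ hν starFree_fill
    (not_sameSide_fill hν he (post_crit hν) (crit_ne_self hν))
    (Or.inr ⟨0, fun m _ => cur_fill_value m⟩)).1⟩

/-- From whichever side of `ω` the germ at `ν` arises, its precritical end is compatible with `ω`;
so `eq_fill_of_compat` applies. -/
theorem IsLowerSequence.eq_fill (hν : IsStarPeriodic ν p) (he : LastSymbol ν p e)
    {ω : Itin A} (hω : IsLowerSequence ν ω) : ω = fill e ν := by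
  obtain ⟨κ, hκ⟩ := hω.2 ⟨1 / 2, by norm_num⟩
  obtain ⟨h1, h2, h3⟩ := hκ.germ hν
  refine eq_fill_of_compat hν he h1 h2 fun n => ?_
  rcases h3 with ⟨M, hM⟩ | ⟨M, hM⟩
  · have := cur_compat (ν := ν) (x := crit ν) (τ := ω) (show n < max M (n + 1) by omega)
    rwa [hM _ (le_max_left _ _)] at this
  · have := cur_compat (ν := ν) (x := ν) (τ := ω) (show n < max M (n + 1) by omega)
    rwa [hM _ (le_max_left _ _)] at this

/-- From depth `q` on the critical point is followed like `ν`, without cuts, and `ν` is never cut.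
So the pair around `fill e ν` becomes constant with both ends compatible with it, which is a gap. -/
theorem isCentral_fill (hν : IsStarPeriodic ν p) (he : LastSymbol ν p e)
    (hq : Function.minimalPeriod shift (fill e ν) = q)
    (hB : track ν (fill e ν) (crit ν) q = ν) : IsCentral ν (fill e ν) := by
  obtain ⟨b, hb⟩ := exists_lies_of_sep hν (starFree_fill (e := e))
    (not_sameSide_fill hν he (post_crit hν) (crit_ne_self hν))
  have hconst : ∀ m ≥ q, cur ν (fill e ν) (crit ν) m = cur ν (fill e ν) (crit ν) q := by
    intro m hm
    refine cur_eq_of_forall (fun n hn => ?_) hm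
    obtain ⟨i, rfl⟩ := Nat.exists_eq_add_of_le hn
    rw [← track_zero_entry hν starFree_fill (precritical_crit hν), track_fill_add hq dvd_rfl, hB,
      track_fill_self hν, shift_iterate_apply, Nat.zero_add, Nat.add_comm q,
      fill_add_of_dvd hq dvd_rfl]
    exact fill_compat i
  obtain ⟨m, hm, h1, h2⟩ := hb.exists_surrounds hν q
  refine ⟨b, q, isCentralIn_iff.2 ⟨diff_eq_top_iff.2 fun i => ?_, hb⟩⟩
  rw [h2, cur_fill_value, h1, hconst m hm, ← hconst (max q (i + 1)) (le_max_left _ _)]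
  have h3 := cur_compat (ν := ν) (x := crit ν) (τ := fill e ν) (show i < max q (i + 1) by omega)
  have h4 := fill_compat (e := e) (ν := ν) i
  rcases h3 with h3 | h3
  · exact Or.inl h3
  · rcases h4 with h4 | h4
    · exact Or.inr (Or.inl h4)
    · exact Or.inr (Or.inr (h3.trans h4.symm))

/-- In a gap the surrounding pair is constant and agrees with the sequence in it up to `⋆`s, so from
some time on the tracks meet no differences, as `track_crit_of_gap` requires. -/
theorem exists_bifurcation_of_gap (hν : IsStarPeriodic ν p) (he : LastSymbol ν p e)
    (hq : Function.minimalPeriod shift (fill e ν) = q) {b : ℕ → Bool}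
    (hg : IsGap (arc ν b n)) : IsStandardBifurcation ν p q := by
  obtain ⟨s, hs⟩ := exists_lies hν b
  obtain ⟨M, hM⟩ := hs.exists_surrounds_ge hν n
  have hfit := fun i => hs.2 n i (agree_of_diff_eq_top hg i)
  have hcur : ∀ m ≥ M, (arc ν b n).l = cur ν s (crit ν) m ∧ (arc ν b n).r = cur ν s ν m := by
    intro m hm
    obtain ⟨n', hn', h1⟩ := hM m hm
    rwa [Surrounds, arc_eq_of_gap hg hn'] at h1
  obtain ⟨h1, h2⟩ := track_crit_of_gap hν he hq hs.1 (hs.not_sameSide hν) (M := M)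
    (fun m hm => by
      rw [track_zero_entry hν hs.1 (precritical_crit hν), ← (hcur m hm).1]
      exact (hfit m).2.1)
    (fun m hm => by
      rw [track_zero_entry hν hs.1 (post_self.precritical hν), ← (hcur m hm).2]
      exact (hfit m).2.2)
  exact ⟨⟨period_dvd hν hq, h1, e, hq⟩, (internalAddress_iff hν (period_pos hν hq) h1).2 h2⟩

theorem IsBifurcation.eq_period (hν : IsStarPeriodic ν p) (he : LastSymbol ν p e)
    (hb : IsBifurcation ν p q) : Function.minimalPeriod shift (fill e ν) = q := by
  obtain ⟨-, h1, e', h2⟩ := hb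
  rwa [← eq_of_minimalPeriod_lt hν he h2 h1]

theorem period_eq_of_not_bifurcation (hν : IsStarPeriodic ν p) (e : A)
    (hb : ¬ ∃ q, IsBifurcation ν p q) : Function.minimalPeriod shift (fill e ν) = p := by
  have h1 := period_dvd hν (e := e) rfl
  by_contra hne
  exact hb ⟨_, h1, lt_of_le_of_ne (Nat.le_of_dvd hν.pos h1) hne, e, rfl⟩

end labels

end Kneading

/-- The alphabet is `ZMod d`, i.e. `ℤ/dℤ` for the degrees `d ≥ 2`, and `ℤ` for `d = 0`, which stands
for the degree `∞`. -/
theorem mainTheorem6 (d : ℕ) (hd : d ≠ 1) (h : FatouMaps (ZMod d))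
    (ν : Itin (ZMod d)) (p : ℕ) (hν : IsStarPeriodic ν p) :
    ∃ ω : Itin (ZMod d), (IsLowerSequence ν ω ∧ ∀ ω', IsLowerSequence ν ω' → ω' = ω) ∧
      ∃ τ : HubbardTree h ν p, τ.1 = Pt.itin ω ∧
        IsCharacteristic τ ∧
        ((¬ ∃ q, IsBifurcation ν p q) →
          Function.minimalPeriod treeMap τ = p ∧
          PrimitiveType τ ∧
          ∀ (n : ℕ) (z : HubbardTree h ν p), treeMap^[n] z = τ → (arms z).encard = 2) ∧
        (∀ q, IsStandardBifurcation ν p q →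
          Function.minimalPeriod treeMap τ = q ∧
          IsCentral ν ω ∧
          (arms τ).encard = ((p / q : ℕ) : ℕ∞) ∧
          SatelliteType τ) ∧
        (∀ q, IsNonstandardBifurcation ν p q →
          Function.minimalPeriod treeMap τ = q ∧
          (arms τ).encard = ((p / q + 1 : ℕ) : ℕ∞) ∧
          EvilType τ) ∧
        ((∃ b n, IsGap (arc ν b n)) → ∃ q, IsStandardBifurcation ν p q) := by
  obtain ⟨e, he⟩ := exists_lastSymbol hν
  have hlow := isLowerSequence hν he
  obtain ⟨κ, hκ⟩ := mem_critPath_of_sep hν (starFree_fill (e := e))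
    (not_sameSide_fill hν he (post_crit hν) (crit_ne_self hν))
  let τ : HubbardTree h ν p := ⟨_, 0, ⟨_, κ, hκ⟩, rfl⟩
  have hτ : τ.1 = .itin (fill e ν) := rfl
  have hmin : Function.minimalPeriod treeMap τ = Function.minimalPeriod shift (fill e ν) :=
    minimalPeriod_treeMap hτ
  refine ⟨fill e ν, ⟨hlow, fun ω' hω' => hω'.eq_fill hν he⟩, τ, hτ, isCharacteristic hν he hτ,
    fun hb => ?_, fun q hb => ?_, fun q hb => ?_, fun hg => ?_⟩
  · have hq := period_eq_of_not_bifurcation hν e hb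
    exact ⟨hmin.trans hq, primitiveType hν he hτ hq⟩
  · have hq := hb.1.eq_period hν he
    have hqp := hb.1.2.1
    have hB := (internalAddress_iff hν (e := e) (period_pos hν hq) hqp).1 hb.2
    exact ⟨hmin.trans hq, isCentral_fill hν he hq hB, satelliteType hν he hτ hq hqp hB⟩
  · have hq := hb.1.eq_period hν he
    have hqp := hb.1.2.1
    have hA := (track_crit_orbit hν hq).resolve_left fun hB =>
      hb.2 ((internalAddress_iff hν (period_pos hν hq) hqp).2 hB)
    exact ⟨hmin.trans hq, evilType hν he hτ hq hqp hA⟩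
  · obtain ⟨b, n, hg⟩ := hg
    exact ⟨_, exists_bifurcation_of_gap hν he rfl hg⟩
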